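/- Let $N\ge 2$ and let $\kappa_N=(-1)^{N/2+1}$ if $N$ is even, $\kappa_N\in\{1,-1\}$ if $N$ is odd. Let $\mathcal L=\partial_x^N+u_{N-2}(x)\partial_x^{N-2}+\cdots+u_0(x)$, where $u_0,\dots,u_{N-2}$ are smooth complex-valued functions on an open set $I\subseteq\mathbb R$. Put $$A_N(z)=\frac1{2\pi i}\int_{c-i\infty}^{c+i\infty}e^{z\xi+\kappa_N\xi^N}\,d\xi ,$$ with $c=0$ if $N$ is even, and, if $N$ is odd, $c=1$ when $\kappa_N=(-1)^{(N+1)/2}$ and $c=-1$ when $\kappa_N=(-1)^{(N-1)/2}$. The Hadamard coefficients $H_k^j(x,y)$ ($k\ge1$, $0\le j\le N-2$) of $\partial_t v=\kappa_N\mathcal L v$ are functions, smooth near the diagonal $y=x\in I$, such that for fixed $y$ $$\frac1{t^{1/N}}A_N\Big(\frac{x-y}{t^{1/N}}\Big)+\sum_{j=0}^{N-2}\frac1{t^{(j+1)/N}}A_N^{(j)}\Big(\frac{x-y}{t^{1/N}}\Big)\sum_{k\ge1}H_k^j(x,y)t^k\qquad(t>0)$$ is a formal solution of this equation, i.e. for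 every $n\ge 0$ and all $(x,y)$ in some neighbourhood of the diagonal, $\partial_t-\kappa_N\mathcal L$ maps the sum of the terms with $k\le n$ to an expression of the form $\sum_{j=0}^{N-2}G_j(x,y)\,t^{n-(j+1)/N}A_N^{(j)}\big((x-y)/t^{1/N}\big)$, $t>0$. In the ring of formal pseudo-differential operators $R=\sum_{i\le m}r_i\partial_x^i$, let $R_+=\sum_{i\ge0}r_i\partial_x^i$ and $\mathrm{res}_{\partial_x}R=r_{-1}$. There is a unique operator $\mathcal L^{1/N}=\partial_x+\sum_{i\le0}p_i\partial_x^i$ with $(\mathcal L^{1/N})^N=\mathcal L$; put $\mathcal L^{m/N}=(\mathcal L^{1/N})^m$ for $m\in\mathbb N$. Let $(a)_k=a(a+1)\cdots(a+k-1)$. Then, for all $k\ge1$, $j\in\{0,\dots,N-2\}$ and $x\in I$, $$H_k^j(x,x)=\frac{\kappa_N^k}{(1-(j+1)/N)_k}\,\mathrm{res}_{\partial_x}\mathcal L^{k-(j+1)/N}.$$ Therefore the functionals $J_{k,j}=\int H_k^j(x,x)\,dx$ are first integrals of all equations $\partial\mathcal L/\partial s_m=[(\mathcal L^{m/N})_+,\mathcal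 L]$, $m\ge1$, of the $N$-th Gelfand–Dickey hierarchy, in both of the following senses. (a) $H_k^j(x,x)$ is the value at $u_0,\dots,u_{N-2}$ of the differential polynomial $h_{k,j}=\frac{\kappa_N^k}{(1-(j+1)/N)_k}\mathrm{res}_{\partial_x}\mathcal L^{k-(j+1)/N}$ (with the $u_i$ now indeterminates). For every $m\ge 1$ the equation $\partial\mathcal L/\partial s_m=[(\mathcal L^{m/N})_+,\mathcal L]$ defines a derivation $\partial/\partial s_m$ of the ring of complex differential polynomials in $u_0,\dots,u_{N-2}$ which commutes with $\partial_x$, and $\partial h_{k,j}/\partial s_m$ is the total $x$-derivative of a differential polynomial. (b) Let $m\ge1$, let $T\subseteq\mathbb R$ be an open interval, let $u_0(x,s),\dots,u_{N-2}(x,s)$ be a smooth solution of the $m$-th equation for $x\in\mathbb R$, $s=s_m\in T$, and let $H_k^j(x,y;s)$ be the Hadamard coefficients of the corresponding operators. If all the functions $\partial_x^iu_l(x,s)$ decay as $|x|\to\infty$ faster than every power of $|x|$, locally uniformly in $s\in T$, then $x\mapsto H_k^j(x,x;s)$ is integrable and $\int_{\mathbb R}H_k^j(x,x;s)\,dx$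 does not depend on $s\in T$. If all $u_l$ are $p$-periodic in $x$, then $\int_a^{a+p}H_k^j(x,x;s)\,dx$ does not depend on $s\in T$, for every $a\in\mathbb R$. -/

import Mathlib

open scoped ContDiff

namespace GelfandDickey

noncomputable section

/-! ### Formal pseudo-differential operators over a commutative differential ring -/

/-- A formal pseudo-differential operator `∑_{n ≤ m} r_n ∂ⁿ` with coefficients in `R`. -/
@[ext]
structure PsDO (R : Type*) [CommRing R] where
  coeff : ℤ → R
  bounded : ∃ m : ℤ, ∀ n, m < n → coeff n = 0

/-- The `i`-th iterated derivative in a differential ring. -/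
def dIter {R : Type*} [CommRing R] [Differential R] (i : ℕ) (f : R) : R :=
  (fun g : R => Differential.deriv g)^[i] f

theorem dIter_zero {R : Type*} [CommRing R] [Differential R] (i : ℕ) :
    dIter i (0 : R) = 0 := by
  induction i with
  | zero => rfl
  | succ i ih => simpa only [dIter, Function.iterate_succ_apply, map_zero] using ih

namespace PsDO

variable {R : Type*} [CommRing R]

/-- The identity operator `∂⁰`. -/
instance : One (PsDO R) where
  one := ⟨fun n => if n = 0 then 1 else 0, 0, fun n hn => if_neg (by omega)⟩

instance : Sub (PsDO R) where
  sub P Q := ⟨fun n => P.coeff n - Q.coeff n, by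
    obtain ⟨a, ha⟩ := P.bounded
    obtain ⟨b, hb⟩ := Q.bounded
    refine ⟨max a b, fun n hn => ?_⟩
    rw [ha n (by omega), hb n (by omega), sub_zero]⟩

/-- The differential operator part `P₊`. -/
def plus (P : PsDO R) : PsDO R where
  coeff n := if 0 ≤ n then P.coeff n else 0
  bounded := by
    obtain ⟨a, ha⟩ := P.bounded
    exact ⟨a, fun n hn => by simp [ha n hn]⟩

/-- The residue: the coefficient of `∂⁻¹`. -/
def res (P : PsDO R) : R := P.coeff (-1)

variable [Differential R]

/-- The contribution of `(a_i ∂^i) (b_j ∂^j)`, `j = n - i + l`, to the coefficient of `∂ⁿ`, through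
the `l`-th term of the Leibniz rule `∂^i b = ∑_l binom(i, l) b^{(l)} ∂^{i - l}`, `i ∈ ℤ`. -/
def mulTerm (P Q : PsDO R) (n : ℤ) (p : ℤ × ℕ) : R :=
  Ring.choose p.1 p.2 • (P.coeff p.1 * dIter p.2 (Q.coeff (n - p.1 + p.2)))

/-- For each `n` only finitely many terms contribute, so that the sum in the product below
is a genuine finite sum. -/
theorem mulTerm_finite (P Q : PsDO R) (n : ℤ) : (Function.support (mulTerm P Q n)).Finite := by
  obtain ⟨a, ha⟩ := P.bounded
  obtain ⟨b, hb⟩ := Q.bounded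
  refine ((Set.finite_Icc (n - b) a).prod (Set.finite_Iic (b - n + a).toNat)).subset ?_
  rintro ⟨i, l⟩ h
  have h1 : i ≤ a := by
    by_contra hc
    exact h (by simp [mulTerm, ha i (by omega)])
  have h2 : n - i + l ≤ b := by
    by_contra hc
    exact h (by simp [mulTerm, hb (n - i + l) (by omega), dIter_zero])
  simp only [Set.mem_prod, Set.mem_Icc, Set.mem_Iic]
  omega

instance : Mul (PsDO R) where
  mul P Q := ⟨fun n => ∑ᶠ p : ℤ × ℕ, mulTerm P Q n p, by
    obtain ⟨a, ha⟩ := P.bounded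
    obtain ⟨b, hb⟩ := Q.bounded
    refine ⟨a + b, fun n hn => finsum_eq_zero_of_forall_eq_zero fun p => ?_⟩
    by_cases h : a < p.1
    · simp [mulTerm, ha p.1 h]
    · simp [mulTerm, hb (n - p.1 + p.2) (by omega), dIter_zero]⟩

/-- Powers `P ^ m`, `m ∈ ℕ`. -/
def npow (P : PsDO R) : ℕ → PsDO R
  | 0 => 1
  | m + 1 => npow P m * P

instance : Pow (PsDO R) ℕ where
  pow P m := npow P m

/-- `Q = ∂ + ∑_{i ≤ 0} p_i ∂^i` and `Q ^ N = P`. -/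
def IsNthRoot (N : ℕ) (P Q : PsDO R) : Prop :=
  Q.coeff 1 = 1 ∧ (∀ n, 1 < n → Q.coeff n = 0) ∧ Q ^ N = P

open Classical in
/-- The `N`-th root `P^{1/N}`; meaningful when `∃! Q, IsNthRoot N P Q`. -/
def nthRoot (N : ℕ) (P : PsDO R) : PsDO R :=
  if h : ∃ Q, IsNthRoot N P Q then h.choose else 1

/-- The fractional power `P^{m/N}`, `m ∈ ℕ`. -/
def fracPow (N : ℕ) (P : PsDO R) (m : ℕ) : PsDO R := nthRoot N P ^ m

end PsDO

/-- The operator `L = ∂^N + u_{N-2} ∂^{N-2} + ⋯ + u_0`. -/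
def lop {R : Type*} [CommRing R] (N : ℕ) (u : Fin (N - 1) → R) : PsDO R where
  coeff n := (if n = N then 1 else 0) + ∑ j : Fin (N - 1), if n = (j : ℕ) then u j else 0
  bounded := by
    refine ⟨N, fun n hn => ?_⟩
    rw [if_neg (by omega), zero_add]
    refine Finset.sum_eq_zero fun j _ => if_neg ?_
    have := j.2
    omega

/-- The right-hand side `[(L^{m/N})₊, L]` of the `m`-th Gelfand–Dickey equation. -/
def gdRHS {R : Type*} [CommRing R] [Differential R] (N m : ℕ) (u : Fin (N - 1) → R) : PsDO R :=
  ((lop N u).fracPow N m).plus * lop N u - lop N u * ((lop N u).fracPow N m).plus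

/-! ### The differential ring of smooth functions on an open subset of the line -/

/-- Extension by zero of a function on `I` to the line. -/
def ext0 {I : TopologicalSpace.Opens ℝ} (f : I → ℂ) : ℝ → ℂ := Function.extend Subtype.val f 0

theorem ext0_coe {I : TopologicalSpace.Opens ℝ} (f : I → ℂ) (x : I) : ext0 f x = f x :=
  Subtype.val_injective.extend_apply f 0 x

theorem ext0_of_mem {I : TopologicalSpace.Opens ℝ} (f : I → ℂ) {x : ℝ} (hx : x ∈ I) :
    ext0 f x = f ⟨x, hx⟩ := ext0_coe f ⟨x, hx⟩

/-- The algebra of smooth complex-valued functions on the open set `I ⊆ ℝ`. -/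
def SmoothFn (I : TopologicalSpace.Opens ℝ) : Subalgebra ℂ (I → ℂ) where
  carrier := {f | ContDiffOn ℝ ∞ (ext0 f) I}
  mul_mem' {f g} hf hg := (ContDiffOn.mul hf hg).congr fun x hx => by
    simp [ext0_of_mem _ (show x ∈ I from hx)]
  add_mem' {f g} hf hg := (ContDiffOn.add hf hg).congr fun x hx => by
    simp [ext0_of_mem _ (show x ∈ I from hx)]
  algebraMap_mem' c := (contDiffOn_const (c := c)).congr fun x hx => by
    simp [ext0_of_mem _ (show x ∈ I from hx)]

section

variable {I : TopologicalSpace.Opens ℝ}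

/-- The value at `x` (zero outside `I`). -/
def fval (f : SmoothFn I) : ℝ → ℂ := ext0 (f : I → ℂ)

theorem fval_of_mem (f : SmoothFn I) {x : ℝ} (hx : x ∈ I) : fval f x = (f : I → ℂ) ⟨x, hx⟩ :=
  ext0_of_mem _ hx

theorem fval_contDiffOn (f : SmoothFn I) : ContDiffOn ℝ ∞ (fval f) I := f.2

theorem fval_differentiableAt (f : SmoothFn I) (x : I) : DifferentiableAt ℝ (fval f) x :=
  ((fval_contDiffOn f).contDiffAt (I.isOpen.mem_nhds x.2)).differentiableAt (by simp)

theorem fval_eventuallyEq {f : SmoothFn I} {g : ℝ → ℂ} (h : ∀ x : I, fval f x = g x) (x : I) :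
    fval f =ᶠ[nhds (x : ℝ)] g :=
  Filter.eventually_of_mem (I.isOpen.mem_nhds x.2) fun y hy => h ⟨y, hy⟩

/-- The derivative `d/dx` of a smooth function on `I`. -/
def ddx (f : SmoothFn I) : SmoothFn I :=
  ⟨fun x => deriv (fval f) x,
    ((fval_contDiffOn f).deriv_of_isOpen I.isOpen (m := ∞) (by simp)).congr fun x hx =>
      ext0_of_mem _ (show x ∈ I from hx)⟩

theorem ddx_apply (f : SmoothFn I) (x : I) : (ddx f : I → ℂ) x = deriv (fval f) x := rfl

instance : Differential (SmoothFn I) where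
  deriv := Derivation.mk'
    (AddMonoidHom.toIntLinearMap
      { toFun := ddx
        map_zero' := by
          ext x
          rw [ddx_apply, (fval_eventuallyEq (g := fun _ => 0)
            (fun y => by simp [fval_of_mem _ y.2]) x).deriv_eq]
          simp
        map_add' := fun f g => by
          ext x
          rw [ddx_apply, (fval_eventuallyEq (g := fval f + fval g)
            (fun y => by simp [fval_of_mem _ y.2]) x).deriv_eq,
            deriv_add (fval_differentiableAt f x) (fval_differentiableAt g x)]
          rfl })
    (fun f g => by
      ext x
      change deriv (fval (f * g)) x =
        (f : I → ℂ) x * deriv (fval g) x + (g : I → ℂ) x * deriv (fval f) x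
      rw [(fval_eventuallyEq (g := fval f * fval g)
            (fun y => by simp [fval_of_mem _ y.2]) x).deriv_eq,
            deriv_mul (fval_differentiableAt f x) (fval_differentiableAt g x),
            fval_of_mem f x.2, fval_of_mem g x.2]
      ring)

end

/-! ### The Airy-type function and the heat kernel -/

/-- The admissible signs: `κ = (-1)^{N/2+1}` if `N` is even and `κ = ±1` if `N` is odd. -/
def IsHeatSign (N : ℕ) (κ : ℤ) : Prop :=
  (Even N → κ = (-1) ^ (N / 2 + 1)) ∧ (Odd N → κ = 1 ∨ κ = -1)

/-- The real part `c` of the line of integration `c + iℝ`: `c = 0` for even `N`; for odd `N`,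
`c = 1` if `κ = (-1)^{(N+1)/2}` and `c = -1` if `κ = (-1)^{(N-1)/2}`, which makes the integral
below absolutely convergent. -/
def contourAbscissa (N : ℕ) (κ : ℤ) : ℤ := if Even N then 0 else -(κ * (-1) ^ ((N - 1) / 2))

/-- `A_N(z; κ) = (2πi)⁻¹ ∫_{c-i∞}^{c+i∞} exp(zξ + κ ξ^N) dξ`, parametrized by `ξ = c + is`. -/
def airyN (N : ℕ) (κ : ℤ) (z : ℝ) : ℂ :=
  (1 / (2 * (Real.pi : ℂ))) * ∫ s : ℝ,
    Complex.exp ((z : ℂ) * ((contourAbscissa N κ : ℂ) + s * Complex.I) +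
      (κ : ℂ) * ((contourAbscissa N κ : ℂ) + s * Complex.I) ^ N)

/-- The building block `t^k · t^{-(j+1)/N} A_N^{(j)}((x - y) / t^{1/N})`. -/
def heatTerm (N : ℕ) (κ : ℤ) (k j : ℕ) (x y t : ℝ) : ℂ :=
  ((t ^ ((k : ℝ) - ((j : ℝ) + 1) / N) : ℝ) : ℂ) *
    iteratedDeriv j (airyN N κ) ((x - y) / t ^ ((1 : ℝ) / N))

/-- The heat kernel expansion with coefficients `H k j = H_k^j`, truncated after the power `t^n`:
`t^{-1/N} A_N(·) + ∑_{j=0}^{N-2} t^{-(j+1)/N} A_N^{(j)}(·) ∑_{k=1}^n H_k^j(x,y) t^k`. -/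
def heatPartial (N : ℕ) (κ : ℤ) (H : ℕ → Fin (N - 1) → ℝ → ℝ → ℂ) (n : ℕ) (x y t : ℝ) : ℂ :=
  heatTerm N κ 0 0 x y t +
    ∑ j : Fin (N - 1), ∑ k ∈ Finset.Icc 1 n, H k j x y * heatTerm N κ k j x y t

/-- The differential expression `L v (x) = v^{(N)}(x) + ∑_{i ≤ N-2} u_i(x) v^{(i)}(x)`. -/
def applyL {I : TopologicalSpace.Opens ℝ} (N : ℕ) (u : Fin (N - 1) → SmoothFn I) (v : ℝ → ℂ)
    (x : ℝ) : ℂ :=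
  iteratedDeriv N v x + ∑ i : Fin (N - 1), fval (u i) x * iteratedDeriv i v x

/-- `H k j = H_k^j`, `k ≥ 1`, `0 ≤ j ≤ N-2`, are the Hadamard coefficients of the heat equation
`∂_t v = κ L v`: they are smooth near the diagonal, and the expansion solves the equation
as a formal series, i.e. substituting its truncation after `t^n` leaves only terms of
order `n`, `t^n · t^{-(j+1)/N} A_N^{(j)}((x-y)/t^{1/N}) · G_j(x,y)` (all the coefficients of
`t^k · t^{-(j+1)/N} A_N^{(j)}`, `k < n`, cancel). The values `H 0 j` play no role. -/
def IsHadamard {I : TopologicalSpace.Opens ℝ} (N : ℕ) (κ : ℤ) (u : Fin (N - 1) → SmoothFn I)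
    (H : ℕ → Fin (N - 1) → ℝ → ℝ → ℂ) : Prop :=
  ∀ n : ℕ, ∃ W : Set (ℝ × ℝ), IsOpen W ∧ W ⊆ (I : Set ℝ) ×ˢ (I : Set ℝ) ∧
    (∀ x ∈ I, (x, x) ∈ W) ∧
    (∀ k ∈ Finset.Icc 1 n, ∀ j, ContDiffOn ℝ ∞ (fun p : ℝ × ℝ => H k j p.1 p.2) W) ∧
    ∃ G : Fin (N - 1) → ℝ → ℝ → ℂ, ∀ x y t : ℝ, (x, y) ∈ W → 0 < t →
      deriv (fun τ => heatPartial N κ H n x y τ) t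
          - (κ : ℂ) * applyL N u (fun ξ => heatPartial N κ H n ξ y t) x
        = ∑ j : Fin (N - 1), G j x y * heatTerm N κ n j x y t

/-! ### Differential polynomials and formal first integrals -/

/-- Differential polynomials in `u_0, …, u_{N-2}`; the variable `(j, i)` stands for `u_j^{(i)}`. -/
abbrev DiffPoly (N : ℕ) := MvPolynomial (Fin (N - 1) × ℕ) ℂ

/-- The total derivative `∂`, with `∂ u_j^{(i)} = u_j^{(i+1)}`. -/
instance (N : ℕ) : Differential (DiffPoly N) where
  deriv := (MvPolynomial.mkDerivation ℂ
    (fun p : Fin (N - 1) × ℕ => (MvPolynomial.X (p.1, p.2 + 1) : DiffPoly N))).restrictScalars ℤ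

/-- The indeterminates `u_0, …, u_{N-2}`. -/
def indet (N : ℕ) (j : Fin (N - 1)) : DiffPoly N := MvPolynomial.X (j, 0)

/-- The `m`-th Gelfand–Dickey vector field: the derivation `∂/∂s_m` of the differential polynomials
that commutes with `∂` and sends `u_j` to the coefficient of `∂^j` in `[(L^{m/N})₊, L]`. -/
def gdFlow (N m : ℕ) : Derivation ℂ (DiffPoly N) (DiffPoly N) :=
  MvPolynomial.mkDerivation ℂ
    (fun p : Fin (N - 1) × ℕ => dIter p.2 ((gdRHS N m (indet N)).coeff (p.1 : ℕ)))

/-- Evaluation of a differential polynomial at smooth functions `u_0, …, u_{N-2}`. -/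
def evalDiff {I : TopologicalSpace.Opens ℝ} (N : ℕ) (u : Fin (N - 1) → SmoothFn I)
    (h : DiffPoly N) : SmoothFn I :=
  MvPolynomial.aeval (fun p : Fin (N - 1) × ℕ => dIter p.2 (u p.1)) h

/-- The constant `κ^k / (1 - (j+1)/N)_k`, with the Pochhammer symbol
`(a)_k = a (a+1) ⋯ (a+k-1)`. -/
def diagConst (N : ℕ) (κ : ℤ) (k j : ℕ) : ℂ :=
  (κ : ℂ) ^ k / (ascPochhammer ℂ k).eval (1 - ((j : ℂ) + 1) / N)

/-- The differential polynomial `κ^k / (1 - (j+1)/N)_k · res L^{k-(j+1)/N}`. -/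
def diagDensity (N : ℕ) (κ : ℤ) (k j : ℕ) : DiffPoly N :=
  MvPolynomial.C (diagConst N κ k j) * ((lop N (indet N)).fracPow N (k * N - (j + 1))).res

/-! ### Solutions of the Gelfand–Dickey equations on the line -/

/-- `u s = (u_0(·, s), …, u_{N-2}(·, s))`, `s ∈ T`, is a smooth solution on `ℝ × T` of the `m`-th
Gelfand–Dickey equation `∂L/∂s = [(L^{m/N})₊, L]` (an equality of all coefficients). -/
def IsGDSolution (N m : ℕ) (T : Set ℝ)
    (u : ℝ → Fin (N - 1) → SmoothFn (⊤ : TopologicalSpace.Opens ℝ)) : Prop :=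
  (∀ j, ContDiffOn ℝ ∞ (fun p : ℝ × ℝ => fval (u p.2 j) p.1) (Set.univ ×ˢ T)) ∧
  ∀ s ∈ T, ∀ x : ℝ, ∀ n : ℤ,
    HasDerivAt (fun σ => fval ((lop N (u σ)).coeff n) x) (fval ((gdRHS N m (u s)).coeff n) x) s

/-- All `x`-derivatives of the coefficients decay rapidly as `|x| → ∞`, locally uniformly
in `s ∈ T`. -/
def IsRapidlyDecaying (N : ℕ) (T : Set ℝ)
    (u : ℝ → Fin (N - 1) → SmoothFn (⊤ : TopologicalSpace.Opens ℝ)) : Prop :=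
  ∀ K ⊆ T, IsCompact K → ∀ (j : Fin (N - 1)) (i n : ℕ), ∃ C : ℝ, ∀ s ∈ K, ∀ x : ℝ,
    |x| ^ n * ‖fval (dIter i (u s j)) x‖ ≤ C

/-- All coefficients are `p`-periodic in `x`. -/
def IsSpacePeriodic (N : ℕ) (T : Set ℝ) (p : ℝ)
    (u : ℝ → Fin (N - 1) → SmoothFn (⊤ : TopologicalSpace.Opens ℝ)) : Prop :=
  ∀ s ∈ T, ∀ (j : Fin (N - 1)) (x : ℝ), fval (u s j) (x + p) = fval (u s j) x

end

end GelfandDickey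

open GelfandDickey

/-! Let `K` be the leading term `t^{-1/N} A_N((x-y)/t^{1/N})`. It satisfies `∂_t K = κ ∂^N K`, and
integration by parts in the contour integral gives `t ∂^{N-1} K = η K` with `η = -(κ/N)(x-y)`.
Multiplication of `K` by `t` is therefore mirrored by the operator `T = ∂^{1-N} ∘ η` (`timeOp`), for
which `[T, ∂^N] = κ`, and the heat kernel expansion is mirrored by a dressing operator `X = ∑
h_{k,j} ∂^j T^k`. The heat equation and the relation `L X = X ∂^N` lead to the same transport
equations (`transportCoeff`), because both families of building blocks obey one reduction rule
(`heatTerm_reduce`, `timeOp_reduce`, `sum_reduce`). Reading these equations off the heat equation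
requires the building blocks to be linearly independent in `t` for `x ≠ y`
(`heatTerm_linearIndependent`); continuity extends them to `x = y`.

For a truncated `X` the operator `L X - X ∂^N` has very low order. A telescoping sum (`sandwich`)
carries this over to `Q = L^{1/N}`, so that `Q^p X - X ∂^p` has no residue as long as `p` is at most
the truncation order. At `x = y` the function `η` vanishes, which settles both residues
(`res_pow_eq_sum`): `X = 1 + Y ∘ η`, so `Q^p X` and `Q^p` have the same residue there, and `∂^j T^k`
collapses to a constant multiple of `∂^{j-kN}`. For `p = kN - (j+1)` only `H_k^j(y,y)` is picked
out, with the factor `κ^k (1-(j+1)/N)_k`.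

Conservation is the Lax argument: with `B = (L^{m/N})₊`, uniqueness of the root gives `∂_s L^{k/N} =
[B, L^{k/N}]`, and the residue of a commutator is a total derivative
(`exists_res_commutator_eq_deriv`). Along a solution the `s`-derivative of a differential polynomial
is the formal flow (`IsGDSolution.hasDerivAt_evalDiff`), so the integrals are constant by
differentiation under the integral sign. On the whole line this also needs densities without
constant term (`constantCoeff_diagDensity`). -/

namespace GelfandDickey

noncomputable section

/-! ### Iterated derivatives in a differential ring -/

section dIter

variable {R : Type*} [CommRing R] [Differential R]

theorem dIter_zero_left (f : R) : dIter 0 f = f := rfl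

theorem dIter_succ (i : ℕ) (f : R) : dIter (i + 1) f = Differential.deriv (dIter i f) := by
  simp only [dIter, Function.iterate_succ_apply']

theorem dIter_succ' (i : ℕ) (f : R) : dIter (i + 1) f = dIter i (Differential.deriv f) := by
  simp only [dIter, Function.iterate_succ_apply]

theorem dIter_dIter (i j : ℕ) (f : R) : dIter i (dIter j f) = dIter (i + j) f := by
  simp only [dIter, Function.iterate_add_apply]

/-- The iterated derivative as an additive map. -/
def dIterHom (i : ℕ) : R →+ R where
  toFun := dIter i
  map_zero' := dIter_zero i
  map_add' f g := by
    induction i with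
    | zero => rfl
    | succ i ih => simp only [dIter_succ, ih, map_add]

theorem dIter_add (i : ℕ) (f g : R) : dIter i (f + g) = dIter i f + dIter i g :=
  (dIterHom i).map_add f g

theorem dIter_zsmul (i : ℕ) (n : ℤ) (f : R) : dIter i (n • f) = n • dIter i f :=
  map_zsmul (dIterHom i) n f

theorem dIter_one_of_pos {i : ℕ} (hi : 0 < i) : dIter i (1 : R) = 0 := by
  obtain ⟨i, rfl⟩ := Nat.exists_eq_succ_of_ne_zero hi.ne'
  rw [Nat.succ_eq_add_one, dIter_succ', Derivation.map_one_eq_zero, dIter_zero]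

/-- The Leibniz rule. -/
theorem dIter_mul (n : ℕ) (f g : R) :
    dIter n (f * g) = ∑ p ∈ Finset.HasAntidiagonal.antidiagonal n, n.choose p.1 • (dIter p.1 f * dIter p.2 g) := by
  induction n with
  | zero => simp [dIter_zero_left]
  | succ n ih =>
    rw [Finset.sum_antidiagonal_choose_succ_nsmul
      (M := R) (fun i j => dIter i f * dIter j g) n, dIter_succ, ih, map_sum,
      ← Finset.sum_add_distrib]
    refine Finset.sum_congr rfl fun p hp => ?_
    have hc : n.choose p.2 = n.choose p.1 := by
      have := Finset.HasAntidiagonal.mem_antidiagonal.mp hp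
      rw [← this, Nat.choose_symm_add]
    rw [map_nsmul, Derivation.leibniz, hc, dIter_succ, dIter_succ, ← smul_add]
    simp only [smul_eq_mul]
    ring

end dIter

/-! ### The ring of formal pseudo-differential operators -/

namespace PsDO

variable {R : Type*} [CommRing R]

instance : Zero (PsDO R) := ⟨⟨fun _ => 0, 0, fun _ _ => rfl⟩⟩

instance : Add (PsDO R) where
  add P Q := ⟨fun n => P.coeff n + Q.coeff n, by
    obtain ⟨a, ha⟩ := P.bounded
    obtain ⟨b, hb⟩ := Q.bounded
    refine ⟨max a b, fun n hn => ?_⟩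
    rw [ha n (by omega), hb n (by omega), add_zero]⟩

instance : Neg (PsDO R) where
  neg P := ⟨fun n => -P.coeff n, by
    obtain ⟨a, ha⟩ := P.bounded
    exact ⟨a, fun n hn => by rw [ha n hn, neg_zero]⟩⟩

@[simp] theorem zero_coeff (n : ℤ) : (0 : PsDO R).coeff n = 0 := rfl

@[simp] theorem add_coeff (P Q : PsDO R) (n : ℤ) : (P + Q).coeff n = P.coeff n + Q.coeff n := rfl

@[simp] theorem neg_coeff (P : PsDO R) (n : ℤ) : (-P).coeff n = -P.coeff n := rfl

@[simp] theorem sub_coeff (P Q : PsDO R) (n : ℤ) : (P - Q).coeff n = P.coeff n - Q.coeff n := rfl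

theorem one_coeff (n : ℤ) : (1 : PsDO R).coeff n = if n = 0 then 1 else 0 := rfl

instance : AddCommGroup (PsDO R) where
  add_assoc P Q S := PsDO.ext (funext fun n => add_assoc _ _ _)
  zero_add P := PsDO.ext (funext fun n => zero_add _)
  add_zero P := PsDO.ext (funext fun n => add_zero _)
  add_comm P Q := PsDO.ext (funext fun n => add_comm _ _)
  neg_add_cancel P := PsDO.ext (funext fun n => neg_add_cancel _)
  sub_eq_add_neg P Q := PsDO.ext (funext fun n => sub_eq_add_neg _ _)
  nsmul := nsmulRec
  zsmul := zsmulRec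

/-- The `n`-th coefficient as an additive map. -/
def coeffHom (n : ℤ) : PsDO R →+ R where
  toFun P := P.coeff n
  map_zero' := rfl
  map_add' _ _ := rfl

theorem sum_coeff {ι : Type*} (s : Finset ι) (f : ι → PsDO R) (n : ℤ) :
    (∑ a ∈ s, f a).coeff n = ∑ a ∈ s, (f a).coeff n :=
  map_sum (coeffHom n) f s

/-- `P` has order at most `m`. -/
def OrdLE (P : PsDO R) (m : ℤ) : Prop := ∀ n, m < n → P.coeff n = 0

theorem exists_ordLE (P : PsDO R) : ∃ m, P.OrdLE m := P.bounded

theorem OrdLE.mono {P : PsDO R} {a b : ℤ} (h : P.OrdLE a) (hab : a ≤ b) : P.OrdLE b :=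
  fun n hn => h n (by omega)

theorem OrdLE.add {P Q : PsDO R} {a : ℤ} (hP : P.OrdLE a) (hQ : Q.OrdLE a) : (P + Q).OrdLE a :=
  fun n hn => by rw [add_coeff, hP n hn, hQ n hn, add_zero]

theorem OrdLE.neg {P : PsDO R} {a : ℤ} (hP : P.OrdLE a) : (-P).OrdLE a :=
  fun n hn => by rw [neg_coeff, hP n hn, neg_zero]

theorem OrdLE.sub {P Q : PsDO R} {a : ℤ} (hP : P.OrdLE a) (hQ : Q.OrdLE a) : (P - Q).OrdLE a :=
  fun n hn => by rw [sub_coeff, hP n hn, hQ n hn, sub_zero]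

theorem ordLE_zero (a : ℤ) : (0 : PsDO R).OrdLE a := fun _ _ => rfl

theorem OrdLE.sum {ι : Type*} {s : Finset ι} {f : ι → PsDO R} {a : ℤ}
    (h : ∀ i ∈ s, (f i).OrdLE a) : (∑ i ∈ s, f i).OrdLE a :=
  fun n hn => by rw [sum_coeff]; exact Finset.sum_eq_zero fun i hi => h i hi n hn

theorem ordLE_one : (1 : PsDO R).OrdLE 0 := fun n hn => if_neg (by omega)

/-- The order filtration is separated; existence and uniqueness of the root both end with this fact.
-/
theorem eq_zero_of_forall_ordLE {P : PsDO R} (h : ∀ m, P.OrdLE m) : P = 0 :=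
  PsDO.ext (funext fun n => h (n - 1) n (by omega))

/-- The operator `a ∂^i`. -/
def mono (a : R) (i : ℤ) : PsDO R :=
  ⟨fun n => if n = i then a else 0, i, fun _ hn => if_neg (by omega)⟩

theorem mono_coeff (a : R) (i n : ℤ) : (mono a i).coeff n = if n = i then a else 0 := rfl

theorem ordLE_mono (a : R) (i : ℤ) : (mono a i).OrdLE i := fun _ hn => if_neg (by omega)

theorem one_eq_mono : (1 : PsDO R) = mono 1 0 := rfl

theorem exists_sum_mono_add (P : PsDO R) (M : ℤ) :
    ∃ (s : Finset ℤ) (q : PsDO R), q.OrdLE M ∧ P = ∑ i ∈ s, mono (P.coeff i) i + q := by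
  obtain ⟨a, ha⟩ := P.bounded
  refine ⟨Finset.Ioc M a, P - ∑ i ∈ Finset.Ioc M a, mono (P.coeff i) i, fun n hn => ?_, by abel⟩
  rw [sub_coeff, sum_coeff]
  by_cases h : n ≤ a
  · rw [Finset.sum_eq_single_of_mem n (Finset.mem_Ioc.mpr ⟨hn, h⟩)
      (fun b _ hb => by rw [mono_coeff, if_neg hb.symm]), mono_coeff, if_pos rfl, sub_self]
  · rw [ha n (by omega), Finset.sum_eq_zero, sub_zero]
    intro b hb
    rw [Finset.mem_Ioc] at hb
    rw [mono_coeff, if_neg (by omega)]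

/-- A substitute for infinite sums: a map blind to operators of order at most `M` only meets the
finitely many monomials above `M`. -/
theorem addMonoidHom_eq_zero {S : Type*} [AddCommGroup S] (φ : PsDO R →+ S) (M : ℤ)
    (h1 : ∀ a i, φ (mono a i) = 0) (h2 : ∀ q : PsDO R, q.OrdLE M → φ q = 0) (P : PsDO R) :
    φ P = 0 := by
  obtain ⟨s, q, hq, hP⟩ := exists_sum_mono_add P M
  rw [hP, map_add, map_sum, h2 q hq, add_zero]
  exact Finset.sum_eq_zero fun i _ => h1 _ _

variable [Differential R]

theorem mul_coeff (P Q : PsDO R) (n : ℤ) :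
    (P * Q).coeff n = ∑ᶠ p : ℤ × ℕ, mulTerm P Q n p := rfl

theorem add_mul' (P P' Q : PsDO R) : (P + P') * Q = P * Q + P' * Q := by
  ext n
  rw [add_coeff, mul_coeff, mul_coeff, mul_coeff,
    ← finsum_add_distrib (mulTerm_finite P Q n) (mulTerm_finite P' Q n)]
  refine finsum_congr fun p => ?_
  simp only [mulTerm, add_coeff, add_mul, smul_add]

theorem mul_add' (P Q Q' : PsDO R) : P * (Q + Q') = P * Q + P * Q' := by
  ext n
  rw [add_coeff, mul_coeff, mul_coeff, mul_coeff,
    ← finsum_add_distrib (mulTerm_finite P Q n) (mulTerm_finite P Q' n)]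
  refine finsum_congr fun p => ?_
  simp only [mulTerm, add_coeff, dIter_add, mul_add, smul_add]

theorem OrdLE.mul {P Q : PsDO R} {a b : ℤ} (ha : P.OrdLE a) (hb : Q.OrdLE b) :
    (P * Q).OrdLE (a + b) := by
  refine fun n hn => finsum_eq_zero_of_forall_eq_zero fun p => ?_
  by_cases h : a < p.1
  · simp [mulTerm, ha p.1 h]
  · simp [mulTerm, hb (n - p.1 + p.2) (by omega), dIter_zero]

/-- The leading coefficient of a product. -/
theorem OrdLE.mul_coeff_top {P Q : PsDO R} {a b : ℤ} (ha : P.OrdLE a) (hb : Q.OrdLE b) :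
    (P * Q).coeff (a + b) = P.coeff a * Q.coeff b := by
  rw [mul_coeff, finsum_eq_single _ (a, 0)]
  · simp [mulTerm, dIter_zero_left]
  · rintro ⟨i, l⟩ hne
    by_cases h : a < i
    · simp [mulTerm, ha i h]
    · have : b < a + b - i + l := by
        by_contra hc
        exact hne (by rw [Prod.mk.injEq]; omega)
      simp [mulTerm, hb _ this, dIter_zero]

/-- The `d`-th Leibniz term lowers the order by exactly `d`, so a single term reaches a given
degree. -/
theorem mono_mul_mono_coeff (a b : R) (i j n : ℤ) (d : ℕ) (hd : n + d = i + j) :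
    (mono a i * mono b j).coeff n = Ring.choose i d • (a * dIter d b) := by
  rw [mul_coeff, finsum_eq_single _ (i, d)]
  · simp only [mulTerm, mono_coeff, if_true]
    rw [if_pos (by omega)]
  · rintro ⟨i', l⟩ hne
    by_cases h : i' = i
    · have : ¬ n - i' + l = j := by
        intro hc
        exact hne (by rw [Prod.mk.injEq]; omega)
      simp [mulTerm, mono_coeff, this, dIter_zero]
    · simp [mulTerm, mono_coeff, h]

theorem mono_mul_mono_expand (a b : R) (i j : ℤ) (M : ℕ) :
    (mono a i * mono b j - ∑ l ∈ Finset.range M,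
      mono (Ring.choose i l • (a * dIter l b)) (i + j - l)).OrdLE (i + j - M) := by
  intro n hn
  rw [sub_coeff, sum_coeff]
  by_cases h : n ≤ i + j
  · obtain ⟨d, hd⟩ := Int.eq_ofNat_of_zero_le (sub_nonneg.mpr h)
    rw [mono_mul_mono_coeff a b i j n d (by omega),
      Finset.sum_eq_single_of_mem d (Finset.mem_range.mpr (by omega)), mono_coeff,
      if_pos (by omega), sub_self]
    intro l _ hl
    rw [mono_coeff, if_neg (by omega)]
  · rw [(ordLE_mono a i).mul (ordLE_mono b j) n (by omega), Finset.sum_eq_zero, sub_zero]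
    intro l _
    rw [mono_coeff, if_neg (by omega)]

/-- Left multiplication as an additive map. -/
def mulLeftHom (P : PsDO R) : PsDO R →+ PsDO R := AddMonoidHom.mk' (fun Q => P * Q) (mul_add' P)

/-- Right multiplication as an additive map. -/
def mulRightHom (Q : PsDO R) : PsDO R →+ PsDO R :=
  AddMonoidHom.mk' (fun P => P * Q) (fun P P' => add_mul' P P' Q)

theorem sum_mul' {ι : Type*} (s : Finset ι) (f : ι → PsDO R) (Q : PsDO R) :
    (∑ a ∈ s, f a) * Q = ∑ a ∈ s, f a * Q := map_sum (mulRightHom Q) f s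

theorem mul_sum' {ι : Type*} (s : Finset ι) (P : PsDO R) (f : ι → PsDO R) :
    P * ∑ a ∈ s, f a = ∑ a ∈ s, P * f a := map_sum (mulLeftHom P) f s

theorem mono_mul_assoc_left_coeff (a b c : R) (i j k n : ℤ) (d : ℕ) (hd : n + d = i + j + k) :
    ((mono a i * mono b j) * mono c k).coeff n = ∑ p ∈ Finset.HasAntidiagonal.antidiagonal d,
      (Ring.choose i p.1 * Ring.choose (i + j - p.1) p.2) • (a * (dIter p.1 b * dIter p.2 c)) := by
  -- With `d + 1` Leibniz terms the remainder of the inner product stays below degree `n` after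
  -- multiplication by `mono c k`.
  have h := mono_mul_mono_expand a b i j (d + 1)
  have h1 := h.mul (ordLE_mono c k) n (by push_cast; omega)
  rw [← sub_add_cancel (mono a i * mono b j) (∑ l ∈ Finset.range (d + 1),
      mono (Ring.choose i l • (a * dIter l b)) (i + j - l)), add_mul', add_coeff, h1, zero_add,
    sum_mul', sum_coeff, Finset.Nat.sum_antidiagonal_eq_sum_range_succ_mk]
  refine Finset.sum_congr rfl fun l hl => ?_
  have hl' := Finset.mem_range.mp hl
  rw [mono_mul_mono_coeff _ _ _ _ n (d - l) (by omega), smul_mul_assoc, smul_smul, mul_assoc,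
    mul_comm (Ring.choose i l)]

theorem mono_mul_assoc_right_coeff (a b c : R) (i j k n : ℤ) (d : ℕ) (hd : n + d = i + j + k) :
    (mono a i * (mono b j * mono c k)).coeff n = ∑ p ∈ Finset.HasAntidiagonal.antidiagonal d,
      (Ring.choose i p.1 * Ring.choose j p.2) • (a * dIter p.1 (b * dIter p.2 c)) := by
  have h := mono_mul_mono_expand b c j k (d + 1)
  have h1 := (ordLE_mono a i).mul h n (by push_cast; omega)
  rw [← sub_add_cancel (mono b j * mono c k) (∑ l ∈ Finset.range (d + 1),
      mono (Ring.choose j l • (b * dIter l c)) (j + k - l)), mul_add', add_coeff, h1, zero_add,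
    mul_sum', sum_coeff, ← Finset.Nat.sum_antidiagonal_swap,
    Finset.Nat.sum_antidiagonal_eq_sum_range_succ_mk]
  refine Finset.sum_congr rfl fun l hl => ?_
  have hl' := Finset.mem_range.mp hl
  rw [mono_mul_mono_coeff _ _ _ _ n (d - l) (by omega), dIter_zsmul, mul_smul_comm, smul_smul]
  rfl

/-- The left side is expanded by Vandermonde's identity for `(i - l) + j`, the right side by the
Leibniz rule together with `choose p q * choose i p = choose i q * choose (i - q) (p - q)`. Both
become the same sum over triples of exponents. -/
theorem mono_mul_assoc (a b c : R) (i j k : ℤ) :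
    (mono a i * mono b j) * mono c k = mono a i * (mono b j * mono c k) := by
  ext n
  by_cases hn : n ≤ i + j + k
  · obtain ⟨d, hd⟩ := Int.eq_ofNat_of_zero_le (sub_nonneg.mpr hn)
    rw [mono_mul_assoc_left_coeff a b c i j k n d (by omega),
      mono_mul_assoc_right_coeff a b c i j k n d (by omega)]
    have e1 : ∀ p ∈ Finset.HasAntidiagonal.antidiagonal d,
        (Ring.choose i p.1 * Ring.choose (i + j - p.1) p.2) • (a * (dIter p.1 b * dIter p.2 c)) =
        ∑ q ∈ Finset.HasAntidiagonal.antidiagonal p.2, (Ring.choose i p.1 * (Ring.choose (i - p.1) q.1 *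
          Ring.choose j q.2)) • (a * (dIter p.1 b * dIter (q.1 + q.2) c)) := by
      intro p _
      rw [show i + j - (p.1 : ℤ) = (i - p.1) + j by ring,
        Ring.add_choose_eq p.2 (Commute.all _ _), Finset.mul_sum, Finset.sum_smul]
      refine Finset.sum_congr rfl fun q hq => ?_
      rw [Finset.HasAntidiagonal.mem_antidiagonal.mp hq]
    have e2 : ∀ p ∈ Finset.HasAntidiagonal.antidiagonal d,
        (Ring.choose i p.1 * Ring.choose j p.2) • (a * dIter p.1 (b * dIter p.2 c)) =
        ∑ q ∈ Finset.HasAntidiagonal.antidiagonal p.1, (Ring.choose i q.1 * (Ring.choose (i - q.1) q.2 *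
          Ring.choose j p.2)) • (a * (dIter q.1 b * dIter (q.2 + p.2) c)) := by
      intro p _
      rw [dIter_mul, Finset.mul_sum, Finset.smul_sum]
      refine Finset.sum_congr rfl fun q hq => ?_
      have hq' := Finset.HasAntidiagonal.mem_antidiagonal.mp hq
      have := Ring.choose_smul_choose i (show q.1 ≤ p.1 by omega)
      rw [show p.1 - q.1 = q.2 by omega] at this
      rw [dIter_dIter, ← mul_assoc (Ring.choose i q.1), ← this, mul_smul_comm,
        ← natCast_zsmul _ (p.1.choose q.1), smul_smul, nsmul_eq_mul]
      congr 1
      ring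
    rw [Finset.sum_congr rfl e1, Finset.sum_congr rfl e2, Finset.sum_sigma', Finset.sum_sigma']
    -- The triple counts the derivatives of `∂^i` falling on `b`, those of `∂^i` falling on `c`, and
    -- those of `∂^j` falling on `c`; only the bracketing changes.
    refine Finset.sum_nbij' (fun z => ⟨(z.1.1 + z.2.1, z.2.2), (z.1.1, z.2.1)⟩)
      (fun z => ⟨(z.2.1, z.2.2 + z.1.2), (z.2.2, z.1.2)⟩) ?_ ?_ ?_ ?_ ?_
    · rintro ⟨⟨l, m⟩, ⟨r, q⟩⟩ h
      simp only [Finset.mem_sigma, Finset.HasAntidiagonal.mem_antidiagonal] at h ⊢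
      exact ⟨by omega, by trivial⟩
    · rintro ⟨⟨l, m⟩, ⟨r, q⟩⟩ h
      simp only [Finset.mem_sigma, Finset.HasAntidiagonal.mem_antidiagonal] at h ⊢
      exact ⟨by omega, by trivial⟩
    · rintro ⟨⟨l, m⟩, ⟨r, q⟩⟩ h
      simp only [Finset.mem_sigma, Finset.HasAntidiagonal.mem_antidiagonal] at h
      obtain ⟨-, rfl⟩ := h
      rfl
    · rintro ⟨⟨l, m⟩, ⟨r, q⟩⟩ h
      simp only [Finset.mem_sigma, Finset.HasAntidiagonal.mem_antidiagonal] at h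
      obtain ⟨-, rfl⟩ := h
      rfl
    · intro z _
      rfl
  · rw [((ordLE_mono a i).mul (ordLE_mono b j)).mul (ordLE_mono c k) n (by omega),
      (ordLE_mono a i).mul ((ordLE_mono b j).mul (ordLE_mono c k)) n (by omega)]

theorem zero_mul' (Q : PsDO R) : 0 * Q = 0 := (mulRightHom Q).map_zero

theorem mul_zero' (P : PsDO R) : P * 0 = 0 := (mulLeftHom P).map_zero

/-- The associator is additive in each argument and shifts orders by a bounded amount, so its
vanishing on monomials spreads to general operators one argument at a time, from the right factor to
the left. -/
theorem mul_assoc' (P Q S : PsDO R) : P * Q * S = P * (Q * S) := by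
  have hsub : ∀ X Y : PsDO R, (∀ n, (coeffHom n) (X - Y) = 0) → X = Y := fun X Y h =>
    sub_eq_zero.mp (PsDO.ext (funext h))
  -- If `φ n` raises orders by at most `b`, operators of order at most `n - b - 1` cannot reach the
  -- coefficient of degree `n`.
  have key : ∀ (φ : ℤ → PsDO R →+ PsDO R) (b : ℤ), (∀ n a i, coeffHom n (φ n (mono a i)) = 0) →
      (∀ n (q : PsDO R) (M : ℤ), q.OrdLE M → (φ n q).OrdLE (M + b)) →
      ∀ n q, coeffHom n (φ n q) = 0 := by
    intro φ b h1 h2 n q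
    exact addMonoidHom_eq_zero ((coeffHom n).comp (φ n)) (n - b - 1) (fun a i => h1 n a i)
      (fun q hq => h2 n q _ hq n (by omega)) q
  obtain ⟨a, ha⟩ := P.exists_ordLE
  obtain ⟨b, hb⟩ := Q.exists_ordLE
  obtain ⟨c, hc⟩ := S.exists_ordLE
  have step3 : ∀ (a b : R) (i j n : ℤ) (S : PsDO R),
      coeffHom n (mono a i * mono b j * S - mono a i * (mono b j * S)) = 0 := by
    intro a b i j
    refine key (fun _ => mulLeftHom (mono a i * mono b j) -
      (mulLeftHom (mono a i)).comp (mulLeftHom (mono b j))) (i + j) ?_ ?_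
    · intro n c k
      change coeffHom n (mono a i * mono b j * mono c k - mono a i * (mono b j * mono c k)) = 0
      rw [mono_mul_assoc, sub_self, map_zero]
    · intro n q M hq
      have h := (((ordLE_mono a i).mul (ordLE_mono b j)).mul hq).sub
        (((ordLE_mono a i).mul ((ordLE_mono b j).mul hq)).mono (add_assoc i j M).ge)
      exact h.mono (by omega)
  have step2 : ∀ (a : R) (i n : ℤ) (Q : PsDO R),
      coeffHom n (mono a i * Q * S - mono a i * (Q * S)) = 0 := by
    intro a i
    refine key (fun _ => (mulRightHom S).comp (mulLeftHom (mono a i)) -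
      (mulLeftHom (mono a i)).comp (mulRightHom S)) (i + c) ?_ ?_
    · exact fun n b j => step3 a b i j n S
    · intro n q M hq
      have h := (((ordLE_mono a i).mul hq).mul hc).sub
        (((ordLE_mono a i).mul (hq.mul hc)).mono (add_assoc i M c).ge)
      exact h.mono (by omega)
  refine hsub _ _ fun n => ?_
  refine key (fun _ => (mulRightHom S).comp (mulRightHom Q) - mulRightHom (Q * S)) (b + c) ?_ ?_ n P
  · exact fun n a i => step2 a i n Q
  · intro n q M hq
    exact (((hq.mul hb).mul hc).mono (add_assoc M b c).le).sub (hq.mul (hb.mul hc))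

theorem one_mul' (P : PsDO R) : 1 * P = P := by
  ext n
  rw [mul_coeff, finsum_eq_single _ (0, 0)]
  · simp [mulTerm, one_coeff, dIter_zero_left]
  · rintro ⟨i, l⟩ hne
    by_cases h : i = 0
    · subst h
      obtain ⟨l, rfl⟩ := Nat.exists_eq_succ_of_ne_zero (show l ≠ 0 by rintro rfl; exact hne rfl)
      simp [mulTerm, Ring.choose_zero_succ]
    · simp [mulTerm, one_coeff, h]

theorem mul_one' (P : PsDO R) : P * 1 = P := by
  ext n
  rw [mul_coeff, finsum_eq_single _ (n, 0)]
  · simp [mulTerm, one_coeff, dIter_zero_left]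
  · rintro ⟨i, l⟩ hne
    have hl : n - i + l = 0 → 0 < l := by
      intro h
      rcases Nat.eq_zero_or_pos l with rfl | h'
      · exact absurd (by rw [Prod.mk.injEq]; omega) hne
      · exact h'
    by_cases h : n - i + l = 0
    · simp [mulTerm, one_coeff, h, dIter_one_of_pos (hl h)]
    · simp [mulTerm, one_coeff, h, dIter_zero]

instance : Ring (PsDO R) where
  left_distrib := mul_add'
  right_distrib := add_mul'
  zero_mul := zero_mul'
  mul_zero := mul_zero'
  mul_assoc := mul_assoc'
  one_mul := one_mul'
  mul_one := mul_one'
  npow n P := P.npow n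
  neg_add_cancel := neg_add_cancel
  sub_eq_add_neg := sub_eq_add_neg
  zsmul := zsmulRec

end PsDO
end

noncomputable section

/-! ### Coefficientwise maps and derivations -/

namespace PsDO

variable {R : Type*} [CommRing R]

section map

variable {S : Type*} [CommRing S]

/-- Coefficientwise application of a ring homomorphism. -/
def map (f : R →+* S) (P : PsDO R) : PsDO S where
  coeff n := f (P.coeff n)
  bounded := by
    obtain ⟨a, ha⟩ := P.bounded
    exact ⟨a, fun n hn => by rw [ha n hn, map_zero]⟩

theorem map_coeff (f : R →+* S) (P : PsDO R) (n : ℤ) : (P.map f).coeff n = f (P.coeff n) := rfl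

theorem map_plus (f : R →+* S) (P : PsDO R) : P.plus.map f = (P.map f).plus := by
  ext n
  simp only [map_coeff, plus]
  split_ifs <;> simp

end map

/-- Coefficientwise application of a derivation. -/
def mapDeriv (δ : Derivation ℤ R R) (P : PsDO R) : PsDO R where
  coeff n := δ (P.coeff n)
  bounded := by
    obtain ⟨a, ha⟩ := P.bounded
    exact ⟨a, fun n hn => by rw [ha n hn, map_zero]⟩

theorem mapDeriv_coeff (δ : Derivation ℤ R R) (P : PsDO R) (n : ℤ) :
    (P.mapDeriv δ).coeff n = δ (P.coeff n) := rfl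

theorem ordLE_sub_plus (P : PsDO R) : (P - P.plus).OrdLE (-1) := by
  intro n hn
  rw [sub_coeff, sub_eq_zero]
  exact (if_pos (by omega)).symm

variable [Differential R]

/-! ### Powers, sandwiches and roots -/

theorem OrdLE.pow {A : PsDO R} (hA : A.OrdLE 1) (n : ℕ) : (A ^ n).OrdLE n := by
  induction n with
  | zero => simpa using ordLE_one
  | succ n ih =>
    rw [pow_succ, Nat.cast_succ]
    exact ih.mul hA

theorem OrdLE.pow_coeff_top {A : PsDO R} (hA : A.OrdLE 1) (h1 : A.coeff 1 = 1) (n : ℕ) :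
    (A ^ n).coeff n = 1 := by
  induction n with
  | zero => simp [one_coeff]
  | succ n ih => rw [pow_succ, Nat.cast_succ, (hA.pow n).mul_coeff_top hA, ih, h1, one_mul]

/-- The sum `∑_{i < n} A^{n-1-i} Z B^i`. -/
def sandwich (A Z B : PsDO R) : ℕ → PsDO R
  | 0 => 0
  | n + 1 => A * sandwich A Z B n + Z * B ^ n

theorem sandwich_succ (A Z B : PsDO R) (n : ℕ) :
    sandwich A Z B (n + 1) = A * sandwich A Z B n + Z * B ^ n := rfl

theorem sandwich_sub (A Z Z' B : PsDO R) (n : ℕ) :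
    sandwich A (Z - Z') B n = sandwich A Z B n - sandwich A Z' B n := by
  induction n with
  | zero => simp [sandwich]
  | succ n ih => rw [sandwich_succ, sandwich_succ, sandwich_succ, ih]; noncomm_ring

/-- A telescoping sum. It relates an approximate intertwiner of `A`, `B` to one of their powers;
with `X = 1` it factors the difference of two powers. -/
theorem sandwich_intertwiner (A X B : PsDO R) (n : ℕ) :
    sandwich A (A * X - X * B) B n = A ^ n * X - X * B ^ n := by
  induction n with
  | zero => simp [sandwich]
  | succ n ih => rw [sandwich_succ, ih, pow_succ', pow_succ']; noncomm_ring

theorem sandwich_commutator (A X : PsDO R) (n : ℕ) :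
    sandwich A (X * A - A * X) A n = X * A ^ n - A ^ n * X := by
  induction n with
  | zero => simp [sandwich]
  | succ n ih => rw [sandwich_succ, ih, pow_succ']; noncomm_ring

theorem OrdLE.sandwich {A Z B : PsDO R} {m : ℤ} (hA : A.OrdLE 1) (hB : B.OrdLE 1)
    (hZ : Z.OrdLE m) (n : ℕ) : (sandwich A Z B n).OrdLE (m + n - 1) := by
  induction n with
  | zero => exact ordLE_zero _
  | succ n ih =>
    exact ((hA.mul ih).mono (by push_cast; omega)).add
      ((hZ.mul (hB.pow n)).mono (by push_cast; omega))

/-- As `A` and `B` are monic of order one, each of the `n` summands contributes the leading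
coefficient of `Z` once. -/
theorem OrdLE.sandwich_coeff_top {A Z B : PsDO R} {m : ℤ} (hA : A.OrdLE 1) (hA1 : A.coeff 1 = 1)
    (hB : B.OrdLE 1) (hB1 : B.coeff 1 = 1) (hZ : Z.OrdLE m) (n : ℕ) :
    (PsDO.sandwich A Z B n).coeff (m + n - 1) = n * Z.coeff m := by
  induction n with
  | zero => simp [PsDO.sandwich]
  | succ n ih =>
    have e1 : m + ((n + 1 : ℕ) : ℤ) - 1 = 1 + (m + n - 1) := by push_cast; ring
    have e2 : (1 + (m + n - 1) : ℤ) = m + n := by ring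
    rw [sandwich_succ, add_coeff, e1, hA.mul_coeff_top (hA.sandwich hB hZ n), ih, e2,
      hZ.mul_coeff_top (hB.pow n), hB.pow_coeff_top hB1, hA1]
    push_cast
    ring

/-- Since `N` is invertible, the leading coefficient of `Z` cannot cancel in the sandwich. Starting
from any bound for the order of `Z`, the bound is lowered one degree at a time. -/
theorem OrdLE.of_sandwich {A Z B : PsDO R} {m : ℤ} (hA : A.OrdLE 1) (hA1 : A.coeff 1 = 1)
    (hB : B.OrdLE 1) (hB1 : B.coeff 1 = 1) {N : ℕ} (hN : IsUnit (N : R))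
    (h : (PsDO.sandwich A Z B N).OrdLE (m + N - 1)) : Z.OrdLE m := by
  have key : ∀ d : ℕ, Z.OrdLE (m + d) → Z.OrdLE m := by
    intro d
    induction d with
    | zero => intro hZ; simpa using hZ
    | succ d ih =>
      intro hZ
      refine ih fun n hn => ?_
      rcases eq_or_ne n (m + (d + 1 : ℕ)) with rfl | hne
      · have h1 := hA.sandwich_coeff_top hA1 hB hB1 hZ N
        rw [h _ (by push_cast; omega)] at h1
        exact (hN.mul_right_eq_zero).mp h1.symm
      · exact hZ n (by push_cast at hne ⊢; omega)
  obtain ⟨M, hM⟩ := Z.exists_ordLE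
  exact key (M - m).toNat (OrdLE.mono hM (by omega))

theorem eq_zero_of_sandwich {A Z B : PsDO R} (hA : A.OrdLE 1) (hA1 : A.coeff 1 = 1)
    (hB : B.OrdLE 1) (hB1 : B.coeff 1 = 1) {N : ℕ} (hN : IsUnit (N : R))
    (h : sandwich A Z B N = 0) : Z = 0 :=
  eq_zero_of_forall_ordLE fun _ => OrdLE.of_sandwich hA hA1 hB hB1 hN (h ▸ ordLE_zero _)

theorem IsNthRoot.unique {N : ℕ} (hN : IsUnit (N : R)) {P Q Q' : PsDO R} (h : IsNthRoot N P Q)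
    (h' : IsNthRoot N P Q') : Q = Q' := by
  refine sub_eq_zero.mp (eq_zero_of_sandwich h.2.1 h.1 h'.2.1 h'.1 hN ?_)
  have := sandwich_intertwiner Q 1 Q' N
  rw [mul_one, one_mul, mul_one, one_mul] at this
  rw [this, h.2.2, h'.2.2, sub_self]

/-- Successive approximations to the `N`-th root of `P`; `c` is the inverse of `N`. -/
def rootApprox (N : ℕ) (c : R) (P : PsDO R) : ℕ → PsDO R
  | 0 => mono 1 1
  | i + 1 => rootApprox N c P i +
      mono (c * (P - rootApprox N c P i ^ N).coeff (N - 1 - i)) (-i)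

theorem rootApprox_ordLE (N : ℕ) (c : R) (P : PsDO R) (i : ℕ) : (rootApprox N c P i).OrdLE 1 := by
  induction i with
  | zero => exact ordLE_mono _ _
  | succ i ih => exact ih.add ((ordLE_mono _ _).mono (by omega))

theorem rootApprox_coeff_one (N : ℕ) (c : R) (P : PsDO R) (i : ℕ) :
    (rootApprox N c P i).coeff 1 = 1 := by
  induction i with
  | zero => simp [rootApprox, mono_coeff]
  | succ i ih => rw [rootApprox, add_coeff, ih, mono_coeff, if_neg (by omega), add_zero]

/-- A correction `e` in degree `-i` changes the `N`-th power by a sandwich whose leading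
coefficient, in degree `N - 1 - i`, is `N` times that of `e`. The choice made in `rootApprox`
cancels the top of the defect. -/
theorem rootApprox_pow (N : ℕ) {c : R} (hc : N * c = 1) {P : PsDO R} (hP : P.OrdLE N)
    (hP1 : P.coeff N = 1) (i : ℕ) : (P - rootApprox N c P i ^ N).OrdLE (N - 1 - i) := by
  induction i with
  | zero =>
    intro n hn
    have h0 := rootApprox_ordLE N c P 0
    rcases eq_or_ne n (N : ℤ) with rfl | hne
    · rw [sub_coeff, hP1, h0.pow_coeff_top (rootApprox_coeff_one N c P 0), sub_self]
    · exact hP.sub (h0.pow N) n (by push_cast at hn; omega)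
  | succ i ih =>
    set A := rootApprox N c P i with hA
    set e := mono (c * (P - A ^ N).coeff (N - 1 - i)) (-i : ℤ) with he
    have hAe : rootApprox N c P (i + 1) = A + e := rfl
    have o1 := rootApprox_ordLE N c P (i + 1)
    have o0 := rootApprox_ordLE N c P i
    have hs : (A + e) ^ N - A ^ N = sandwich (A + e) e A N := by
      have := sandwich_intertwiner (A + e) 1 A N
      rw [mul_one, one_mul, mul_one, one_mul, add_sub_cancel_left] at this
      exact this.symm
    have hsplit : P - (A + e) ^ N = (P - A ^ N) - sandwich (A + e) e A N := by
      rw [← hs]; abel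
    rw [hAe] at o1 ⊢
    have oe : e.OrdLE (-i) := ordLE_mono _ _
    have os := o1.sandwich o0 oe N
    intro n hn
    rw [hsplit]
    rcases eq_or_ne n ((N : ℤ) - 1 - i) with rfl | hne
    · have ht := o1.sandwich_coeff_top (hAe ▸ rootApprox_coeff_one N c P (i + 1)) o0
        (rootApprox_coeff_one N c P i) oe N
      rw [show (-(i : ℤ) + N - 1) = N - 1 - i by ring] at ht
      rw [sub_coeff, ht, he, mono_coeff, if_pos rfl, ← mul_assoc, hc, one_mul, sub_self]
    · exact ih.sub (os.mono (by omega)) n (by push_cast at hn; omega)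

theorem rootApprox_stable (N : ℕ) (c : R) (P : PsDO R) (n : ℤ) {i j : ℕ} (hij : i ≤ j)
    (hn : -(i : ℤ) < n) : (rootApprox N c P j).coeff n = (rootApprox N c P i).coeff n := by
  induction j, hij using Nat.le_induction with
  | base => rfl
  | succ j hj ih => rw [rootApprox, add_coeff, ih, mono_coeff, if_neg (by omega), add_zero]

theorem exists_isNthRoot {N : ℕ} (hN : IsUnit (N : R)) {P : PsDO R} (hP : P.OrdLE N)
    (hP1 : P.coeff N = 1) : ∃ Q, IsNthRoot N P Q := by
  obtain ⟨c, hc⟩ := hN.exists_right_inv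
  have hcoeff : ∀ (n : ℤ) (i : ℕ), -(i : ℤ) < n →
      (rootApprox N c P (1 - n).toNat).coeff n = (rootApprox N c P i).coeff n := fun n i hi =>
    (rootApprox_stable N c P n (show (1 - n).toNat ≤ i by omega) (by omega)).symm
  -- From stage `1 - n` on, corrections only touch degrees below `n`, so the coefficient of degree
  -- `n` has its final value.
  let Q : PsDO R := ⟨fun n => (rootApprox N c P (1 - n).toNat).coeff n, 1, fun n hn =>
    rootApprox_ordLE N c P _ n hn⟩
  have hQ : Q.OrdLE 1 := fun n hn => rootApprox_ordLE N c P _ n hn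
  refine ⟨Q, rootApprox_coeff_one N c P (1 - 1 : ℤ).toNat, hQ, ?_⟩
  refine (sub_eq_zero.mp (eq_zero_of_forall_ordLE fun m => ?_)).symm
  obtain ⟨i, hi⟩ : ∃ i : ℕ, (N : ℤ) - 1 - i ≤ m := ⟨(N - 1 - m).toNat, by omega⟩
  set A := rootApprox N c P i
  have hd : (Q - A).OrdLE (-i) := fun n hn => by
    rw [sub_coeff, sub_eq_zero]
    exact hcoeff n i hn
  have hs := sandwich_intertwiner Q 1 A N
  rw [mul_one, one_mul, mul_one, one_mul] at hs
  have h1 : P - Q ^ N = (P - A ^ N) - sandwich Q (Q - A) A N := by rw [hs]; abel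
  rw [h1]
  exact ((rootApprox_pow N hc hP hP1 i).mono hi).sub
    ((hQ.sandwich (rootApprox_ordLE N c P i) hd N).mono (by omega))

theorem existsUnique_isNthRoot {N : ℕ} (hN : IsUnit (N : R)) {P : PsDO R} (hP : P.OrdLE N)
    (hP1 : P.coeff N = 1) : ∃! Q, IsNthRoot N P Q := by
  obtain ⟨Q, hQ⟩ := exists_isNthRoot hN hP hP1
  exact ⟨Q, hQ, fun Q' hQ' => hQ'.unique hN hQ⟩

theorem nthRoot_spec {N : ℕ} {P : PsDO R} (h : ∃ Q, IsNthRoot N P Q) :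
    IsNthRoot N P (nthRoot N P) := by
  rw [nthRoot, dif_pos h]
  exact h.choose_spec

/-! ### Functoriality -/

section map

variable {S : Type*} [CommRing S] [Differential S]

theorem map_dIter {f : R →+* S} (hf : ∀ a, f (Differential.deriv a) = Differential.deriv (f a))
    (i : ℕ) (a : R) : f (dIter i a) = dIter i (f a) := by
  induction i with
  | zero => rfl
  | succ i ih => rw [dIter_succ, dIter_succ, hf, ih]

theorem map_mul' {f : R →+* S} (hf : ∀ a, f (Differential.deriv a) = Differential.deriv (f a))
    (P Q : PsDO R) : (P * Q).map f = P.map f * Q.map f := by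
  ext n
  rw [map_coeff, mul_coeff, mul_coeff]
  refine (f.toAddMonoidHom.map_finsum (mulTerm_finite P Q n)).trans (finsum_congr fun p => ?_)
  change f (mulTerm P Q n p) = _
  rw [mulTerm, mulTerm, map_zsmul, map_mul, map_dIter hf]
  rfl

theorem map_pow' {f : R →+* S} (hf : ∀ a, f (Differential.deriv a) = Differential.deriv (f a))
    (P : PsDO R) (n : ℕ) : (P ^ n).map f = P.map f ^ n := by
  induction n with
  | zero =>
    ext n
    rw [pow_zero, pow_zero, map_coeff, one_coeff, one_coeff]
    split_ifs <;> simp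
  | succ n ih => rw [pow_succ, pow_succ, map_mul' hf, ih]

theorem IsNthRoot.map {f : R →+* S}
    (hf : ∀ a, f (Differential.deriv a) = Differential.deriv (f a)) {N : ℕ} {P Q : PsDO R}
    (h : IsNthRoot N P Q) : IsNthRoot N (P.map f) (Q.map f) := by
  refine ⟨by rw [map_coeff, h.1, map_one], fun n hn => by rw [map_coeff, h.2.1 n hn, map_zero], ?_⟩
  rw [← map_pow' hf, h.2.2]

end map

/-! ### Derivations acting on coefficients -/

theorem derivation_dIter {δ : Derivation ℤ R R}
    (hδ : ∀ a, δ (Differential.deriv a) = Differential.deriv (δ a)) (i : ℕ) (a : R) :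
    δ (dIter i a) = dIter i (δ a) := by
  induction i with
  | zero => rfl
  | succ i ih => rw [dIter_succ, dIter_succ, hδ, ih]

theorem mapDeriv_mul {δ : Derivation ℤ R R}
    (hδ : ∀ a, δ (Differential.deriv a) = Differential.deriv (δ a)) (P Q : PsDO R) :
    (P * Q).mapDeriv δ = P.mapDeriv δ * Q + P * Q.mapDeriv δ := by
  ext n
  rw [mapDeriv_coeff, add_coeff, mul_coeff, mul_coeff, mul_coeff,
    ← finsum_add_distrib (mulTerm_finite _ _ n) (mulTerm_finite _ _ n)]
  refine (δ.toLinearMap.toAddMonoidHom.map_finsum (mulTerm_finite P Q n)).trans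
    (finsum_congr fun p => ?_)
  change δ (mulTerm P Q n p) = _
  rw [mulTerm, mulTerm, mulTerm, map_zsmul, Derivation.leibniz, derivation_dIter hδ,
    mapDeriv_coeff, mapDeriv_coeff, ← smul_add, smul_eq_mul, smul_eq_mul]
  congr 1
  ring

theorem mapDeriv_pow {δ : Derivation ℤ R R}
    (hδ : ∀ a, δ (Differential.deriv a) = Differential.deriv (δ a)) (P : PsDO R) (n : ℕ) :
    (P ^ n).mapDeriv δ = sandwich P (P.mapDeriv δ) P n := by
  induction n with
  | zero =>
    ext n
    rw [pow_zero, mapDeriv_coeff, one_coeff]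
    split_ifs <;> simp [sandwich]
  | succ n ih => rw [pow_succ', mapDeriv_mul hδ, ih, sandwich_succ, add_comm]

/-- If `∂_s P = [B, P]`, then `∂_s P^{k/N} = [B, P^{k/N}]`. -/
theorem IsNthRoot.mapDeriv_pow {δ : Derivation ℤ R R}
    (hδ : ∀ a, δ (Differential.deriv a) = Differential.deriv (δ a)) {N : ℕ} (hN : IsUnit (N : R))
    {P Q B : PsDO R} (hQ : IsNthRoot N P Q) (h : P.mapDeriv δ = B * P - P * B) (k : ℕ) :
    (Q ^ k).mapDeriv δ = B * Q ^ k - Q ^ k * B := by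
  -- The sandwich between two copies of `Q` is injective, and it sends both `∂_s Q` and `[B, Q]` to
  -- `∂_s P`.
  have h1 : Q.mapDeriv δ = B * Q - Q * B := by
    refine sub_eq_zero.mp (eq_zero_of_sandwich hQ.2.1 hQ.1 hQ.2.1 hQ.1 hN ?_)
    rw [sandwich_sub, ← PsDO.mapDeriv_pow hδ, sandwich_commutator, hQ.2.2, h, sub_self]
  rw [PsDO.mapDeriv_pow hδ, h1, sandwich_commutator]

/-! ### Commutators and residues -/

theorem OrdLE.commutator {P Q : PsDO R} {a b : ℤ} (hP : P.OrdLE a) (hQ : Q.OrdLE b) :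
    (P * Q - Q * P).OrdLE (a + b - 1) := by
  intro n hn
  rcases eq_or_ne n (a + b) with rfl | hne
  · rw [sub_coeff, hP.mul_coeff_top hQ, add_comm a b, hQ.mul_coeff_top hP, mul_comm, sub_self]
  · exact (hP.mul hQ).sub ((hQ.mul hP).mono (by omega)) n (by omega)

/-- Differential operators are closed under products because `choose i l = 0` for `0 ≤ i < l`. -/
theorem mul_coeff_of_neg {P Q : PsDO R} (hP : ∀ n < 0, P.coeff n = 0)
    (hQ : ∀ n < 0, Q.coeff n = 0) (n : ℤ) (hn : n < 0) : (P * Q).coeff n = 0 := by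
  refine finsum_eq_zero_of_forall_eq_zero fun p => ?_
  rcases lt_or_ge p.1 0 with h | h
  · simp [mulTerm, hP _ h]
  rcases lt_or_ge (n - p.1 + p.2) 0 with h' | h'
  · simp [mulTerm, hQ _ h', dIter_zero]
  obtain ⟨i, hi⟩ := Int.eq_ofNat_of_zero_le h
  rw [mulTerm, hi, Ring.choose_natCast, Nat.choose_eq_zero_of_lt (by omega)]
  simp

/-- Integration by parts, `l` times. -/
theorem exists_deriv_eq_mul_dIter_sub (a b : R) (l : ℕ) :
    ∃ F, a * dIter l b - (-1) ^ l * (dIter l a * b) = Differential.deriv F := by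
  induction l generalizing a with
  | zero => exact ⟨0, by simp [dIter_zero_left]⟩
  | succ l ih =>
    obtain ⟨F, hF⟩ := ih (Differential.deriv a)
    refine ⟨a * dIter l b - F, ?_⟩
    rw [map_sub, ← hF, Derivation.leibniz, dIter_succ, dIter_succ' l a, smul_eq_mul, smul_eq_mul]
    ring

/-- Negation of the upper index. The sign is the one produced by `l` integrations by parts, so
paired terms of a commutator cancel modulo derivatives. -/
theorem choose_sub_one_sub (i : ℤ) (l : ℕ) :
    Ring.choose ((l : ℤ) - 1 - i) l = (-1) ^ l * Ring.choose i l := by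
  have h := Ring.choose_neg (i + 1 - l : ℤ) l
  rw [show -(i + 1 - l : ℤ) = l - 1 - i by ring, show i + 1 - l + l - 1 = i by ring] at h
  rw [h, Int.negOnePow_def, zpow_natCast, Units.smul_def]
  simp

/-- The residue of a commutator is a total derivative. -/
theorem exists_res_commutator_eq_deriv (P Q : PsDO R) :
    ∃ F, (P * Q - Q * P).res = Differential.deriv F := by
  -- In degree `-1` the term `(i, l)` of `P * Q` involves the coefficients `P_i` and `Q_{l-1-i}`;
  -- the term of `Q * P` with the same pair and the same `l` has index `l - 1 - i`.
  have hinv : Function.Involutive (fun p : ℤ × ℕ => ((p.2 : ℤ) - 1 - p.1, p.2)) := by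
    rintro ⟨i, l⟩
    simp
  have hQP : (Q * P).coeff (-1) =
      ∑ᶠ p : ℤ × ℕ, mulTerm Q P (-1) ((p.2 : ℤ) - 1 - p.1, p.2) := by
    rw [mul_coeff]
    exact (finsum_comp_equiv hinv.toPerm (f := mulTerm Q P (-1))).symm
  have hfin : (Function.support fun p : ℤ × ℕ =>
      mulTerm Q P (-1) ((p.2 : ℤ) - 1 - p.1, p.2)).Finite :=
    (mulTerm_finite Q P (-1)).preimage (f := fun p : ℤ × ℕ => ((p.2 : ℤ) - 1 - p.1, p.2))
      hinv.injective.injOn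
  have hterm : ∀ p : ℤ × ℕ, ∃ F, mulTerm P Q (-1) p - mulTerm Q P (-1) ((p.2 : ℤ) - 1 - p.1, p.2)
      = Differential.deriv F := by
    rintro ⟨i, l⟩
    obtain ⟨F, hF⟩ := exists_deriv_eq_mul_dIter_sub (P.coeff i) (Q.coeff (-1 - i + l)) l
    refine ⟨Ring.choose i l • F, ?_⟩
    rw [map_zsmul, ← hF]
    simp only [mulTerm, choose_sub_one_sub]
    rw [show (-1 : ℤ) - (l - 1 - i) + l = i by ring, show (l : ℤ) - 1 - i = -1 - i + l by ring]
    simp only [zsmul_eq_mul]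
    push_cast
    ring
  choose F hF using hterm
  rw [res, sub_coeff, mul_coeff, hQP, ← finsum_sub_distrib (mulTerm_finite P Q (-1)) hfin]
  have hfin2 : (Function.support fun p : ℤ × ℕ => mulTerm P Q (-1) p -
      mulTerm Q P (-1) ((p.2 : ℤ) - 1 - p.1, p.2)).Finite :=
    ((mulTerm_finite P Q (-1)).union hfin).subset (Function.support_sub _ _)
  refine ⟨∑ p ∈ hfin2.toFinset, F p, ?_⟩
  rw [finsum_eq_sum _ hfin2, map_sum]
  exact Finset.sum_congr rfl fun p _ => hF p

end PsDO

/-! ### The operator `L` and the Gelfand–Dickey flows -/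

section lop

open PsDO

variable {R : Type*} [CommRing R]

theorem lop_ordLE (N : ℕ) (u : Fin (N - 1) → R) : (lop N u).OrdLE N := by
  intro n hn
  change (if n = N then (1 : R) else 0) + ∑ j : Fin (N - 1), (if n = (j : ℕ) then u j else 0) = 0
  rw [if_neg (by omega), zero_add]
  refine Finset.sum_eq_zero fun j _ => if_neg ?_
  have := j.2
  omega

theorem lop_coeff_fin (N : ℕ) (u : Fin (N - 1) → R) (j : Fin (N - 1)) :
    (lop N u).coeff (j : ℕ) = u j := by
  change (if ((j : ℕ) : ℤ) = N then (1 : R) else 0) +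
    ∑ i : Fin (N - 1), (if ((j : ℕ) : ℤ) = (i : ℕ) then u i else 0) = u j
  have := j.2
  rw [if_neg (by omega), zero_add, Finset.sum_eq_single j]
  · simp
  · intro i _ hi
    rw [if_neg]
    intro h
    exact hi (Fin.ext (by omega))
  · simp

theorem lop_coeff_top (N : ℕ) (u : Fin (N - 1) → R) : (lop N u).coeff N = 1 := by
  change (if (N : ℤ) = N then (1 : R) else 0) +
    ∑ i : Fin (N - 1), (if (N : ℤ) = (i : ℕ) then u i else 0) = 1
  rw [if_pos rfl, Finset.sum_eq_zero, add_zero]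
  intro i _
  have := i.2
  rw [if_neg (by omega)]

theorem lop_coeff_of_ne (N : ℕ) (u : Fin (N - 1) → R) (n : ℤ) (hn : n ≠ N)
    (h : ∀ j : Fin (N - 1), n ≠ (j : ℕ)) : (lop N u).coeff n = 0 := by
  change (if n = N then (1 : R) else 0) + ∑ i : Fin (N - 1), (if n = (i : ℕ) then u i else 0) = 0
  rw [if_neg hn, zero_add]
  exact Finset.sum_eq_zero fun i _ => if_neg (h i)

theorem lop_map {S : Type*} [CommRing S] (f : R →+* S) (N : ℕ)
    (u : Fin (N - 1) → R) : (lop N u).map f = lop N fun j => f (u j) := by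
  ext n
  change f ((if n = N then (1 : R) else 0) + ∑ i : Fin (N - 1), (if n = (i : ℕ) then u i else 0)) =
    (if n = N then (1 : S) else 0) + ∑ i : Fin (N - 1), (if n = (i : ℕ) then f (u i) else 0)
  simp [apply_ite f]

theorem lop_coeff_neg (N : ℕ) (u : Fin (N - 1) → R) (n : ℤ) (hn : n < 0) :
    (lop N u).coeff n = 0 :=
  lop_coeff_of_ne N u n (by omega) fun j => by omega

variable [Differential R]

theorem existsUnique_lop_root {N : ℕ} (hN : IsUnit (N : R)) (u : Fin (N - 1) → R) :
    ∃! Q, IsNthRoot N (lop N u) Q :=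
  existsUnique_isNthRoot hN (lop_ordLE N u) (lop_coeff_top N u)

theorem isNthRoot_lop {N : ℕ} (hN : IsUnit (N : R)) (u : Fin (N - 1) → R) :
    IsNthRoot N (lop N u) (nthRoot N (lop N u)) :=
  nthRoot_spec (existsUnique_lop_root hN u).exists

theorem fracPow_map {S : Type*} [CommRing S] [Differential S] {f : R →+* S}
    (hf : ∀ a, f (Differential.deriv a) = Differential.deriv (f a)) {N : ℕ} (hR : IsUnit (N : R))
    (hS : IsUnit (N : S)) (u : Fin (N - 1) → R) (m : ℕ) :
    ((lop N u).fracPow N m).map f = (lop N fun j => f (u j)).fracPow N m := by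
  rw [fracPow, fracPow, map_pow' hf]
  congr 1
  refine IsNthRoot.unique hS ?_ (isNthRoot_lop hS _)
  rw [← lop_map]
  exact (isNthRoot_lop hR u).map hf

theorem gdRHS_map {S : Type*} [CommRing S] [Differential S] {f : R →+* S}
    (hf : ∀ a, f (Differential.deriv a) = Differential.deriv (f a)) {N : ℕ} (hR : IsUnit (N : R))
    (hS : IsUnit (N : S)) (u : Fin (N - 1) → R) (m : ℕ) (n : ℤ) :
    f ((gdRHS N m u).coeff n) = (gdRHS N m fun j => f (u j)).coeff n := by
  rw [gdRHS, gdRHS, ← fracPow_map hf hR hS, ← map_plus, ← lop_map, ← map_mul' hf, ← map_mul' hf]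
  simp only [sub_coeff, map_coeff, map_sub]

theorem lop_commute_fracPow {N : ℕ} (hN : IsUnit (N : R)) (u : Fin (N - 1) → R) (m : ℕ) :
    (lop N u).fracPow N m * lop N u = lop N u * (lop N u).fracPow N m := by
  have h := (isNthRoot_lop hN u).2.2
  have hc := (Commute.pow_pow (Commute.refl (nthRoot N (lop N u))) m N).eq
  rw [h] at hc
  exact hc

/-- Since `L^{m/N}` commutes with `L`, replacing `P₊` by `-(P - P₊)` leaves the commutator
unchanged. The new factor has order at most `-1`, and a commutator loses one more order. -/
theorem gdRHS_ordLE {N : ℕ} (hN : IsUnit (N : R)) (u : Fin (N - 1) → R) (m : ℕ) :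
    (gdRHS N m u).OrdLE (N - 2) := by
  set P := (lop N u).fracPow N m with hP
  have h : gdRHS N m u = -((P - P.plus) * lop N u - lop N u * (P - P.plus)) := by
    rw [gdRHS, sub_mul, mul_sub, hP, lop_commute_fracPow hN u m]
    abel
  rw [h]
  exact ((P.ordLE_sub_plus.commutator (lop_ordLE N u)).neg).mono (by omega)

theorem gdRHS_coeff_neg (N : ℕ) (u : Fin (N - 1) → R) (m : ℕ) (n : ℤ) (hn : n < 0) :
    (gdRHS N m u).coeff n = 0 := by
  have h1 : ∀ n < 0, ((lop N u).fracPow N m).plus.coeff n = 0 := fun n hn => if_neg (by omega)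
  rw [gdRHS, sub_coeff, mul_coeff_of_neg h1 (lop_coeff_neg N u) n hn,
    mul_coeff_of_neg (lop_coeff_neg N u) h1 n hn, sub_self]

end lop

section flow

open PsDO

variable (N : ℕ)

theorem diffPoly_deriv_X (p : Fin (N - 1) × ℕ) :
    Differential.deriv (MvPolynomial.X p : DiffPoly N) = MvPolynomial.X (p.1, p.2 + 1) :=
  MvPolynomial.mkDerivation_X ℂ _ p

theorem diffPoly_deriv_C (c : ℂ) : Differential.deriv (MvPolynomial.C c : DiffPoly N) = 0 :=
  MvPolynomial.derivation_C _ c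

theorem gdFlow_X (m : ℕ) (p : Fin (N - 1) × ℕ) :
    gdFlow N m (MvPolynomial.X p) = dIter p.2 ((gdRHS N m (indet N)).coeff (p.1 : ℕ)) :=
  MvPolynomial.mkDerivation_X ℂ _ p

theorem gdFlow_deriv (m : ℕ) (h : DiffPoly N) :
    gdFlow N m (Differential.deriv h) = Differential.deriv (gdFlow N m h) := by
  induction h using MvPolynomial.induction_on with
  | C c =>
    rw [diffPoly_deriv_C, map_zero, MvPolynomial.derivation_C, map_zero]
  | add f g hf hg => simp only [map_add, hf, hg]
  | mul_X f p hf =>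
    simp only [Derivation.leibniz, map_add, smul_eq_mul, diffPoly_deriv_X, hf, gdFlow_X, dIter_succ]
    ring

variable {N}

theorem diffPoly_isUnit (hN : 2 ≤ N) : IsUnit (N : DiffPoly N) := by
  have h : (N : DiffPoly N) = MvPolynomial.C (N : ℂ) := by simp
  rw [h]
  exact (IsUnit.mk0 _ (Nat.cast_ne_zero.mpr (by omega))).map MvPolynomial.C

/-- The flow prescribes only the coefficients of degrees `0, …, N - 2`. Consistency in all other
degrees is the fact that `[(L^{m/N})₊, L]` is a differential operator of order at most `N - 2`. -/
theorem gdFlow_lop_coeff (hN : 2 ≤ N) (m : ℕ) (n : ℤ) :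
    gdFlow N m ((lop N (indet N)).coeff n) = (gdRHS N m (indet N)).coeff n := by
  by_cases h : ∃ j : Fin (N - 1), n = (j : ℕ)
  · obtain ⟨j, rfl⟩ := h
    rw [lop_coeff_fin, indet, gdFlow_X]
    rfl
  · push Not at h
    have h1 : (gdRHS N m (indet N)).coeff n = 0 := by
      rcases lt_or_ge n 0 with hn | hn
      · exact gdRHS_coeff_neg N _ m n hn
      · refine gdRHS_ordLE (diffPoly_isUnit hN) _ m n ?_
        by_contra hc
        exact h ⟨n.toNat, by omega⟩ (by simp; omega)
    rw [h1]
    rcases eq_or_ne n (N : ℤ) with rfl | hne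
    · rw [lop_coeff_top, Derivation.map_one_eq_zero]
    · rw [lop_coeff_of_ne N _ n hne h, map_zero]

theorem exists_gdFlow_res_eq_deriv (hN : 2 ≤ N) (m k : ℕ) : ∃ F : DiffPoly N,
    gdFlow N m ((lop N (indet N)).fracPow N k).res = Differential.deriv F := by
  obtain ⟨F, hF⟩ := exists_res_commutator_eq_deriv ((lop N (indet N)).fracPow N m).plus
    ((lop N (indet N)).fracPow N k)
  refine ⟨F, ?_⟩
  have hL : (lop N (indet N)).mapDeriv ((gdFlow N m).restrictScalars ℤ) =
      gdRHS N m (indet N) := PsDO.ext (funext fun n => gdFlow_lop_coeff hN m n)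
  have h := (isNthRoot_lop (diffPoly_isUnit hN) (indet N)).mapDeriv_pow
    (δ := (gdFlow N m).restrictScalars ℤ) (gdFlow_deriv N m) (diffPoly_isUnit hN) hL k
  rw [← hF]
  exact congrArg (fun P => P.coeff (-1)) h

theorem exists_gdFlow_diagDensity_eq_deriv (hN : 2 ≤ N) (κ : ℤ) (k j m : ℕ) : ∃ F : DiffPoly N,
    gdFlow N m (diagDensity N κ k j) = Differential.deriv F := by
  obtain ⟨F, hF⟩ := exists_gdFlow_res_eq_deriv hN m (k * N - (j + 1))
  refine ⟨MvPolynomial.C (diagConst N κ k j) * F, ?_⟩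
  rw [diagDensity, Derivation.leibniz, hF, Derivation.leibniz, diffPoly_deriv_C,
    MvPolynomial.derivation_C]
  simp

end flow

end

noncomputable section

/-! ### Airy-type integrals with polynomial amplitudes -/

open Polynomial MeasureTheory Filter Topology

theorem IsHeatSign.sq {N : ℕ} {κ : ℤ} (hκ : IsHeatSign N κ) : κ * κ = 1 := by
  rcases Nat.even_or_odd N with h | h
  · rw [hκ.1 h, ← mul_pow]
    simp
  · rcases hκ.2 h with rfl | rfl <;> norm_num

/-- The point `c + i s` of the line of integration. -/
def contour (N : ℕ) (κ : ℤ) (s : ℝ) : ℂ := (contourAbscissa N κ : ℂ) + s * Complex.I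

theorem contourAbscissa_abs_le {N : ℕ} {κ : ℤ} (hκ : IsHeatSign N κ) :
    ‖(contourAbscissa N κ : ℂ)‖ ≤ 1 := by
  rw [contourAbscissa]
  split_ifs with h
  · simp
  · rcases hκ.2 (Nat.not_even_iff_odd.mp h) with rfl | rfl <;> simp

theorem norm_contour_le {N : ℕ} {κ : ℤ} (hκ : IsHeatSign N κ) (s : ℝ) :
    ‖contour N κ s‖ ≤ 1 + |s| := by
  refine (norm_add_le _ _).trans (add_le_add (contourAbscissa_abs_le hκ) ?_)
  simp

theorem re_contour_pow_le_even (m : ℕ) (hm : 1 ≤ m) {κ : ℤ} (hκ : IsHeatSign (2 * m) κ) (s : ℝ) :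
    ((κ : ℂ) * contour (2 * m) κ s ^ (2 * m)).re ≤ 1 - s ^ 2 := by
  have h1 : contour (2 * m) κ s = s * Complex.I := by
    simp [contour, contourAbscissa]
  have h2 : (κ : ℂ) * contour (2 * m) κ s ^ (2 * m) = ((-(s ^ 2) ^ m : ℝ) : ℂ) := by
    rw [h1, hκ.1 (even_two_mul m), Nat.mul_div_cancel_left m two_pos, mul_pow, pow_mul Complex.I,
      Complex.I_sq]
    push_cast
    have : ((-1 : ℂ) ^ m) * (-1) ^ m = 1 := by rw [← mul_pow]; simp
    rw [pow_succ, pow_mul]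
    linear_combination (-((s : ℂ) ^ 2) ^ m) * this
  rw [h2, Complex.ofReal_re]
  rcases le_total (s ^ 2) 1 with h | h
  · have : 0 ≤ (s ^ 2) ^ m := by positivity
    linarith
  · have : s ^ 2 ≤ (s ^ 2) ^ m := le_self_pow₀ h (by omega)
    linarith

/-- The leading term of `κ (c + is)^{2m+1}` is purely imaginary. The next one equals `-(2m+1)
s^{2m}`, because `c = -κ(-1)^m`, and it dominates the remaining terms. -/
theorem re_contour_pow_le_odd (m : ℕ) (hm : 1 ≤ m) {κ : ℤ} (hκ : IsHeatSign (2 * m + 1) κ) :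
    ∃ C : ℝ, ∀ s : ℝ, ((κ : ℂ) * contour (2 * m + 1) κ s ^ (2 * m + 1)).re ≤ C - s ^ 2 := by
  set c : ℤ := contourAbscissa (2 * m + 1) κ with hc
  have hodd : Odd (2 * m + 1) := odd_two_mul_add_one m
  have hκ2 : (κ : ℂ) * κ = 1 := by exact_mod_cast hκ.sq
  have hκn : ‖(κ : ℂ)‖ = 1 := by rcases hκ.2 hodd with rfl | rfl <;> simp
  have hcv : c = -(κ * (-1) ^ m) := by
    rw [hc, contourAbscissa, if_neg (Nat.not_even_iff_odd.mpr hodd)]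
    simp
  have hcn : ‖(c : ℂ)‖ ≤ 1 := contourAbscissa_abs_le hκ
  set E : ℝ → ℂ := fun s => ∑ i ∈ Finset.range (2 * m),
    ((s : ℂ) * Complex.I) ^ i * (c : ℂ) ^ (2 * m + 1 - i) * ((2 * m + 1).choose i : ℂ) with hE
  have hexp : ∀ s : ℝ, (κ : ℂ) * contour (2 * m + 1) κ s ^ (2 * m + 1) =
      ((κ * (-1) ^ m * s ^ (2 * m + 1) : ℝ) : ℂ) * Complex.I + ((-((2 * m + 1) * s ^ (2 * m)) : ℝ) : ℂ)
        + κ * E s := by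
    intro s
    have hsq : ((-1 : ℂ) ^ m) * (-1) ^ m = 1 := by rw [← mul_pow]; simp
    rw [contour, ← hc, add_comm (c : ℂ), add_pow, Finset.sum_range_succ, Finset.sum_range_succ]
    have e1 : 2 * m + 1 - 2 * m = 1 := by omega
    rw [e1, Nat.sub_self, Nat.choose_self, Nat.choose_succ_self_right, pow_zero, pow_one, mul_pow,
      mul_pow, pow_succ Complex.I, pow_mul Complex.I, Complex.I_sq]
    simp only [hE]
    rw [hcv]
    push_cast
    linear_combination (-(s : ℂ) ^ (2 * m) * (2 * m + 1) * ((-1) ^ m * (-1) ^ m)) * hκ2 -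
      (s : ℂ) ^ (2 * m) * (2 * m + 1) * hsq
  set K : ℝ := ∑ i ∈ Finset.range (2 * m), ((2 * m + 1).choose i : ℝ) with hK
  have hK0 : 0 ≤ K := Finset.sum_nonneg fun i _ => by positivity
  have hEn : ∀ s : ℝ, ‖(κ : ℂ) * E s‖ ≤ K * (max 1 |s|) ^ (2 * m - 1) := by
    intro s
    rw [norm_mul, hκn, one_mul, hK, Finset.sum_mul]
    refine (norm_sum_le _ _).trans (Finset.sum_le_sum fun i hi => ?_)
    have hi' := Finset.mem_range.mp hi
    rw [norm_mul, norm_mul, norm_pow, norm_pow, norm_mul, Complex.norm_I, mul_one,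
      Complex.norm_real, Real.norm_eq_abs, Complex.norm_natCast, mul_comm]
    refine mul_le_mul_of_nonneg_left ?_ (by positivity)
    calc |s| ^ i * ‖(c : ℂ)‖ ^ (2 * m + 1 - i) ≤ |s| ^ i * 1 :=
          mul_le_mul_of_nonneg_left (pow_le_one₀ (norm_nonneg _) hcn) (by positivity)
      _ = |s| ^ i := mul_one _
      _ ≤ (max 1 |s|) ^ i := pow_le_pow_left₀ (abs_nonneg s) (le_max_right _ _) i
      _ ≤ (max 1 |s|) ^ (2 * m - 1) := pow_le_pow_right₀ (le_max_left _ _) (by omega)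
  refine ⟨K ^ (2 * m) + K + 1, fun s => ?_⟩
  have hre : ((κ : ℂ) * contour (2 * m + 1) κ s ^ (2 * m + 1)).re ≤
      -((2 * m + 1) * s ^ (2 * m)) + K * (max 1 |s|) ^ (2 * m - 1) := by
    rw [hexp s, Complex.add_re, Complex.add_re, Complex.re_ofReal_mul, Complex.I_re, mul_zero,
      zero_add, Complex.ofReal_re]
    exact add_le_add le_rfl ((Complex.re_le_norm _).trans (hEn s))
  refine hre.trans ?_
  have hev : s ^ (2 * m) = |s| ^ (2 * m) := (Even.pow_abs (even_two_mul m) s).symm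
  have hs2 : s ^ 2 = |s| ^ 2 := (sq_abs s).symm
  have hKp : 0 ≤ K ^ (2 * m) := by positivity
  rw [hev, hs2]
  set a := |s| with ha
  have ha0 : 0 ≤ a := abs_nonneg s
  have hm1 : (1 : ℝ) ≤ m := by exact_mod_cast hm
  rcases le_total a 1 with h | h
  · rw [max_eq_left h, one_pow, mul_one]
    have h1 : a ^ 2 ≤ 1 := pow_le_one₀ ha0 h
    have h2 : 0 ≤ (2 * (m : ℝ) + 1) * a ^ (2 * m) := by positivity
    linarith
  · rw [max_eq_right h]
    -- A crude Young inequality: the product is at most the `2m`-th power of the larger of `K` and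
    -- `a`.
    have h1 : K * a ^ (2 * m - 1) ≤ K ^ (2 * m) + a ^ (2 * m) := by
      have e : 2 * m = (2 * m - 1) + 1 := by omega
      rcases le_total K a with hKa | hKa
      · have : K * a ^ (2 * m - 1) ≤ a ^ (2 * m) := by
          conv_rhs => rw [e, pow_succ']
          exact mul_le_mul_of_nonneg_right hKa (by positivity)
        linarith
      · have : K * a ^ (2 * m - 1) ≤ K ^ (2 * m) := by
          conv_rhs => rw [e, pow_succ']
          exact mul_le_mul_of_nonneg_left (pow_le_pow_left₀ ha0 hKa _) hK0
        have : 0 ≤ a ^ (2 * m) := by positivity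
        linarith
    have h2 : a ^ 2 ≤ a ^ (2 * m) := pow_le_pow_right₀ h (by omega)
    have h3 : a ^ (2 * m) ≤ m * a ^ (2 * m) := le_mul_of_one_le_left (by positivity) hm1
    nlinarith

theorem exists_re_contour_pow_le {N : ℕ} (hN : 2 ≤ N) {κ : ℤ} (hκ : IsHeatSign N κ) :
    ∃ C : ℝ, ∀ s : ℝ, ((κ : ℂ) * contour N κ s ^ N).re ≤ C - s ^ 2 := by
  rcases Nat.even_or_odd' N with ⟨m, rfl | rfl⟩
  · exact ⟨1, re_contour_pow_le_even m (by omega) hκ⟩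
  · exact re_contour_pow_le_odd m (by omega) hκ

theorem exists_norm_eval_le_exp (p : ℂ[X]) :
    ∃ C : ℝ, 0 ≤ C ∧ ∀ ξ : ℂ, ‖p.eval ξ‖ ≤ C * Real.exp ‖ξ‖ := by
  induction p using Polynomial.induction_on' with
  | add p q hp hq =>
    obtain ⟨C, hC, h⟩ := hp
    obtain ⟨C', hC', h'⟩ := hq
    refine ⟨C + C', by positivity, fun ξ => ?_⟩
    rw [eval_add, add_mul]
    exact (norm_add_le _ _).trans (add_le_add (h ξ) (h' ξ))
  | monomial n a =>
    refine ⟨‖a‖ * n.factorial, by positivity, fun ξ => ?_⟩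
    rw [eval_monomial, norm_mul, norm_pow, mul_assoc]
    refine mul_le_mul_of_nonneg_left ?_ (norm_nonneg a)
    have h := Real.pow_div_factorial_le_exp ‖ξ‖ (norm_nonneg ξ) n
    rwa [div_le_iff₀ (by positivity), mul_comm] at h

/-- The integrand `exp(zξ + κ ξ^N) p(ξ)` on the contour `ξ = c + is`. -/
def airyIntegrand (N : ℕ) (κ : ℤ) (p : ℂ[X]) (z : ℂ) (s : ℝ) : ℂ :=
  Complex.exp (z * contour N κ s + κ * contour N κ s ^ N) * p.eval (contour N κ s)

/-- The integral `∫ exp(zξ + κ ξ^N) p(ξ) ds` over the contour `ξ = c + is`. -/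
def airyInt (N : ℕ) (κ : ℤ) (p : ℂ[X]) (z : ℂ) : ℂ := ∫ s : ℝ, airyIntegrand N κ p z s

theorem continuous_contour (N : ℕ) (κ : ℤ) : Continuous (contour N κ) := by
  unfold contour
  fun_prop

theorem continuous_airyIntegrand (N : ℕ) (κ : ℤ) (p : ℂ[X]) (z : ℂ) :
    Continuous (airyIntegrand N κ p z) := by
  have := continuous_contour N κ
  unfold airyIntegrand
  exact (by fun_prop : Continuous fun s : ℝ =>
    Complex.exp (z * contour N κ s + κ * contour N κ s ^ N)).mul (p.continuous.comp this)

section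

variable {N : ℕ} (hN : 2 ≤ N) {κ : ℤ} (hκ : IsHeatSign N κ)

include hN hκ

/-- The linear growth `(ρ + 1)|s|` in the exponent costs half of the Gaussian after completing the
square. Uniformity on discs in `z` is what differentiation under the integral requires. -/
theorem exists_norm_airyIntegrand_le (p : ℂ[X]) (ρ : ℝ) :
    ∃ K : ℝ, ∀ z : ℂ, ‖z‖ ≤ ρ → ∀ s : ℝ,
      ‖airyIntegrand N κ p z s‖ ≤ K * Real.exp (-(1 / 2) * s ^ 2) := by
  obtain ⟨C, hC⟩ := exists_re_contour_pow_le hN hκ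
  obtain ⟨D, hD, hp⟩ := exists_norm_eval_le_exp p
  refine ⟨D * Real.exp (ρ + 1 + C + (ρ + 1) ^ 2 / 2), fun z hz s => ?_⟩
  have hξ := norm_contour_le hκ s
  have hρ : 0 ≤ ρ := (norm_nonneg z).trans hz
  rw [airyIntegrand, norm_mul, Complex.norm_exp, Complex.add_re]
  have h1 : (z * contour N κ s).re ≤ ρ * (1 + |s|) := by
    refine (Complex.re_le_norm _).trans ?_
    rw [norm_mul]
    exact mul_le_mul hz hξ (norm_nonneg _) hρ
  have h2 : ‖p.eval (contour N κ s)‖ ≤ D * Real.exp (1 + |s|) :=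
    (hp _).trans (mul_le_mul_of_nonneg_left (Real.exp_le_exp.mpr hξ) hD)
  calc Real.exp ((z * contour N κ s).re + ((κ : ℂ) * contour N κ s ^ N).re) *
        ‖p.eval (contour N κ s)‖
      ≤ Real.exp (ρ * (1 + |s|) + (C - s ^ 2)) * (D * Real.exp (1 + |s|)) :=
        mul_le_mul (Real.exp_le_exp.mpr (add_le_add h1 (hC s))) h2 (norm_nonneg _)
          (Real.exp_nonneg _)
    _ = D * Real.exp (ρ * (1 + |s|) + (C - s ^ 2) + (1 + |s|)) := by
        rw [Real.exp_add _ (1 + |s|)]; ring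
    _ ≤ D * Real.exp (ρ + 1 + C + (ρ + 1) ^ 2 / 2 + -(1 / 2) * s ^ 2) := by
        refine mul_le_mul_of_nonneg_left (Real.exp_le_exp.mpr ?_) hD
        have := sq_nonneg (ρ + 1 - |s|)
        rw [← sq_abs s]
        nlinarith
    _ = _ := by rw [Real.exp_add _ (-(1 / 2) * s ^ 2)]; ring

theorem integrable_airyIntegrand (p : ℂ[X]) (z : ℂ) : Integrable (airyIntegrand N κ p z) := by
  obtain ⟨K, hK⟩ := exists_norm_airyIntegrand_le hN hκ p ‖z‖
  exact ((integrable_exp_neg_mul_sq (b := 1 / 2) (by norm_num)).const_mul K).mono'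
    (continuous_airyIntegrand N κ p z).aestronglyMeasurable (ae_of_all _ (hK z le_rfl))

theorem airyInt_add (p q : ℂ[X]) (z : ℂ) :
    airyInt N κ (p + q) z = airyInt N κ p z + airyInt N κ q z := by
  rw [airyInt, airyInt, airyInt, ← integral_add (integrable_airyIntegrand hN hκ p z)
    (integrable_airyIntegrand hN hκ q z)]
  refine integral_congr_ae (ae_of_all _ fun s => ?_)
  simp only [airyIntegrand, eval_add, mul_add]

omit hN hκ in
theorem airyInt_C_mul (a : ℂ) (p : ℂ[X]) (z : ℂ) :
    airyInt N κ (C a * p) z = a * airyInt N κ p z := by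
  rw [airyInt, airyInt, ← integral_const_mul]
  refine integral_congr_ae (ae_of_all _ fun s => ?_)
  simp only [airyIntegrand, eval_mul, eval_C]
  ring

omit hN hκ in
theorem airyInt_zero (z : ℂ) : airyInt N κ 0 z = 0 := by
  simp [airyInt, airyIntegrand]

theorem airyInt_sum {ι : Type*} (t : Finset ι) (p : ι → ℂ[X]) (z : ℂ) :
    airyInt N κ (∑ i ∈ t, p i) z = ∑ i ∈ t, airyInt N κ (p i) z := by
  classical
  induction t using Finset.induction_on with
  | empty => simp [airyInt_zero]
  | insert i t hi ih => rw [Finset.sum_insert hi, Finset.sum_insert hi, airyInt_add hN hκ, ih]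

theorem hasDerivAt_airyInt (p : ℂ[X]) (z : ℂ) :
    HasDerivAt (airyInt N κ p) (airyInt N κ (X * p) z) z := by
  obtain ⟨K, hK⟩ := exists_norm_airyIntegrand_le hN hκ (X * p) (‖z‖ + 1)
  refine (hasDerivAt_integral_of_dominated_loc_of_deriv_le (Metric.ball_mem_nhds z one_pos)
    (Eventually.of_forall fun x => (continuous_airyIntegrand N κ p x).aestronglyMeasurable)
    (integrable_airyIntegrand hN hκ p z)
    (continuous_airyIntegrand N κ (X * p) z).aestronglyMeasurable
    (ae_of_all _ fun s x hx => hK x ?_ s)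
    ((integrable_exp_neg_mul_sq (b := 1 / 2) (by norm_num)).const_mul K)
    (ae_of_all _ fun s x _ => ?_)).2
  · have h1 := norm_sub_norm_le x z
    have h2 := mem_ball_iff_norm.mp hx
    linarith
  · have h : HasDerivAt (fun x : ℂ => x * contour N κ s + κ * contour N κ s ^ N)
        (contour N κ s) x := by
      simpa using ((hasDerivAt_id x).mul_const (contour N κ s)).add_const
        ((κ : ℂ) * contour N κ s ^ N)
    have h3 := h.cexp.mul_const (p.eval (contour N κ s))
    have e : airyIntegrand N κ (X * p) x s = Complex.exp (x * contour N κ s +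
        κ * contour N κ s ^ N) * contour N κ s * p.eval (contour N κ s) := by
      rw [airyIntegrand, eval_mul, eval_X, mul_assoc]
    rw [e]
    exact h3

theorem differentiable_airyInt (p : ℂ[X]) : Differentiable ℂ (airyInt N κ p) :=
  fun z => (hasDerivAt_airyInt hN hκ p z).differentiableAt

omit hN hκ in
/-- The amplitude of `z ∫ exp(zξ + κ ξ^N) p(ξ) ds` after integration by parts. -/
def ampShift (N : ℕ) (κ : ℤ) (p : ℂ[X]) : ℂ[X] :=
  -(C ((κ : ℂ) * N) * X ^ (N - 1) * p + derivative p)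

/-- Integration by parts: the `s`-derivative of the integrand is `i` times the integrand with
amplitude `z p - ampShift p`, and its integral vanishes. -/
theorem mul_airyInt (p : ℂ[X]) (z : ℂ) :
    z * airyInt N κ p z = airyInt N κ (ampShift N κ p) z := by
  have hd : ∀ s : ℝ, HasDerivAt (airyIntegrand N κ p z)
      (Complex.I * airyIntegrand N κ (C z * p + C (-1) * ampShift N κ p) z s) s := by
    intro s
    have h0 : HasDerivAt (contour N κ) Complex.I s := by
      have := ((hasDerivAt_id s).ofReal_comp.mul_const Complex.I).const_add
        (contourAbscissa N κ : ℂ)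
      exact this.congr_deriv (by simp)
    have h1 : HasDerivAt (fun s => z * contour N κ s + κ * contour N κ s ^ N)
        (z * Complex.I + κ * (N * contour N κ s ^ (N - 1) * Complex.I)) s :=
      (h0.const_mul z).add ((h0.fun_pow N).const_mul _)
    have h2 : HasDerivAt (fun s => p.eval (contour N κ s))
        ((derivative p).eval (contour N κ s) * Complex.I) s :=
      (p.hasDerivAt (contour N κ s)).comp s h0
    refine (h1.cexp.mul h2).congr_deriv ?_
    simp only [airyIntegrand, ampShift, eval_add, eval_mul, eval_C, eval_neg, eval_pow, eval_X]
    ring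
  have hint := integrable_airyIntegrand hN hκ (C z * p + C (-1) * ampShift N κ p) z
  have h := integral_eq_zero_of_hasDerivAt_of_integrable hd (hint.const_mul Complex.I)
    (integrable_airyIntegrand hN hκ p z)
  rw [integral_const_mul, mul_eq_zero, or_iff_right Complex.I_ne_zero] at h
  change airyInt N κ _ z = 0 at h
  rw [airyInt_add hN hκ, airyInt_C_mul, airyInt_C_mul] at h
  linear_combination h

theorem pow_mul_airyInt (p : ℂ[X]) (z : ℂ) (a : ℕ) :
    z ^ a * airyInt N κ p z = airyInt N κ ((ampShift N κ)^[a] p) z := by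
  induction a with
  | zero => simp
  | succ a ih =>
    rw [pow_succ', mul_assoc, ih, mul_airyInt hN hκ, Function.iterate_succ_apply']

/-- The factor `X^(N-1)` wins over the derivative. The exact degree is what later separates the
amplitudes of different building blocks. -/
theorem degree_ampShift {p : ℂ[X]} (hp : p ≠ 0) :
    degree (ampShift N κ p) = degree p + (N - 1 : ℕ) := by
  have hκ0 : (κ : ℂ) * N ≠ 0 := by
    have h : (κ : ℂ) * κ = 1 := by exact_mod_cast hκ.sq
    have h1 : (κ : ℂ) ≠ 0 := left_ne_zero_of_mul_eq_one h
    exact mul_ne_zero h1 (Nat.cast_ne_zero.mpr (by omega))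
  have h1 : degree (C ((κ : ℂ) * N) * X ^ (N - 1) * p) = degree p + (N - 1 : ℕ) := by
    rw [degree_mul, degree_mul, degree_C hκ0, degree_X_pow, zero_add, add_comm]
  rw [ampShift, degree_neg, degree_add_eq_left_of_degree_lt, h1]
  rw [h1]
  refine (degree_derivative_lt hp).trans_le ?_
  exact le_add_of_nonneg_right (by positivity)

theorem degree_iterate_ampShift (j a : ℕ) :
    degree ((ampShift N κ)^[a] (X ^ j)) = ((j + a * (N - 1) : ℕ) : WithBot ℕ) := by
  induction a with
  | zero => simp
  | succ a ih =>
    rw [Function.iterate_succ_apply', degree_ampShift hN hκ, ih]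
    · norm_cast
      ring
    · intro h
      rw [h, degree_zero] at ih
      exact absurd ih.symm (WithBot.natCast_ne_bot _)

/-- An amplitude whose integral vanishes for all real `z` is zero. -/
theorem eq_zero_of_airyInt_eq_zero (p : ℂ[X]) (h : ∀ z : ℝ, airyInt N κ p z = 0) : p = 0 := by
  -- At `z = -2πv` the integral is a nonzero factor times the Fourier transform at `v` of the
  -- integrand for `z = 0`. Fourier inversion then makes `p` vanish on the whole contour, which is
  -- infinite.
  have hF : FourierTransform.fourier (airyIntegrand N κ p 0) = 0 := by
    ext v
    rw [Real.fourier_real_eq_integral_exp_smul, Pi.zero_apply]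
    have h1 := h (-2 * Real.pi * v)
    rw [airyInt] at h1
    have h2 : ∀ s : ℝ, airyIntegrand N κ p ((-2 * Real.pi * v : ℝ) : ℂ) s =
        Complex.exp ((-2 * Real.pi * v : ℝ) * (contourAbscissa N κ : ℂ)) *
          (Complex.exp (((-2 * Real.pi * s * v : ℝ) : ℂ) * Complex.I) •
            airyIntegrand N κ p 0 s) := by
      intro s
      rw [airyIntegrand, airyIntegrand, smul_eq_mul, ← mul_assoc, ← mul_assoc, ← Complex.exp_add,
        ← Complex.exp_add]
      congr 2
      rw [contour]
      push_cast
      ring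
    simp_rw [h2] at h1
    rw [integral_const_mul] at h1
    exact (mul_eq_zero.mp h1).resolve_left (Complex.exp_ne_zero _)
  have hinv := (continuous_airyIntegrand N κ p 0).fourierInv_fourier_eq
    (integrable_airyIntegrand hN hκ p 0) (by rw [hF]; exact integrable_zero _ _ _)
  rw [hF] at hinv
  have hz : ∀ s : ℝ, p.eval (contour N κ s) = 0 := by
    intro s
    have h1 := congrFun hinv s
    rw [Real.fourierInv_eq'] at h1
    simp only [Pi.zero_apply, smul_zero, integral_zero] at h1
    rw [airyIntegrand, eq_comm, mul_eq_zero] at h1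
    exact h1.resolve_left (Complex.exp_ne_zero _)
  refine Polynomial.eq_zero_of_infinite_isRoot p ?_
  refine (Set.infinite_range_of_injective (f := contour N κ) ?_).mono ?_
  · intro s s' hs
    simpa [contour] using hs
  · rintro _ ⟨s, rfl⟩
    exact hz s

end

end

noncomputable section

/-! ### The building blocks of the heat kernel expansion -/

open Polynomial Filter Topology

section

variable {N : ℕ} (hN : 2 ≤ N) {κ : ℤ} (hκ : IsHeatSign N κ)

include hN hκ

theorem iteratedDeriv_airyN (j : ℕ) :
    iteratedDeriv j (airyN N κ) =
      fun z : ℝ => 1 / (2 * (Real.pi : ℂ)) * airyInt N κ (X ^ j) z := by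
  induction j with
  | zero =>
    rw [iteratedDeriv_zero]
    funext z
    simp only [airyN, airyInt, airyIntegrand, contour, pow_zero, eval_one, mul_one]
  | succ j ih =>
    rw [iteratedDeriv_succ, ih]
    funext z
    rw [pow_succ']
    exact (((hasDerivAt_airyInt hN hκ (X ^ j) z).comp_ofReal).const_mul _).deriv

theorem hasDerivAt_iteratedDeriv_airyN (j : ℕ) (z : ℝ) :
    HasDerivAt (iteratedDeriv j (airyN N κ)) (iteratedDeriv (j + 1) (airyN N κ) z) z := by
  rw [iteratedDeriv_airyN hN hκ, iteratedDeriv_airyN hN hκ, pow_succ']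
  exact ((hasDerivAt_airyInt hN hκ (X ^ j) z).comp_ofReal).const_mul _

/-- The differential equation of the Airy-type function. -/
theorem iteratedDeriv_airyN_add (l : ℕ) (z : ℝ) :
    iteratedDeriv (N - 1 + l) (airyN N κ) z = -((κ : ℂ) / N) *
      (z * iteratedDeriv l (airyN N κ) z + l * iteratedDeriv (l - 1) (airyN N κ) z) := by
  have hκ2 : (κ : ℂ) * κ = 1 := by exact_mod_cast hκ.sq
  have hN0 : (N : ℂ) ≠ 0 := Nat.cast_ne_zero.mpr (by omega)
  have h := mul_airyInt hN hκ (X ^ l) (z : ℂ)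
  -- For `l = 0` the truncated exponent `l - 1` is harmless, as its factor `l` is zero.
  have e : ampShift N κ (X ^ l) =
      C (-((κ : ℂ) * N)) * X ^ (N - 1 + l) + C (-(l : ℂ)) * X ^ (l - 1) := by
    simp only [ampShift, derivative_X_pow, C_neg, pow_add, mul_assoc]
    ring
  rw [e, airyInt_add hN hκ, airyInt_C_mul, airyInt_C_mul] at h
  simp only [iteratedDeriv_airyN hN hκ]
  field_simp
  linear_combination (κ : ℂ) * h - (N : ℂ) * airyInt N κ (X ^ (N - 1 + l)) z * hκ2

theorem hasDerivAt_heatTerm_left (k j : ℕ) (x y : ℝ) {t : ℝ} (ht : 0 < t) :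
    HasDerivAt (fun ξ => heatTerm N κ k j ξ y t) (heatTerm N κ k (j + 1) x y t) x := by
  have hN0 : (N : ℝ) ≠ 0 := Nat.cast_ne_zero.mpr (by omega)
  have h1 : HasDerivAt (fun ξ : ℝ => (ξ - y) / t ^ ((1 : ℝ) / N)) (1 / t ^ ((1 : ℝ) / N)) x :=
    ((hasDerivAt_id x).sub_const y).div_const _
  have h2 := ((hasDerivAt_iteratedDeriv_airyN hN hκ j _).scomp x h1).const_mul
    ((t ^ ((k : ℝ) - ((j : ℝ) + 1) / N) : ℝ) : ℂ)
  refine h2.congr_deriv ?_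
  have e : t ^ ((k : ℝ) - (((j + 1 : ℕ) : ℝ) + 1) / N) =
      t ^ ((k : ℝ) - ((j : ℝ) + 1) / N) * (1 / t ^ ((1 : ℝ) / N)) := by
    rw [one_div, ← Real.rpow_neg ht.le, ← Real.rpow_add ht]
    congr 1
    push_cast
    ring
  rw [heatTerm, e, Complex.real_smul]
  push_cast
  ring

theorem iteratedDeriv_heatTerm (k j i : ℕ) (y : ℝ) {t : ℝ} (ht : 0 < t) :
    iteratedDeriv i (fun ξ => heatTerm N κ k j ξ y t) = fun x => heatTerm N κ k (j + i) x y t := by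
  induction i with
  | zero => rw [iteratedDeriv_zero]; rfl
  | succ i ih =>
    rw [iteratedDeriv_succ, ih]
    funext x
    exact (hasDerivAt_heatTerm_left hN hκ k (j + i) x y ht).deriv

theorem contDiff_heatTerm (k j : ℕ) (y : ℝ) {t : ℝ} (ht : 0 < t) :
    ContDiff ℝ ∞ (fun ξ => heatTerm N κ k j ξ y t) := by
  refine contDiff_of_differentiable_iteratedDeriv fun m _ => ?_
  rw [iteratedDeriv_heatTerm hN hκ k j m y ht]
  exact fun x => (hasDerivAt_heatTerm_left hN hκ k (j + m) x y ht).differentiableAt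

/-- This is `t ∂^{N-1} K = -(κ/N)(x-y) K`, differentiated `l` times in `x` and multiplied by `t^k`.
-/
theorem heatTerm_reduce (k l : ℕ) (x y : ℝ) {t : ℝ} (ht : 0 < t) :
    heatTerm N κ (k + 1) (N - 1 + l) x y t = -((κ : ℂ) / N) *
      (((x - y : ℝ) : ℂ) * heatTerm N κ k l x y t + l * heatTerm N κ k (l - 1) x y t) := by
  have hN0 : (N : ℝ) ≠ 0 := Nat.cast_ne_zero.mpr (by omega)
  have hNl : ((N - 1 + l : ℕ) : ℝ) = N - 1 + l := by
    rw [Nat.cast_add, Nat.cast_sub (by omega), Nat.cast_one]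
  have e1 : t ^ (((k + 1 : ℕ) : ℝ) - (((N - 1 + l : ℕ) : ℝ) + 1) / N) *
      ((x - y) / t ^ ((1 : ℝ) / N)) = t ^ ((k : ℝ) - ((l : ℝ) + 1) / N) * (x - y) := by
    rw [div_eq_mul_inv (x - y), ← Real.rpow_neg ht.le, mul_left_comm, ← Real.rpow_add ht, mul_comm]
    congr 2
    rw [hNl]
    push_cast
    field_simp
    ring
  have e2 : (l : ℂ) * ((t ^ (((k + 1 : ℕ) : ℝ) - (((N - 1 + l : ℕ) : ℝ) + 1) / N) : ℝ) : ℂ) =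
      l * ((t ^ ((k : ℝ) - (((l - 1 : ℕ) : ℝ) + 1) / N) : ℝ) : ℂ) := by
    rcases Nat.eq_zero_or_pos l with rfl | hl
    · simp
    · congr 3
      rw [hNl, Nat.cast_sub hl]
      push_cast
      field_simp
      ring
  have e1' := congrArg (Complex.ofReal) e1
  rw [Complex.ofReal_mul, Complex.ofReal_mul] at e1'
  rw [heatTerm, iteratedDeriv_airyN_add hN hκ, heatTerm, heatTerm]
  linear_combination (-((κ : ℂ) / N) * iteratedDeriv l (airyN N κ) ((x - y) / t ^ ((1 : ℝ) / N))) *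
    e1' - ((κ : ℂ) / N) * iteratedDeriv (l - 1) (airyN N κ) ((x - y) / t ^ ((1 : ℝ) / N)) * e2

omit hN hκ in
theorem mul_heatTerm (k j : ℕ) (x y : ℝ) {t : ℝ} (ht : 0 < t) :
    (t : ℂ) * heatTerm N κ k j x y t = heatTerm N κ (k + 1) j x y t := by
  rw [heatTerm, heatTerm, ← mul_assoc]
  congr 1
  rw [← Complex.ofReal_mul, mul_comm, ← Real.rpow_add_one ht.ne']
  congr 2
  push_cast
  ring

/-- The product rule for `t^k ∂^j K` together with `∂_t K = κ ∂^N K`, the latter coming from scaling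
and the Airy equation. -/
theorem hasDerivAt_heatTerm_time (k j : ℕ) (x y : ℝ) {t : ℝ} (ht : 0 < t) :
    HasDerivAt (fun τ => heatTerm N κ k j x y τ)
      (k * heatTerm N κ (k - 1) j x y t + κ * heatTerm N κ k (j + N) x y t) t := by
  have hN0 : (N : ℝ) ≠ 0 := Nat.cast_ne_zero.mpr (by omega)
  have hNc : (N : ℂ) ≠ 0 := Nat.cast_ne_zero.mpr (by omega)
  have hκ2 : (κ : ℂ) * κ = 1 := by exact_mod_cast hκ.sq
  set r : ℝ := (k : ℝ) - ((j : ℝ) + 1) / N with hr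
  set z : ℝ := (x - y) / t ^ ((1 : ℝ) / N) with hz
  have h1 : HasDerivAt (fun τ : ℝ => ((τ ^ r : ℝ) : ℂ)) ((r * t ^ (r - 1) : ℝ) : ℂ) t :=
    (Real.hasDerivAt_rpow_const (Or.inl ht.ne')).ofReal_comp
  have h2 : HasDerivAt (fun τ : ℝ => (x - y) / τ ^ ((1 : ℝ) / N)) (-(z / (N * t))) t := by
    have h := ((Real.hasDerivAt_rpow_const (p := -((1 : ℝ) / N)) (Or.inl ht.ne')).const_mul (x - y))
    refine (h.congr_deriv ?_).congr_of_eventuallyEq ?_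
    · rw [hz, Real.rpow_sub_one ht.ne', Real.rpow_neg ht.le]
      field_simp
    · filter_upwards [lt_mem_nhds ht] with τ hτ
      rw [Real.rpow_neg hτ.le, div_eq_mul_inv]
  have h3 := h1.mul ((hasDerivAt_iteratedDeriv_airyN hN hκ j _).scomp t h2)
  refine h3.congr_deriv ?_
  have e1 : heatTerm N κ k (j + N) x y t = ((t ^ (r - 1) : ℝ) : ℂ) * (-((κ : ℂ) / N) *
      (z * iteratedDeriv (j + 1) (airyN N κ) z + (j + 1) * iteratedDeriv j (airyN N κ) z)) := by
    have h := iteratedDeriv_airyN_add hN hκ (j + 1) z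
    rw [show N - 1 + (j + 1) = j + N by omega, Nat.add_sub_cancel] at h
    rw [heatTerm, ← hz, h]
    push_cast
    congr 3
    rw [hr]
    field_simp
    ring
  have e2 : (k : ℂ) * heatTerm N κ (k - 1) j x y t =
      k * (((t ^ (r - 1) : ℝ) : ℂ) * iteratedDeriv j (airyN N κ) z) := by
    rcases Nat.eq_zero_or_pos k with rfl | hk
    · simp
    · rw [heatTerm, ← hz]
      congr 4
      rw [hr, Nat.cast_sub hk]
      push_cast
      ring
  have e3 : t ^ r = t ^ (r - 1) * t := by
    rw [← Real.rpow_add_one ht.ne', sub_add_cancel]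
  have htc : (t : ℂ) ≠ 0 := Complex.ofReal_ne_zero.mpr ht.ne'
  have hrc : (r : ℂ) = k - (j + 1) / N := by rw [hr]; push_cast; ring
  rw [e1, e2, Function.comp_apply, Complex.real_smul, e3, ← hz, Complex.ofReal_mul r, hrc]
  generalize t ^ (r - 1) = B
  push_cast
  field_simp
  linear_combination (B : ℂ) * ((z : ℂ) * iteratedDeriv (j + 1) (airyN N κ) z +
    (j + 1) * iteratedDeriv j (airyN N κ) z) * hκ2

/-- For fixed `x ≠ y` the functions `t ↦ t^k t^{-(j+1)/N} A_N^{(j)}((x-y)/t^{1/N})`,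
`0 ≤ j ≤ N - 2`, are linearly independent. -/
theorem heatTerm_linearIndependent {x y : ℝ} (hxy : x ≠ y) (n : ℕ) (c : ℕ → Fin (N - 1) → ℂ)
    (h : ∀ t : ℝ, 0 < t →
      ∑ k ∈ Finset.range (n + 1), ∑ j : Fin (N - 1), c k j * heatTerm N κ k j x y t = 0)
    (k : ℕ) (hk : k ≤ n) (j : Fin (N - 1)) : c k j = 0 := by
  have hN0 : (N : ℝ) ≠ 0 := Nat.cast_ne_zero.mpr (by omega)
  set w : ℂ := ((x - y : ℝ) : ℂ) with hw
  have hw0 : w ≠ 0 := Complex.ofReal_ne_zero.mpr (sub_ne_zero.mpr hxy)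
  -- With `t = r^{-N}`, multiplying the relation by `r^{Nn-1}` turns `t^{k-(j+1)/N}` into
  -- `r^{j+N(n-k)}`. All exponents are natural numbers, so `g` is entire.
  let a : ℕ × Fin (N - 1) → ℕ := fun q => q.2 + N * (n - q.1)
  let S : Finset (ℕ × Fin (N - 1)) := Finset.range (n + 1) ×ˢ Finset.univ
  let g : ℂ → ℂ := fun r => ∑ q ∈ S, c q.1 q.2 * (r ^ a q * airyInt N κ (X ^ (q.2 : ℕ)) (w * r))
  have hg : Differentiable ℂ g := by
    refine Differentiable.fun_sum fun q _ => ?_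
    refine (differentiable_const _).mul ((differentiable_id.pow _).mul ?_)
    exact (differentiable_airyInt hN hκ _).comp ((differentiable_const w).mul differentiable_id)
  have hg0 : ∀ r : ℝ, 0 < r → g r = 0 := by
    intro r hr
    have ht : 0 < (r ^ N)⁻¹ := by positivity
    have h1 := h _ ht
    rw [← Finset.sum_product'] at h1
    have hroot : ((r ^ N)⁻¹) ^ ((1 : ℝ) / N) = r⁻¹ := by
      rw [← inv_pow, one_div, Real.pow_rpow_inv_natCast (by positivity) (by omega)]
    have h2 : ∀ q ∈ S, c q.1 q.2 * (((r : ℂ)) ^ a q * airyInt N κ (X ^ (q.2 : ℕ)) (w * r)) =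
        (2 * Real.pi * ((r ^ ((N : ℝ) * n - 1) : ℝ) : ℂ)) *
          (c q.1 q.2 * heatTerm N κ q.1 q.2 x y (r ^ N)⁻¹) := by
      intro q hq
      have hq1 : q.1 ≤ n := Nat.lt_succ_iff.mp (Finset.mem_range.mp (Finset.mem_product.mp hq).1)
      have e1 : r ^ a q = r ^ ((N : ℝ) * n - 1) *
          ((r ^ N)⁻¹) ^ ((q.1 : ℝ) - (((q.2 : ℕ) : ℝ) + 1) / N) := by
        rw [← Real.rpow_natCast r N, ← Real.rpow_neg hr.le, ← Real.rpow_mul hr.le,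
          ← Real.rpow_add hr, ← Real.rpow_natCast]
        congr 1
        simp only [a]
        push_cast [Nat.cast_sub hq1]
        field_simp
        ring
      have hpi : (Real.pi : ℂ) ≠ 0 := Complex.ofReal_ne_zero.mpr Real.pi_ne_zero
      rw [heatTerm, iteratedDeriv_airyN hN hκ, hroot, ← Complex.ofReal_pow, e1, div_inv_eq_mul,
        Complex.ofReal_mul]
      beta_reduce
      rw [Complex.ofReal_mul (x - y), ← hw]
      field_simp
    simp only [g]
    rw [Finset.sum_congr rfl h2, ← Finset.mul_sum, h1, mul_zero]
  -- Zeros on the positive half-line accumulate at `1`, so the identity theorem applies.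
  have hgz : ∀ r : ℂ, g r = 0 := by
    have hfreq : ∃ᶠ z in 𝓝[≠] (1 : ℂ), g z = 0 := by
      have ht : Tendsto (fun r : ℝ => (r : ℂ)) (𝓝[>] (1 : ℝ)) (𝓝[≠] (1 : ℂ)) := by
        refine tendsto_nhdsWithin_iff.mpr ⟨?_, ?_⟩
        · have : Tendsto (fun r : ℝ => (r : ℂ)) (𝓝 (1 : ℝ)) (𝓝 ((1 : ℝ) : ℂ)) :=
            Complex.continuous_ofReal.tendsto 1
          rw [Complex.ofReal_one] at this
          exact this.mono_left nhdsWithin_le_nhds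
        · filter_upwards [self_mem_nhdsWithin] with r hr
          have : r ≠ 1 := (Set.mem_Ioi.mp hr).ne'
          simpa using this
      refine ht.frequently (Eventually.frequently ?_)
      filter_upwards [self_mem_nhdsWithin] with r hr
      exact hg0 r (one_pos.trans (Set.mem_Ioi.mp hr))
    have := AnalyticOnNhd.eqOn_zero_of_preconnected_of_frequently_eq_zero
      (fun z _ => hg.analyticAt z) isPreconnected_univ (Set.mem_univ (1 : ℂ)) hfreq
    exact fun r => this (Set.mem_univ r)
  -- At `r = z / w` the powers of `z` are absorbed into amplitudes; `f q` is the amplitude of the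
  -- `q`-th summand.
  let f : ℕ × Fin (N - 1) → ℂ[X] := fun q =>
    C (c q.1 q.2 * (w ^ a q)⁻¹) * (ampShift N κ)^[a q] (X ^ (q.2 : ℕ))
  have hsum : ∑ q ∈ S, f q = 0 := by
    refine eq_zero_of_airyInt_eq_zero hN hκ _ fun z => ?_
    rw [airyInt_sum hN hκ, ← hgz (z / w)]
    refine Finset.sum_congr rfl fun q _ => ?_
    rw [airyInt_C_mul, ← pow_mul_airyInt hN hκ, mul_div_cancel₀ _ hw0, div_pow]
    field_simp
  have hdeg : ∀ q, f q ≠ 0 → degree (f q) = (((q.2 : ℕ) + a q * (N - 1) : ℕ) : WithBot ℕ) := by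
    intro q hq
    have hc : c q.1 q.2 * (w ^ a q)⁻¹ ≠ 0 := fun h0 => hq (by simp only [f, h0, C_0, zero_mul])
    simp only [f]
    rw [degree_mul, degree_C hc, zero_add, degree_iterate_ampShift hN hκ]
  -- The degree of `f (k, j)` is `N (j + (N-1)(n-k))`. As `j < N - 1`, division with remainder by `N
  -- - 1` recovers `j` and `k`, so nonzero summands have distinct degrees and cannot cancel.
  have hpair : Set.Pairwise {q | q ∈ S ∧ f q ≠ 0} (Function.onFun Ne (degree ∘ f)) := by
    rintro ⟨k₁, j₁⟩ ⟨h1S, h1⟩ ⟨k₂, j₂⟩ ⟨h2S, h2⟩ hne heq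
    simp only [Function.comp_apply] at heq
    rw [hdeg _ h1, hdeg _ h2] at heq
    have heq' : (j₁ : ℕ) + (j₁ + N * (n - k₁)) * (N - 1) = j₂ + (j₂ + N * (n - k₂)) * (N - 1) := by
      exact_mod_cast heq
    have hk1 : k₁ ≤ n := Nat.lt_succ_iff.mp (Finset.mem_range.mp (Finset.mem_product.mp h1S).1)
    have hk2 : k₂ ≤ n := Nat.lt_succ_iff.mp (Finset.mem_range.mp (Finset.mem_product.mp h2S).1)
    obtain ⟨M, rfl⟩ : ∃ M, N = M + 1 := ⟨N - 1, by omega⟩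
    simp only [Nat.add_sub_cancel] at heq'
    have e : ∀ (j K : ℕ), j + (j + (M + 1) * K) * M = (M + 1) * (j + M * K) := fun j K => by ring
    rw [e, e] at heq'
    have heq2 := Nat.eq_of_mul_eq_mul_left (Nat.succ_pos M) heq'
    have hj1 : (j₁ : ℕ) < M := j₁.2
    have hj2 : (j₂ : ℕ) < M := j₂.2
    have hmod := congrArg (· % M) heq2
    simp only [Nat.add_mul_mod_self_left, Nat.mod_eq_of_lt hj1, Nat.mod_eq_of_lt hj2] at hmod
    rw [hmod] at heq2
    have hK : n - k₁ = n - k₂ := Nat.eq_of_mul_eq_mul_left (by omega : 0 < M) (by omega)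
    exact hne (Prod.ext (by simp only; omega) (Fin.ext hmod))
  have hsup := degree_sum_eq_of_disjoint f S hpair
  rw [hsum, degree_zero] at hsup
  have hmem : (k, j) ∈ S :=
    Finset.mem_product.mpr ⟨Finset.mem_range.mpr (Nat.lt_succ_of_le hk), Finset.mem_univ j⟩
  have hbot : degree (f (k, j)) = ⊥ := by
    have := Finset.le_sup (f := fun i => degree (f i)) hmem
    rw [← hsup] at this
    exact le_bot_iff.mp this
  by_contra hne
  have hc : c k j * (w ^ a (k, j))⁻¹ ≠ 0 := mul_ne_zero hne (inv_ne_zero (pow_ne_zero _ hw0))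
  have hf0 : f (k, j) ≠ 0 := by
    refine mul_ne_zero (C_ne_zero.mpr hc) fun h0 => ?_
    have := degree_iterate_ampShift hN hκ (j : ℕ) (a (k, j))
    rw [h0, degree_zero] at this
    exact absurd this.symm (WithBot.natCast_ne_bot _)
  exact hf0 (degree_eq_bot.mp hbot)

end

end

noncomputable section

/-! ### Calculus with `∂` and multiplication operators -/

namespace PsDO

variable {R : Type*} [CommRing R]

instance : Module R (PsDO R) where
  smul a P := ⟨fun n => a * P.coeff n, by
    obtain ⟨m, hm⟩ := P.bounded
    exact ⟨m, fun n hn => by rw [hm n hn, mul_zero]⟩⟩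
  one_smul P := PsDO.ext (funext fun n => one_mul _)
  mul_smul a b P := PsDO.ext (funext fun n => mul_assoc _ _ _)
  smul_zero a := PsDO.ext (funext fun n => mul_zero _)
  smul_add a P Q := PsDO.ext (funext fun n => mul_add _ _ _)
  add_smul a b P := PsDO.ext (funext fun n => add_mul _ _ _)
  zero_smul P := PsDO.ext (funext fun n => zero_mul _)

theorem smul_coeff (a : R) (P : PsDO R) (n : ℤ) : (a • P).coeff n = a * P.coeff n := rfl

theorem OrdLE.smul {P : PsDO R} {m : ℤ} (h : P.OrdLE m) (a : R) : (a • P).OrdLE m :=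
  fun n hn => by rw [smul_coeff, h n hn, mul_zero]

theorem smul_mono (a b : R) (i : ℤ) : a • mono b i = mono (a * b) i := by
  ext n
  rw [smul_coeff, mono_coeff, mono_coeff, mul_ite, mul_zero]

theorem intCast_coeff [Differential R] (k n : ℤ) :
    ((k : ℤ) : PsDO R).coeff n = if n = 0 then (k : R) else 0 := by
  have h : ((k : ℤ) : PsDO R) = k • (1 : PsDO R) := by simp
  rw [h]
  refine (map_zsmul (coeffHom (R := R) n) k 1).trans ?_
  change k • (1 : PsDO R).coeff n = _
  rw [one_coeff]
  split_ifs <;> simp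

variable [Differential R]

theorem smul_mul (a : R) (P Q : PsDO R) : (a • P) * Q = a • (P * Q) := by
  ext n
  rw [smul_coeff, mul_coeff, mul_coeff]
  refine (((AddMonoidHom.mulLeft a).map_finsum (mulTerm_finite P Q n)).trans
    (finsum_congr fun p => ?_)).symm
  simp only [AddMonoidHom.coe_mulLeft, mulTerm, smul_coeff, mul_assoc, mul_smul_comm]

theorem mono_zero_mul (a : R) (P : PsDO R) : mono a 0 * P = a • P := by
  have h : mono a 0 = a • (1 : PsDO R) := by rw [one_eq_mono, smul_mono, mul_one]
  rw [h, smul_mul, one_mul]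

theorem mono_mul_partial (a : R) (i j : ℤ) : mono a i * mono 1 j = mono a (i + j) := by
  ext n
  rw [mono_coeff]
  by_cases h : n ≤ i + j
  · obtain ⟨d, hd⟩ := Int.eq_ofNat_of_zero_le (sub_nonneg.mpr h)
    rw [mono_mul_mono_coeff a 1 i j n d (by omega)]
    rcases Nat.eq_zero_or_pos d with rfl | hpos
    · rw [if_pos (by omega), Ring.choose_zero_right, one_smul, dIter_zero_left, mul_one]
    · rw [if_neg (by omega), dIter_one_of_pos hpos, mul_zero, smul_zero]
  · rw [(ordLE_mono a i).mul (ordLE_mono 1 j) n (by omega), if_neg (by omega)]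

theorem partial_pow (n : ℕ) : (mono (1 : R) 1) ^ n = mono 1 n := by
  induction n with
  | zero => rw [pow_zero, one_eq_mono]; rfl
  | succ n ih => rw [pow_succ, ih, mono_mul_partial, Nat.cast_succ]

theorem mul_partial_coeff (P : PsDO R) (j n : ℤ) : (P * mono 1 j).coeff n = P.coeff (n - j) := by
  rw [mul_coeff, finsum_eq_single _ (n - j, 0)]
  · simp [mulTerm, mono_coeff, dIter_zero_left]
  · rintro ⟨i, l⟩ hne
    by_cases h : n - i + l = j
    · have hl : 0 < l := by
        rcases Nat.eq_zero_or_pos l with rfl | h'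
        · exact absurd (by rw [Prod.mk.injEq]; omega) hne
        · exact h'
      simp [mulTerm, mono_coeff, h, dIter_one_of_pos hl]
    · simp [mulTerm, mono_coeff, h, dIter_zero]

/-- `∂^i η = η ∂^i + i η' ∂^{i-1}` if `η'' = 0`. -/
theorem partial_mul_mono {η γ : R} (hη : Differential.deriv η = γ) (hγ : Differential.deriv γ = 0)
    (i : ℤ) : mono 1 i * mono η 0 = η • mono 1 i + ((i : R) * γ) • mono 1 (i - 1) := by
  ext n
  rw [add_coeff, smul_coeff, smul_coeff, mono_coeff, mono_coeff]
  by_cases h : n ≤ i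
  · obtain ⟨d, hd⟩ := Int.eq_ofNat_of_zero_le (sub_nonneg.mpr h)
    rw [mono_mul_mono_coeff 1 η i 0 n d (by omega)]
    rcases d with _ | _ | d
    · rw [if_pos (by omega), if_neg (by omega), Ring.choose_zero_right, dIter_zero_left]
      simp
    · rw [if_neg (by omega), if_pos (by omega), Ring.choose_one_right, dIter_succ,
        dIter_zero_left, hη]
      simp
    · rw [if_neg (by omega), if_neg (by omega), dIter_succ', hη, dIter_succ', hγ, dIter_zero]
      simp
  · rw [(ordLE_mono 1 i).mul (ordLE_mono η 0) n (by omega), if_neg (by omega), if_neg (by omega)]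
    simp

/-- The residue of `Z ∘ η` is divisible by `η`. -/
theorem mul_mono_coeff_neg_one (Z : PsDO R) (η : R) :
    (Z * mono η 0).coeff (-1) = Z.coeff (-1) * η := by
  rw [mul_coeff, finsum_eq_single _ (-1, 0)]
  · simp [mulTerm, mono_coeff, dIter_zero_left]
  · rintro ⟨i, l⟩ hne
    by_cases h : -1 - i + (l : ℤ) = 0
    · rcases l with _ | l
      · exact absurd (by rw [Prod.mk.injEq]; omega) hne
      · obtain rfl : i = (l : ℤ) := by push_cast at h; omega
        rw [mulTerm, Ring.choose_natCast, Nat.choose_succ_self]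
        simp
    · simp [mulTerm, mono_coeff, h, dIter_zero]

/-- If `B` has order `b` with a cancellable leading coefficient, then `Z` has order at most `m`
as soon as `Z * B` has order at most `m + b`. -/
theorem OrdLE.of_mul {Z B : PsDO R} {m b : ℤ} (hB : B.OrdLE b)
    (hreg : ∀ a, a * B.coeff b = 0 → a = 0) (h : (Z * B).OrdLE (m + b)) : Z.OrdLE m := by
  have key : ∀ d : ℕ, Z.OrdLE (m + d) → Z.OrdLE m := by
    intro d
    induction d with
    | zero => intro hZ; simpa using hZ
    | succ d ih =>
      intro hZ
      refine ih fun n hn => ?_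
      rcases eq_or_ne n (m + (d + 1 : ℕ)) with rfl | hne
      · refine hreg _ ?_
        rw [← hZ.mul_coeff_top hB]
        exact h _ (by push_cast; omega)
      · exact hZ n (by push_cast at hne ⊢; omega)
  obtain ⟨M, hM⟩ := Z.exists_ordLE
  exact key (M - m).toNat (OrdLE.mono hM (by omega))

/-- The operator `T = ∂^{1-N} ∘ η` that represents multiplication by `t`. -/
def timeOp (N : ℕ) (η : R) : PsDO R := mono 1 (1 - N) * mono η 0

section timeOp

variable {N : ℕ} {η γ : R} (hη : Differential.deriv η = γ) (hγ : Differential.deriv γ = 0)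

theorem partial_mul_timeOp (i : ℤ) :
    mono 1 i * timeOp N η = mono 1 (i + (1 - N)) * mono η 0 := by
  rw [timeOp, ← mul_assoc, mono_mul_partial]

theorem timeOp_ordLE : (timeOp N η).OrdLE (1 - N) :=
  ((ordLE_mono 1 (1 - N : ℤ)).mul (ordLE_mono η 0)).mono (by omega)

theorem timeOp_coeff_top : (timeOp N η).coeff (1 - N) = η := by
  have h := (ordLE_mono (1 : R) (1 - N : ℤ)).mul_coeff_top (ordLE_mono η 0)
  rw [add_zero] at h
  rw [timeOp, h, mono_coeff, mono_coeff, if_pos rfl, if_pos rfl, one_mul]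

theorem timeOp_pow_ordLE (k : ℕ) : (timeOp N η ^ k).OrdLE (k * (1 - N)) := by
  induction k with
  | zero => simpa using ordLE_one
  | succ k ih =>
    rw [pow_succ]
    exact (ih.mul (timeOp_ordLE)).mono (by push_cast; linarith)

include hη hγ

theorem partial_mul_timeOp_expand (i : ℤ) : mono 1 i * timeOp N η =
    η • mono 1 (i + 1 - N) + (((i + 1 - N : ℤ) : R) * γ) • mono 1 (i - N) := by
  rw [partial_mul_timeOp, partial_mul_mono hη hγ]
  congr 3
  · ring
  · push_cast; ring
  · ring

/-- The same rule as `heatTerm_reduce`, with `T` in place of `t` and `η` in place of `-(κ/N)(x-y)`;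
one reduction argument thus serves both. -/
theorem timeOp_reduce (hN : 1 ≤ N) (k l : ℕ) :
    mono 1 ((N - 1 + l : ℕ) : ℤ) * timeOp N η ^ (k + 1) = η • (mono 1 (l : ℤ) * timeOp N η ^ k) +
      ((l : R) * γ) • (mono 1 ((l - 1 : ℕ) : ℤ) * timeOp N η ^ k) := by
  have e1 : ((N - 1 + l : ℕ) : ℤ) + 1 - N = l := by omega
  have e2 : ((N - 1 + l : ℕ) : ℤ) - N = (l : ℤ) - 1 := by omega
  rw [pow_succ', ← mul_assoc, partial_mul_timeOp_expand hη hγ, e1, e2, add_mul, smul_mul, smul_mul,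
    Int.cast_natCast]
  congr 1
  rcases Nat.eq_zero_or_pos l with rfl | hl
  · simp
  · rw [Nat.cast_sub hl, Nat.cast_one]

/-- The operator counterpart of `∂_t K = κ ∂^N K`: up to the sign `κ`, `∂^N` acts as the variable
conjugate to `T`. -/
theorem timeOp_mul_partial {κ : ℤ} (hκ : (N : R) * γ = -κ) :
    timeOp N η * mono 1 N = mono 1 N * timeOp N η + (κ : PsDO R) := by
  rw [partial_mul_timeOp_expand hη hγ, timeOp, partial_mul_mono hη hγ, add_mul, smul_mul, smul_mul,
    mono_mul_partial, mono_mul_partial]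
  ext n
  simp only [add_coeff, smul_coeff, mono_coeff, intCast_coeff]
  rcases eq_or_ne n 0 with rfl | h0
  · rw [if_neg (by omega), if_pos (by omega), if_neg (by omega), if_pos (by omega), if_pos rfl]
    push_cast
    linear_combination (-1 : R) * hκ
  · rw [if_neg (show ¬ n = 1 - N - 1 + N by omega), if_neg (show ¬ n = N - N by omega), if_neg h0]
    have : (n = 1 - (N : ℤ) + N) ↔ (n = N + 1 - N) := by omega
    simp only [this]
    ring

/-- The extra factor `T` on the right turns the commutator term `k T^{k-1}` into `k T^k`, so that `k
= 0` needs no separate formula. -/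
theorem timeOp_pow_mul_partial {κ : ℤ} (hκ : (N : R) * γ = -κ) (k : ℕ) :
    timeOp N η ^ k * mono 1 N * timeOp N η =
      mono 1 N * timeOp N η ^ (k + 1) + (k * κ : PsDO R) * timeOp N η ^ k := by
  induction k with
  | zero => simp
  | succ k ih =>
    have h := timeOp_mul_partial hη hγ hκ
    have hc : timeOp N η * (k * κ : PsDO R) = (k * κ : PsDO R) * timeOp N η :=
      ((Nat.cast_commute k _).mul_left (Int.cast_commute κ _)).eq.symm
    calc timeOp N η ^ (k + 1) * mono 1 N * timeOp N η
        = timeOp N η * (timeOp N η ^ k * mono 1 N * timeOp N η) := by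
          rw [pow_succ']; simp only [mul_assoc]
      _ = (timeOp N η * mono 1 N) * timeOp N η ^ (k + 1) +
          (timeOp N η * (k * κ : PsDO R)) * timeOp N η ^ k := by
          rw [ih, mul_add]; simp only [mul_assoc]
      _ = mono 1 N * (timeOp N η * timeOp N η ^ (k + 1)) + (κ : PsDO R) * timeOp N η ^ (k + 1) +
          (k * κ : PsDO R) * (timeOp N η * timeOp N η ^ k) := by
          rw [h, hc, add_mul]; simp only [mul_assoc]
      _ = _ := by
          rw [← pow_succ', ← pow_succ']
          push_cast
          rw [add_mul (k : PsDO R), one_mul, add_mul]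
          abel

/-- The symbol of `∂^i T^k` at a zero of `η`. -/
theorem map_partial_mul_timeOp_pow_coeff {S : Type*} [CommRing S] (f : R →+* S) (hf : f η = 0)
    (k : ℕ) (i m : ℤ) : f ((mono 1 i * timeOp N η ^ k).coeff m) =
      if m = i - k * N then ∏ s ∈ Finset.range k, (((i + 1 - (s + 1) * N : ℤ) : S) * f γ) else 0 := by
  induction k generalizing i with
  | zero =>
    rw [pow_zero, mul_one, mono_coeff]
    simp [apply_ite f]
  | succ k ih =>
    -- At a zero of `η` only the second term of the expansion survives. Each factor `T` lowers the
    -- order by `N` and contributes one scalar.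
    rw [pow_succ', ← mul_assoc, partial_mul_timeOp_expand hη hγ, add_mul, smul_mul, smul_mul,
      add_coeff, smul_coeff, smul_coeff, map_add, map_mul, hf, zero_mul, zero_add, map_mul, ih,
      map_mul, map_intCast, Finset.prod_range_succ', mul_ite, mul_zero]
    have e : i - N - k * N = i - ((k + 1 : ℕ) : ℤ) * N := by push_cast; ring
    rw [e]
    split_ifs
    · rw [mul_comm]
      congr 1
      · refine Finset.prod_congr rfl fun s _ => ?_
        congr 2
        push_cast
        ring
      · congr 2
        push_cast
        ring
    · rfl

end timeOp

end PsDO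

/-! ### Reduction to the basis `(k, j)`, `0 ≤ j ≤ N - 2` -/

section reduction

variable {R : Type*} [CommRing R] {N : ℕ}

/-- The part of `∑ e_{j',l} φ(k+1, j'+l)` of level `k + 1`. -/
def upperCoeff (e : Fin (N - 1) → Fin N → R) (j : Fin (N - 1)) : R :=
  ∑ j' : Fin (N - 1), ∑ l : Fin N, if (j' + l : ℕ) = j then e j' l else 0

/-- The part of `∑ e_{j',l} φ(k+1, j'+l)` of level `k`. -/
def lowerCoeff (η γ : R) (e : Fin (N - 1) → Fin N → R) (j : Fin (N - 1)) : R :=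
  ∑ j' : Fin (N - 1), ∑ l : Fin N, ((if (j' + l : ℕ) = N - 1 + j then e j' l * η else 0) +
    (if (j' + l : ℕ) = N + j then e j' l * (((j : ℕ) + 1 : R) * γ) else 0))

/-- The left-hand sides of the transport equations. -/
def transportCoeff (η γ κ : R) (h : ℕ → Fin (N - 1) → R) (e : ℕ → Fin (N - 1) → Fin N → R) :
    ℕ → Fin (N - 1) → R
  | 0, j => -(κ * lowerCoeff η γ (e 0) j)
  | k + 1, j => ((k + 1 : ℕ) : R) * h (k + 1) j -
      κ * (upperCoeff (e k) j + lowerCoeff η γ (e (k + 1)) j)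

theorem map_transportCoeff {S : Type*} [CommRing S] (f : R →+* S) (η γ κ : R)
    (h : ℕ → Fin (N - 1) → R) (e : ℕ → Fin (N - 1) → Fin N → R) (k : ℕ) (j : Fin (N - 1)) :
    f (transportCoeff η γ κ h e k j) = transportCoeff (f η) (f γ) (f κ) (fun k j => f (h k j))
      (fun k j l => f (e k j l)) k j := by
  cases k <;> simp [transportCoeff, upperCoeff, lowerCoeff, apply_ite f]

variable {M : Type*} [AddCommGroup M] [Module R M]

/-- The bound `2N - 3` is the largest value of `j' + l` with `j' ≤ N - 2` and `l ≤ N - 1`. Up to it,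
one application of the rule brings the index below `N - 1`. -/
theorem basis_reduce (hN : 2 ≤ N) {η γ : R} {φ : ℕ → ℕ → M}
    (hφ : ∀ k l, φ (k + 1) (N - 1 + l) = η • φ k l + ((l : R) * γ) • φ k (l - 1)) (k q : ℕ)
    (hq : q ≤ 2 * N - 3) :
    φ (k + 1) q = ∑ j : Fin (N - 1), (if q = j then φ (k + 1) j else 0) +
      ∑ j : Fin (N - 1), ((if q = N - 1 + j then η • φ k j else 0) +
        (if q = N + j then (((j : ℕ) + 1 : R) * γ) • φ k j else 0)) := by
  rcases lt_or_ge q (N - 1) with h | h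
  · rw [Finset.sum_eq_single (⟨q, h⟩ : Fin (N - 1)), Finset.sum_eq_zero]
    · simp
    · intro j _
      rw [if_neg (by omega), if_neg (by omega), add_zero]
    · intro j _ hj
      rw [if_neg]
      rintro rfl
      exact hj rfl
    · simp
  · obtain ⟨l, rfl⟩ := Nat.exists_eq_add_of_le h
    have hl : l < N - 1 := by omega
    rw [hφ, Finset.sum_add_distrib, Finset.sum_eq_zero (s := Finset.univ)
      (f := fun j : Fin (N - 1) => if N - 1 + l = (j : ℕ) then φ (k + 1) j else 0), zero_add]
    · congr 1
      · rw [Finset.sum_eq_single (⟨l, hl⟩ : Fin (N - 1))]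
        · simp
        · intro j _ hj
          rw [if_neg]
          intro h'
          exact hj (Fin.ext (by simp only; omega))
        · simp
      · rcases l with _ | l
        · rw [Finset.sum_eq_zero]
          · simp
          · intro j _
            rw [if_neg (by omega)]
        · rw [Finset.sum_eq_single (⟨l, by omega⟩ : Fin (N - 1))]
          · rw [if_pos (by simp only; omega)]
            push_cast
            rfl
          · intro j _ hj
            rw [if_neg]
            intro h'
            exact hj (Fin.ext (by simp only; omega))
          · simp
    · intro j _
      rw [if_neg (by omega)]

theorem level_reduce (hN : 2 ≤ N) {η γ : R} {φ : ℕ → ℕ → M}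
    (hφ : ∀ k l, φ (k + 1) (N - 1 + l) = η • φ k l + ((l : R) * γ) • φ k (l - 1)) (k : ℕ)
    (e : Fin (N - 1) → Fin N → R) :
    ∑ j : Fin (N - 1), ∑ l : Fin N, e j l • φ (k + 1) (j + l) =
      ∑ j, upperCoeff e j • φ (k + 1) j + ∑ j, lowerCoeff η γ e j • φ k j := by
  have h1 : ∀ (j : Fin (N - 1)) (l : Fin N), e j l • φ (k + 1) (j + l) =
      ∑ i : Fin (N - 1), (if (j + l : ℕ) = i then e j l else 0) • φ (k + 1) i +
      ∑ i : Fin (N - 1), ((if (j + l : ℕ) = N - 1 + i then e j l * η else 0) +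
        (if (j + l : ℕ) = N + i then e j l * (((i : ℕ) + 1 : R) * γ) else 0)) • φ k i := by
    intro j l
    have := j.2
    have := l.2
    rw [basis_reduce hN hφ k (j + l) (by omega), smul_add, Finset.smul_sum, Finset.smul_sum]
    congr 1
    · refine Finset.sum_congr rfl fun i _ => ?_
      split_ifs <;> simp
    · refine Finset.sum_congr rfl fun i _ => ?_
      rw [smul_add, add_smul]
      congr 1 <;> split_ifs <;> simp [mul_smul]
  simp_rw [h1, Finset.sum_add_distrib]
  congr 1
  · simp_rw [upperCoeff, Finset.sum_smul]
    exact Finset.sum_comm_cycle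
  · simp_rw [lowerCoeff, Finset.sum_smul]
    exact Finset.sum_comm_cycle

/-- The abstract computation behind both uses: a truncated expansion is substituted into `t(∂_t -
κL)`, the top-order derivatives having already cancelled. Everything at levels up to `n` is a
transport coefficient, and only level `n + 1` is left over. It is applied to functions of `t` and to
operators `∂^q T^k`. -/
theorem sum_reduce (hN : 2 ≤ N) {η γ : R} (κ : R) {φ : ℕ → ℕ → M}
    (hφ : ∀ k l, φ (k + 1) (N - 1 + l) = η • φ k l + ((l : R) * γ) • φ k (l - 1))
    (h : ℕ → Fin (N - 1) → R) (e : ℕ → Fin (N - 1) → Fin N → R) (n : ℕ) :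
    ∑ k ∈ Finset.range (n + 1), ∑ j : Fin (N - 1), (((k : R) * h k j) • φ k j -
        κ • ∑ l : Fin N, e k j l • φ (k + 1) (j + l)) =
      ∑ k ∈ Finset.range (n + 1), ∑ j : Fin (N - 1), transportCoeff η γ κ h e k j • φ k j -
        κ • ∑ j : Fin (N - 1), upperCoeff (e n) j • φ (n + 1) j := by
  have h1 : ∀ k : ℕ, ∑ j : Fin (N - 1), (((k : R) * h k j) • φ k j -
      κ • ∑ l : Fin N, e k j l • φ (k + 1) (j + l)) =
      ∑ j : Fin (N - 1), ((k : R) * h k j - κ * lowerCoeff η γ (e k) j) • φ k j -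
        κ • ∑ j, upperCoeff (e k) j • φ (k + 1) j := by
    intro k
    rw [Finset.sum_sub_distrib, ← Finset.smul_sum, level_reduce hN hφ k (e k), smul_add,
      ← sub_sub, sub_right_comm, Finset.smul_sum (r := κ) (f := fun j => lowerCoeff η γ (e k) j • φ k j),
      ← Finset.sum_sub_distrib]
    simp_rw [sub_smul, mul_smul]
  simp_rw [h1]
  induction n with
  | zero => simp [transportCoeff]
  | succ n ih =>
    rw [Finset.sum_range_succ, ih, Finset.sum_range_succ _ (n + 1)]
    have h2 : ∑ j : Fin (N - 1), transportCoeff η γ κ h e (n + 1) j • φ (n + 1) j =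
        ∑ j : Fin (N - 1), (((n + 1 : ℕ) : R) * h (n + 1) j -
          κ * lowerCoeff η γ (e (n + 1)) j) • φ (n + 1) j -
        κ • ∑ j, upperCoeff (e n) j • φ (n + 1) j := by
      rw [Finset.smul_sum, ← Finset.sum_sub_distrib]
      refine Finset.sum_congr rfl fun j _ => ?_
      rw [smul_smul, ← sub_smul, transportCoeff]
      congr 1
      ring
    rw [h2]
    abel

end reduction

end

noncomputable section

open PsDO

/-! ### Residues from the transport equations -/

section residue

variable {R : Type*} [CommRing R]

theorem lop_eq_sum_mono (N : ℕ) (u : Fin (N - 1) → R) :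
    lop N u = ∑ i ∈ Finset.range (N + 1), mono ((lop N u).coeff i) i := by
  ext n
  rw [sum_coeff]
  by_cases h : 0 ≤ n ∧ n ≤ N
  · obtain ⟨d, rfl⟩ := Int.eq_ofNat_of_zero_le h.1
    rw [Finset.sum_eq_single_of_mem d (Finset.mem_range.mpr (by omega)), mono_coeff, if_pos rfl]
    intro i _ hi
    rw [mono_coeff, if_neg (by omega)]
  · rw [Finset.sum_eq_zero]
    · rcases lt_or_ge n 0 with hn | hn
      · exact lop_coeff_neg N u n hn
      · exact lop_ordLE N u n (by omega)
    · intro i hi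
      have := Finset.mem_range.mp hi
      rw [mono_coeff, if_neg (by omega)]

variable [Differential R]

theorem lop_mul_mono_coeff (N : ℕ) (u : Fin (N - 1) → R) (a : R) (l : ℕ) :
    (lop N u * mono a 0).coeff l = ∑ i ∈ Finset.range (N + 1),
      (i.choose l : R) * ((lop N u).coeff i * dIter (i - l) a) := by
  conv_lhs => rw [lop_eq_sum_mono, Finset.sum_mul, sum_coeff]
  refine Finset.sum_congr rfl fun i _ => ?_
  rcases le_or_gt l i with h | h
  · rw [mono_mul_mono_coeff _ _ _ _ (l : ℤ) (i - l) (by omega), Ring.choose_natCast,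
      Nat.choose_symm h]
    simp
  · rw [(ordLE_mono _ (i : ℤ)).mul (ordLE_mono a 0) l (by omega), Nat.choose_eq_zero_of_lt h]
    simp

theorem lop_mul_mono (N : ℕ) (u : Fin (N - 1) → R) (a : R) :
    lop N u * mono a 0 = ∑ l : Fin N, (lop N u * mono a 0).coeff (l : ℕ) • mono 1 ((l : ℕ) : ℤ) +
      a • mono 1 N := by
  have hord := (lop_ordLE N u).mul (ordLE_mono a 0)
  ext n
  rw [add_coeff, sum_coeff, smul_coeff, mono_coeff]
  rcases lt_trichotomy n N with h | rfl | h
  · rw [if_neg (by omega), mul_zero, add_zero]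
    rcases lt_or_ge n 0 with hn | hn
    · rw [mul_coeff_of_neg (lop_coeff_neg N u) (fun m hm => by rw [mono_coeff, if_neg (by omega)])
        n hn, Finset.sum_eq_zero]
      intro l _
      rw [smul_coeff, mono_coeff, if_neg (by omega), mul_zero]
    · obtain ⟨d, rfl⟩ := Int.eq_ofNat_of_zero_le hn
      rw [Finset.sum_eq_single (⟨d, by omega⟩ : Fin N)]
      · rw [smul_coeff, mono_coeff, if_pos rfl, mul_one]
      · intro l _ hl
        rw [smul_coeff, mono_coeff, if_neg, mul_zero]
        intro h'
        exact hl (Fin.ext (by simp only; omega))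
      · simp
  · have h1 := (lop_ordLE N u).mul_coeff_top (ordLE_mono a 0)
    rw [add_zero, lop_coeff_top, mono_coeff, if_pos rfl, one_mul] at h1
    rw [h1, if_pos rfl, mul_one, Finset.sum_eq_zero, zero_add]
    intro l _
    have := l.2
    rw [smul_coeff, mono_coeff, if_neg (by omega), mul_zero]
  · rw [hord n (by omega), if_neg (by omega), mul_zero, add_zero, Finset.sum_eq_zero]
    intro l _
    have := l.2
    rw [smul_coeff, mono_coeff, if_neg (by omega), mul_zero]

variable {N : ℕ} {κ : ℤ} {η γ : R}

/-- The truncated dressing operator `∑_{k ≤ n} ∑_j h_{k,j} ∂^j T^k`. -/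
def dressing (N : ℕ) (η : R) (h : ℕ → Fin (N - 1) → R) (n : ℕ) : PsDO R :=
  ∑ k ∈ Finset.range (n + 1), ∑ j : Fin (N - 1),
    h k j • (mono 1 ((j : ℕ) : ℤ) * timeOp N η ^ k)

/-- The coefficients of `L ∘ h_{k,j} - h_{k,j} ∂^N`. -/
def conjCoeff (N : ℕ) (u : Fin (N - 1) → R) (h : ℕ → Fin (N - 1) → R) (k : ℕ) (j : Fin (N - 1))
    (l : Fin N) : R := (lop N u * mono (h k j) 0).coeff (l : ℕ)

/-- The terms `a ∂^{j+N} T^{k+1}` cancel. What remains are the lower coefficients of `L ∘ a` and the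
commutator of `T^k` with `∂^N`. -/
theorem intertwine_term (hη : Differential.deriv η = γ) (hγ : Differential.deriv γ = 0)
    (hκ : (N : R) * γ = -κ) (u : Fin (N - 1) → R) (a : R) (k j : ℕ) :
    (lop N u * (a • (mono 1 (j : ℤ) * timeOp N η ^ k)) -
        (a • (mono 1 (j : ℤ) * timeOp N η ^ k)) * mono 1 N) * timeOp N η =
      ∑ l : Fin N, (lop N u * mono a 0).coeff (l : ℕ) •
        (mono 1 ((j + l : ℕ) : ℤ) * timeOp N η ^ (k + 1)) -
      ((k : R) * κ * a) • (mono 1 (j : ℤ) * timeOp N η ^ k) := by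
  set T := timeOp N η with hT
  have h1 : lop N u * (a • (mono 1 (j : ℤ) * T ^ k)) * T =
      ∑ l : Fin N, (lop N u * mono a 0).coeff (l : ℕ) • (mono 1 ((j + l : ℕ) : ℤ) * T ^ (k + 1)) +
        a • (mono 1 ((j : ℤ) + N) * T ^ (k + 1)) := by
    rw [← mono_zero_mul, ← mul_assoc]
    conv_lhs => rw [lop_mul_mono, add_mul, add_mul, Finset.sum_mul, Finset.sum_mul]
    congr 1
    · refine Finset.sum_congr rfl fun l _ => ?_
      rw [smul_mul, smul_mul, mul_assoc, mul_assoc, ← pow_succ, ← mul_assoc, mono_mul_partial,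
        Nat.cast_add, add_comm (j : ℤ)]
    · rw [smul_mul, smul_mul, mul_assoc, mul_assoc, ← pow_succ, ← mul_assoc, mono_mul_partial,
        add_comm (j : ℤ)]
  have hcomm : mono 1 (j : ℤ) * (k * κ : PsDO R) = (k * κ : PsDO R) * mono 1 (j : ℤ) :=
    ((Nat.cast_commute k _).mul_left (Int.cast_commute κ _)).eq.symm
  have hcast : ∀ P : PsDO R, (k * κ : PsDO R) * P = ((k : R) * κ) • P := fun P => by
    rw [mul_smul, Int.cast_smul_eq_zsmul, Nat.cast_smul_eq_nsmul, zsmul_eq_mul, nsmul_eq_mul,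
      mul_assoc]
  have h2 : a • (mono 1 (j : ℤ) * T ^ k) * mono 1 N * T =
      a • (mono 1 ((j : ℤ) + N) * T ^ (k + 1)) + ((k : R) * κ * a) • (mono 1 (j : ℤ) * T ^ k) := by
    rw [smul_mul, smul_mul, mul_assoc (mono 1 (j : ℤ)), mul_assoc (mono 1 (j : ℤ)), hT,
      timeOp_pow_mul_partial hη hγ hκ, ← hT, mul_add, smul_add, ← mul_assoc, mono_mul_partial,
      ← mul_assoc _ _ (T ^ k), hcomm, mul_assoc (k * κ : PsDO R), hcast, smul_smul, mul_comm a]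
  rw [sub_mul, h1, h2]
  abel

/-- After right multiplication by `T` the operator is `-κ` times the sum treated by `sum_reduce`.
The transport equations remove all levels up to `n`. -/
theorem intertwine_dressing_ordLE (hN : 2 ≤ N) (hκ2 : κ * κ = 1) (hη : Differential.deriv η = γ)
    (hγ : Differential.deriv γ = 0) (hκ : (N : R) * γ = -κ) (hreg : ∀ a, a * η = 0 → a = 0)
    (u : Fin (N - 1) → R) (h : ℕ → Fin (N - 1) → R) (n : ℕ)
    (htr : ∀ k ≤ n, ∀ j, transportCoeff η γ (κ : R) h (conjCoeff N u h) k j = 0) :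
    (lop N u * dressing N η h n - dressing N η h n * mono 1 N).OrdLE (N - 2 - n * (N - 1)) := by
  set Z := lop N u * dressing N η h n - dressing N η h n * mono 1 N with hZ
  have hκR : (κ : R) * κ = 1 := by rw [← Int.cast_mul, hκ2, Int.cast_one]
  have h1 : Z * timeOp N η = ∑ k ∈ Finset.range (n + 1), ∑ j : Fin (N - 1),
      (∑ l : Fin N, conjCoeff N u h k j l • (mono 1 ((j + l : ℕ) : ℤ) * timeOp N η ^ (k + 1)) -
        ((k : R) * κ * h k j) • (mono 1 ((j : ℕ) : ℤ) * timeOp N η ^ k)) := by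
    simp only [hZ, dressing, Finset.mul_sum, Finset.sum_mul, ← Finset.sum_sub_distrib]
    refine Finset.sum_congr rfl fun k _ => Finset.sum_congr rfl fun j _ => ?_
    exact intertwine_term hη hγ hκ u (h k j) k j
  have h2 := sum_reduce (M := PsDO R) hN (κ : R)
    (φ := fun k q => mono 1 (q : ℤ) * timeOp N η ^ k)
    (fun k l => timeOp_reduce hη hγ (by omega) k l) h (conjCoeff N u h) n
  have h3 : Z * timeOp N η = -((κ : R) • ∑ k ∈ Finset.range (n + 1), ∑ j : Fin (N - 1),
      (((k : R) * h k j) • (mono 1 ((j : ℕ) : ℤ) * timeOp N η ^ k) - (κ : R) • ∑ l : Fin N,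
        conjCoeff N u h k j l • (mono 1 ((j + l : ℕ) : ℤ) * timeOp N η ^ (k + 1)))) := by
    rw [h1, Finset.smul_sum, ← Finset.sum_neg_distrib]
    refine Finset.sum_congr rfl fun k _ => ?_
    rw [Finset.smul_sum, ← Finset.sum_neg_distrib]
    refine Finset.sum_congr rfl fun j _ => ?_
    rw [smul_sub, smul_smul, smul_smul, hκR, one_smul, neg_sub]
    congr 2
    ring
  rw [h2, Finset.sum_eq_zero, zero_sub, smul_neg, neg_neg, smul_smul, hκR, one_smul] at h3
  -- `T` has order `1 - N` and leading coefficient `η`, which is not a zero divisor, so it can be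
  -- cancelled. Level `n + 1` has order at most `N - 2 - (n+1)(N-1)`.
  · refine OrdLE.of_mul (timeOp_ordLE (N := N)) (by rw [timeOp_coeff_top]; exact hreg) ?_
    rw [h3]
    refine OrdLE.sum fun j _ => OrdLE.smul ?_ _
    refine ((ordLE_mono 1 ((j : ℕ) : ℤ)).mul (timeOp_pow_ordLE (n + 1))).mono ?_
    have := j.2
    push_cast
    have h4 : ((j : ℕ) : ℤ) ≤ N - 2 := by omega
    linarith
  · intro k hk
    refine Finset.sum_eq_zero fun j _ => ?_
    rw [htr k (Nat.lt_succ_iff.mp (Finset.mem_range.mp hk)) j, zero_smul]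

/-- Every positive power of `T` ends with multiplication by `η`, and level zero is the identity.
Hence `X` does not affect residues at the zero of `η`. -/
theorem exists_dressing_eq_one_add (hN : 2 ≤ N) (h : ℕ → Fin (N - 1) → R)
    (h0 : ∀ j, h 0 j = if (j : ℕ) = 0 then 1 else 0) (n : ℕ) :
    ∃ Y, dressing N η h n = 1 + Y * mono η 0 := by
  refine ⟨∑ k ∈ Finset.range n, ∑ j : Fin (N - 1),
    h (k + 1) j • (mono 1 ((j : ℕ) : ℤ) * (timeOp N η ^ k * mono 1 (1 - N))), ?_⟩
  rw [dressing, Finset.sum_range_succ', add_comm]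
  congr 1
  · rw [Finset.sum_eq_single (⟨0, by omega⟩ : Fin (N - 1))]
    · rw [h0, if_pos rfl, one_smul, pow_zero, mul_one]
      rfl
    · intro j _ hj
      rw [h0, if_neg, zero_smul]
      intro h'
      exact hj (Fin.ext h')
    · simp
  · rw [Finset.sum_mul]
    refine Finset.sum_congr rfl fun k _ => ?_
    rw [Finset.sum_mul]
    refine Finset.sum_congr rfl fun j _ => ?_
    rw [smul_mul, pow_succ, mul_assoc, mul_assoc]
    rfl

/-- The residue of `L^{p/N}` at a zero of `η`, in terms of solutions of the transport equations. -/
theorem res_pow_eq_sum (hN : 2 ≤ N) (hNu : IsUnit (N : R)) (hκ2 : κ * κ = 1)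
    (hη : Differential.deriv η = γ) (hγ : Differential.deriv γ = 0) (hκ : (N : R) * γ = -κ)
    (hreg : ∀ a, a * η = 0 → a = 0) (u : Fin (N - 1) → R) {Q : PsDO R}
    (hQ : IsNthRoot N (lop N u) Q) (h : ℕ → Fin (N - 1) → R)
    (h0 : ∀ j, h 0 j = if (j : ℕ) = 0 then 1 else 0) (n : ℕ)
    (htr : ∀ k ≤ n, ∀ j, transportCoeff η γ (κ : R) h (conjCoeff N u h) k j = 0)
    {S : Type*} [CommRing S] (f : R →+* S) (hf : f η = 0) (p : ℕ) (hp : p ≤ n) :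
    f ((Q ^ p).coeff (-1)) = ∑ k ∈ Finset.range (n + 1), ∑ j : Fin (N - 1), f (h k j) *
      if (-1 - p : ℤ) = (j : ℕ) - k * N then
        ∏ s ∈ Finset.range k, ((((j : ℕ) + 1 - (s + 1) * N : ℤ) : S) * f γ) else 0 := by
  set X := dressing N η h n with hX
  have hD : (mono (1 : R) 1).OrdLE 1 := ordLE_mono 1 1
  have hD1 : (mono (1 : R) 1).coeff 1 = 1 := by rw [mono_coeff, if_pos rfl]
  -- The sandwich turns `Q X - X ∂` into `L X - X ∂^N` and raises the order by exactly `N - 1`, so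
  -- the bound descends to the root.
  have h1 : (Q * X - X * mono 1 1).OrdLE (-1 - n * (N - 1)) := by
    refine OrdLE.of_sandwich hQ.2.1 hQ.1 hD hD1 hNu ?_
    rw [sandwich_intertwiner, hQ.2.2, partial_pow]
    exact (intertwine_dressing_ordLE hN hκ2 hη hγ hκ hreg u h n htr).mono (by linarith)
  have h2 := OrdLE.sandwich hQ.2.1 hD h1 p
  rw [sandwich_intertwiner, partial_pow] at h2
  -- The difference `Q^p X - X ∂^p` has order at most `p - 2 - n(N-1)`, which is below `-1` because
  -- `p ≤ n` and `N ≥ 2`.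
  have h3 : (Q ^ p * X).coeff (-1) = X.coeff (-1 - p) := by
    rw [← mul_partial_coeff, ← sub_eq_zero, ← sub_coeff]
    refine h2 _ ?_
    have hN' : (2 : ℤ) ≤ N := by exact_mod_cast hN
    have hp' : (p : ℤ) ≤ n := by exact_mod_cast hp
    nlinarith
  obtain ⟨Y, hY⟩ := exists_dressing_eq_one_add (η := η) hN h h0 n
  have h4 : f ((Q ^ p * X).coeff (-1)) = f ((Q ^ p).coeff (-1)) := by
    rw [hX, hY, mul_add, mul_one, add_coeff, ← mul_assoc, mul_mono_coeff_neg_one, map_add, map_mul,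
      hf, mul_zero, add_zero]
  rw [← h4, h3, hX, dressing, sum_coeff, map_sum]
  refine Finset.sum_congr rfl fun k _ => ?_
  rw [sum_coeff, map_sum]
  refine Finset.sum_congr rfl fun j _ => ?_
  rw [smul_coeff, map_mul, map_partial_mul_timeOp_pow_coeff hη hγ f hf]

end residue

/-! ### Smooth functions -/

section smooth

variable {I : TopologicalSpace.Opens ℝ}

/-- Evaluation at a point of `I`. -/
def evalHom (x : I) : SmoothFn I →+* ℂ :=
  (Pi.evalRingHom (fun _ : I => ℂ) x).comp (SmoothFn I).val.toRingHom

theorem fval_eq_evalHom (f : SmoothFn I) {x : ℝ} (hx : x ∈ I) : fval f x = evalHom ⟨x, hx⟩ f :=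
  fval_of_mem f hx

theorem smoothFn_ext {f g : SmoothFn I} (h : ∀ x ∈ I, fval f x = fval g x) : f = g := by
  refine Subtype.ext (funext fun x => ?_)
  have := h x x.2
  rwa [fval_of_mem f x.2, fval_of_mem g x.2] at this

theorem fval_deriv (f : SmoothFn I) {x : ℝ} (hx : x ∈ I) :
    fval (Differential.deriv f) x = deriv (fval f) x := fval_of_mem _ hx

theorem fval_eqOn_dIter {f : SmoothFn I} {g : ℝ → ℂ} (h : ∀ x ∈ I, fval f x = g x) (i : ℕ) :
    ∀ x ∈ I, fval (dIter i f) x = iteratedDeriv i g x := by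
  induction i with
  | zero => simpa [dIter_zero_left] using h
  | succ i ih =>
    intro x hx
    rw [dIter_succ, fval_deriv _ hx, iteratedDeriv_succ]
    exact (fval_eventuallyEq (fun y => ih y y.2) ⟨x, hx⟩).deriv_eq

theorem fval_contDiffAt (f : SmoothFn I) {x : ℝ} (hx : x ∈ I) : ContDiffAt ℝ ∞ (fval f) x :=
  (fval_contDiffOn f).contDiffAt (I.isOpen.mem_nhds hx)

/-- The restriction to `I` of a function that is smooth on `I`. -/
def mkFn (g : ℝ → ℂ) (hg : ContDiffOn ℝ ∞ g I) : SmoothFn I :=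
  ⟨fun x => g x, hg.congr fun _ hx => ext0_of_mem _ hx⟩

theorem fval_mkFn {g : ℝ → ℂ} (hg : ContDiffOn ℝ ∞ g I) {x : ℝ} (hx : x ∈ I) :
    fval (mkFn g hg) x = g x := fval_of_mem _ hx

/-- Restriction to a smaller open set. -/
def restrictHom {J I : TopologicalSpace.Opens ℝ} (h : J ≤ I) : SmoothFn I →+* SmoothFn J where
  toFun f := mkFn (fval f) ((fval_contDiffOn f).mono h)
  map_one' := smoothFn_ext fun x hx => by
    rw [fval_mkFn _ hx, fval_eq_evalHom _ (h hx), fval_eq_evalHom _ hx, map_one, map_one]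
  map_mul' f g := smoothFn_ext fun x hx => by
    rw [fval_mkFn _ hx, fval_eq_evalHom _ (h hx), fval_eq_evalHom _ hx, map_mul, map_mul,
      ← fval_eq_evalHom, ← fval_eq_evalHom, ← fval_eq_evalHom, ← fval_eq_evalHom, fval_mkFn _ hx,
      fval_mkFn _ hx]
  map_zero' := smoothFn_ext fun x hx => by
    rw [fval_mkFn _ hx, fval_eq_evalHom _ (h hx), fval_eq_evalHom _ hx, map_zero, map_zero]
  map_add' f g := smoothFn_ext fun x hx => by
    rw [fval_mkFn _ hx, fval_eq_evalHom _ (h hx), fval_eq_evalHom _ hx, map_add, map_add,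
      ← fval_eq_evalHom, ← fval_eq_evalHom, ← fval_eq_evalHom, ← fval_eq_evalHom, fval_mkFn _ hx,
      fval_mkFn _ hx]

theorem fval_restrictHom {J I : TopologicalSpace.Opens ℝ} (h : J ≤ I) (f : SmoothFn I) {x : ℝ}
    (hx : x ∈ J) : fval (restrictHom h f) x = fval f x :=
  fval_mkFn ((fval_contDiffOn f).mono h) hx

theorem restrictHom_deriv {J I : TopologicalSpace.Opens ℝ} (h : J ≤ I) (f : SmoothFn I) :
    restrictHom h (Differential.deriv f) = Differential.deriv (restrictHom h f) :=
  smoothFn_ext fun x hx => by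
    rw [fval_restrictHom h _ hx, fval_deriv _ (h hx), fval_deriv _ hx]
    exact (fval_eventuallyEq (fun y => fval_restrictHom h f y.2) ⟨x, hx⟩).deriv_eq.symm

theorem smoothFn_isUnit {N : ℕ} (hN : 2 ≤ N) : IsUnit (N : SmoothFn I) := by
  have h : (N : SmoothFn I) = algebraMap ℂ (SmoothFn I) (N : ℂ) := by simp
  rw [h]
  exact (IsUnit.mk0 _ (Nat.cast_ne_zero.mpr (by omega))).map (algebraMap ℂ (SmoothFn I))

theorem fval_algebraMap (c : ℂ) {x : ℝ} (hx : x ∈ I) :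
    fval (algebraMap ℂ (SmoothFn I) c) x = c := fval_of_mem _ hx

theorem deriv_algebraMap_smoothFn (c : ℂ) :
    Differential.deriv (algebraMap ℂ (SmoothFn I) c) = 0 :=
  smoothFn_ext fun x hx => by
    rw [fval_deriv _ hx, (fval_eventuallyEq (g := fun _ => c)
      (fun y => fval_algebraMap c y.2) ⟨x, hx⟩).deriv_eq, deriv_const, fval_eq_evalHom _ hx,
      map_zero]

/-- The function `x ↦ c (x - y)`. -/
def affineFn (I : TopologicalSpace.Opens ℝ) (c : ℂ) (y : ℝ) : SmoothFn I :=
  mkFn (fun x => c * ((x - y : ℝ) : ℂ))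
    (contDiff_const.mul (Complex.ofRealCLM.contDiff.comp (contDiff_id.sub contDiff_const))).contDiffOn

theorem fval_affineFn (c : ℂ) (y : ℝ) {x : ℝ} (hx : x ∈ I) :
    fval (affineFn I c y) x = c * ((x - y : ℝ) : ℂ) := fval_mkFn _ hx

theorem deriv_affineFn (c : ℂ) (y : ℝ) :
    Differential.deriv (affineFn I c y) = algebraMap ℂ (SmoothFn I) c :=
  smoothFn_ext fun x hx => by
    rw [fval_deriv _ hx, (fval_eventuallyEq (g := fun x : ℝ => c * ((x - y : ℝ) : ℂ))
      (fun z => fval_affineFn c y z.2) ⟨x, hx⟩).deriv_eq,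
      fval_algebraMap c hx]
    have h : HasDerivAt (fun x : ℝ => c * ((x - y : ℝ) : ℂ)) (c * ((1 : ℝ) : ℂ)) x :=
      (((hasDerivAt_id x).sub_const y).ofReal_comp).const_mul c
    rw [h.deriv]
    simp

/-- Continuity at `y`. It extends the transport equations to the diagonal and makes `x - y` a
regular element. -/
theorem eq_zero_of_fval_eq_zero_of_ne {f : SmoothFn I} (y : ℝ)
    (h : ∀ x ∈ I, x ≠ y → fval f x = 0) : f = 0 := by
  refine smoothFn_ext fun x hx => ?_
  rw [fval_eq_evalHom 0 hx, map_zero]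
  rcases eq_or_ne x y with rfl | hne
  · have hc : ContinuousAt (fval f) x := (fval_contDiffAt f hx).continuousAt
    have h1 : Filter.Tendsto (fval f) (nhdsWithin x {x}ᶜ) (nhds (fval f x)) :=
      hc.tendsto.mono_left nhdsWithin_le_nhds
    have h2 : Filter.Tendsto (fval f) (nhdsWithin x {x}ᶜ) (nhds 0) := by
      refine tendsto_const_nhds.congr' ?_
      filter_upwards [self_mem_nhdsWithin, nhdsWithin_le_nhds (I.isOpen.mem_nhds hx)] with z hz hzI
      exact (h z hzI hz).symm
    exact tendsto_nhds_unique h1 h2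
  · exact h x hx hne

theorem affineFn_regular {c : ℂ} (hc : c ≠ 0) (y : ℝ) (f : SmoothFn I)
    (h : f * affineFn I c y = 0) : f = 0 := by
  refine eq_zero_of_fval_eq_zero_of_ne y fun x hx hne => ?_
  have h1 := congrArg (evalHom ⟨x, hx⟩) h
  rw [map_mul, map_zero, ← fval_eq_evalHom, ← fval_eq_evalHom, fval_affineFn c y hx] at h1
  exact (mul_eq_zero.mp h1).resolve_right
    (mul_ne_zero hc (Complex.ofReal_ne_zero.mpr (sub_ne_zero.mpr hne)))

end smooth

end

noncomputable section

open PsDO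

/-! ### The Hadamard coefficients on the diagonal -/

section applyL

variable {I : TopologicalSpace.Opens ℝ} {N : ℕ}

theorem applyL_eq_sum (hN : 2 ≤ N) (u : Fin (N - 1) → SmoothFn I) (v : ℝ → ℂ) {x : ℝ}
    (hx : x ∈ I) : applyL N u v x = ∑ i ∈ Finset.range (N + 1),
      fval ((lop N u).coeff i) x * iteratedDeriv i v x := by
  obtain ⟨M, rfl⟩ : ∃ M, N = M + 1 := ⟨N - 1, by omega⟩
  rw [applyL, Finset.sum_range_succ, lop_coeff_top, fval_eq_evalHom 1 hx, map_one, one_mul,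
    add_comm, Finset.sum_range_succ, lop_coeff_of_ne (M + 1) u M (by omega)
      (fun j => by have := j.2; omega), fval_eq_evalHom 0 hx, map_zero, zero_mul, add_zero]
  congr 1
  rw [← Fin.sum_univ_eq_sum_range (fun i : ℕ =>
    fval ((lop (M + 1) u).coeff i) x * iteratedDeriv i v x) M]
  exact Finset.sum_congr rfl fun i _ => by rw [← lop_coeff_fin (M + 1) u i]

/-- The link between analysis and algebra: by the Leibniz rule, applying `L` to a product with `f`
has the coefficients of the composition `L ∘ f`. -/
theorem applyL_mul (hN : 2 ≤ N) (u : Fin (N - 1) → SmoothFn I) {f : SmoothFn I} {g : ℝ → ℂ}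
    (hfg : ∀ x ∈ I, fval f x = g x) {φ : ℝ → ℂ} (hφ : ContDiff ℝ ∞ φ) {x : ℝ} (hx : x ∈ I) :
    applyL N u (fun ξ => g ξ * φ ξ) x =
      ∑ l : Fin N, fval ((lop N u * mono f 0).coeff (l : ℕ)) x * iteratedDeriv l φ x +
        g x * iteratedDeriv N φ x := by
  have hg : ContDiffAt ℝ ∞ g x := (fval_contDiffAt f hx).congr_of_eventuallyEq
    (fval_eventuallyEq (fun y => hfg y y.2) ⟨x, hx⟩).symm
  have h1 : ∀ i ∈ Finset.range (N + 1), iteratedDeriv i (fun ξ => g ξ * φ ξ) x =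
      ∑ l ∈ Finset.range (N + 1), (i.choose l : ℂ) * iteratedDeriv l φ x *
        iteratedDeriv (i - l) g x := by
    intro i hi
    have hc : (fun ξ => g ξ * φ ξ) = fun ξ => φ ξ * g ξ := funext fun ξ => mul_comm _ _
    rw [hc, iteratedDeriv_fun_mul (hφ.contDiffAt.of_le (by exact_mod_cast le_top))
      (hg.of_le (by exact_mod_cast le_top))]
    refine Finset.sum_subset (Finset.range_mono (Finset.mem_range.mp hi)) fun l _ hl => ?_
    rw [Nat.choose_eq_zero_of_lt (by simpa using hl)]
    simp
  have h2 : ∀ l : ℕ, fval ((lop N u * mono f 0).coeff (l : ℕ)) x =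
      ∑ i ∈ Finset.range (N + 1), (i.choose l : ℂ) *
        (fval ((lop N u).coeff i) x * iteratedDeriv (i - l) g x) := by
    intro l
    rw [lop_mul_mono_coeff, fval_eq_evalHom _ hx, map_sum]
    refine Finset.sum_congr rfl fun i _ => ?_
    rw [map_mul, map_mul, map_natCast, ← fval_eq_evalHom, ← fval_eq_evalHom,
      fval_eqOn_dIter hfg (i - l) x hx]
  have h3 : fval ((lop N u * mono f 0).coeff (N : ℕ)) x = g x := by
    have h := (lop_ordLE N u).mul_coeff_top (ordLE_mono f 0)
    rw [add_zero, lop_coeff_top, mono_coeff, if_pos rfl, one_mul] at h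
    rw [h, hfg x hx]
  rw [← h3, Fin.sum_univ_eq_sum_range (fun l : ℕ =>
    fval ((lop N u * mono f 0).coeff (l : ℕ)) x * iteratedDeriv l φ x) N,
    ← Finset.sum_range_succ (fun l : ℕ =>
      fval ((lop N u * mono f 0).coeff (l : ℕ)) x * iteratedDeriv l φ x),
    applyL_eq_sum hN u _ hx]
  simp_rw [h2, Finset.sum_mul]
  rw [Finset.sum_comm]
  refine Finset.sum_congr rfl fun i hi => ?_
  rw [h1 i hi, Finset.mul_sum]
  refine Finset.sum_congr rfl fun l _ => ?_
  ring

theorem applyL_sum (u : Fin (N - 1) → SmoothFn I) {ι : Type*} (s : Finset ι) (v : ι → ℝ → ℂ)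
    {x : ℝ} (hv : ∀ a ∈ s, ContDiffAt ℝ ∞ (v a) x) :
    applyL N u (fun ξ => ∑ a ∈ s, v a ξ) x = ∑ a ∈ s, applyL N u (v a) x := by
  have h : ∀ i : ℕ, iteratedDeriv i (fun ξ => ∑ a ∈ s, v a ξ) x =
      ∑ a ∈ s, iteratedDeriv i (v a) x := fun i =>
    iteratedDeriv_fun_sum fun a ha => (hv a ha).of_le (by exact_mod_cast le_top)
  simp only [applyL, h, Finset.mul_sum]
  rw [Finset.sum_comm, Finset.sum_add_distrib]

end applyL

/-- The Hadamard coefficients with the convention `H_0^j = δ_{j0}`. -/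
def normHadamard {N : ℕ} (H : ℕ → Fin (N - 1) → ℝ → ℝ → ℂ) (k : ℕ) (j : Fin (N - 1)) (x y : ℝ) :
    ℂ := if k = 0 then (if (j : ℕ) = 0 then 1 else 0) else H k j x y

theorem heatPartial_eq_sum {N : ℕ} (hN : 2 ≤ N) (κ : ℤ) (H : ℕ → Fin (N - 1) → ℝ → ℝ → ℂ) (n : ℕ)
    (x y t : ℝ) : heatPartial N κ H n x y t =
      ∑ q ∈ Finset.range (n + 1) ×ˢ (Finset.univ : Finset (Fin (N - 1))),
        normHadamard H q.1 q.2 x y * heatTerm N κ q.1 q.2 x y t := by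
  have hr : Finset.range (n + 1) = insert 0 (Finset.Icc 1 n) := by
    ext k
    simp only [Finset.mem_range, Finset.mem_insert, Finset.mem_Icc]
    omega
  rw [Finset.sum_product, hr, Finset.sum_insert (by simp), heatPartial, Finset.sum_comm]
  congr 1
  · rw [Finset.sum_eq_single (⟨0, by omega⟩ : Fin (N - 1))]
    · simp [normHadamard]
    · intro j _ hj
      have : ¬ (j : ℕ) = 0 := fun h => hj (Fin.ext h)
      simp [normHadamard, this]
    · simp
  · refine Finset.sum_congr rfl fun k hk => Finset.sum_congr rfl fun j _ => ?_
    have : k ≠ 0 := by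
      have := (Finset.mem_Icc.mp hk).1
      omega
    simp only [normHadamard, if_neg this]

section transport

variable {N : ℕ} (hN : 2 ≤ N) {κ : ℤ} (hκ : IsHeatSign N κ)

include hN hκ

theorem deriv_heatPartial (H : ℕ → Fin (N - 1) → ℝ → ℝ → ℂ) (n : ℕ) (x y : ℝ) {t : ℝ}
    (ht : 0 < t) : deriv (fun τ => heatPartial N κ H n x y τ) t =
      ∑ q ∈ Finset.range (n + 1) ×ˢ (Finset.univ : Finset (Fin (N - 1))),
        normHadamard H q.1 q.2 x y * (q.1 * heatTerm N κ (q.1 - 1) q.2 x y t +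
          κ * heatTerm N κ q.1 (q.2 + N) x y t) := by
  simp_rw [heatPartial_eq_sum hN]
  refine HasDerivAt.deriv (HasDerivAt.fun_sum fun q _ => ?_)
  exact (hasDerivAt_heatTerm_time hN hκ q.1 q.2 x y ht).const_mul _

/-- The heat equation implies the transport equations off the diagonal. -/
theorem transportCoeff_eval_eq_zero {J : TopologicalSpace.Opens ℝ} (u : Fin (N - 1) → SmoothFn J)
    (H : ℕ → Fin (N - 1) → ℝ → ℝ → ℂ) (y : ℝ) (n : ℕ) (h : ℕ → Fin (N - 1) → SmoothFn J)
    (hh : ∀ k ≤ n, ∀ j, ∀ x ∈ J, fval (h k j) x = normHadamard H k j x y) {x : ℝ} (hx : x ∈ J)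
    (hxy : x ≠ y) (G : Fin (N - 1) → ℂ)
    (hG : ∀ t : ℝ, 0 < t → deriv (fun τ => heatPartial N κ H n x y τ) t
      - (κ : ℂ) * applyL N u (fun ξ => heatPartial N κ H n ξ y t) x
        = ∑ j : Fin (N - 1), G j * heatTerm N κ n j x y t) (k : ℕ) (hk : k ≤ n)
    (j : Fin (N - 1)) :
    evalHom ⟨x, hx⟩ (transportCoeff (affineFn J (-((κ : ℂ) / N)) y)
      (algebraMap ℂ (SmoothFn J) (-((κ : ℂ) / N))) (κ : SmoothFn J) h (conjCoeff N u h) k j) = 0 := by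
  set E := evalHom (⟨x, hx⟩ : J) with hE
  rw [map_transportCoeff, map_intCast]
  set η : ℂ := E (affineFn J (-((κ : ℂ) / N)) y) with hηdef
  set γ : ℂ := E (algebraMap ℂ (SmoothFn J) (-((κ : ℂ) / N))) with hγdef
  set a : ℕ → Fin (N - 1) → ℂ := fun k j => E (h k j) with ha
  set e : ℕ → Fin (N - 1) → Fin N → ℂ := fun k j l => E (conjCoeff N u h k j l) with he
  have hη : η = -((κ : ℂ) / N) * ((x - y : ℝ) : ℂ) := by
    rw [hηdef, hE, ← fval_eq_evalHom, fval_affineFn _ _ hx]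
  have hγ : γ = -((κ : ℂ) / N) := by
    rw [hγdef, hE, ← fval_eq_evalHom, fval_algebraMap _ hx]
  -- The heat equation is multiplied by `t`, which makes the powers nonnegative and moves the
  -- remainder to level `n + 1`. The terms `κ ∂^{j+N}` of the two sides cancel.
  have hsum : ∀ t : ℝ, 0 < t → ∑ k ∈ Finset.range (n + 1), ∑ j : Fin (N - 1),
      (((k : ℂ) * a k j) • heatTerm N κ k j x y t - (κ : ℂ) • ∑ l : Fin N,
        e k j l • heatTerm N κ (k + 1) (j + l) x y t) =
      ∑ j : Fin (N - 1), G j * heatTerm N κ (n + 1) j x y t := by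
    intro t ht
    have h1 := hG t ht
    have hL : applyL N u (fun ξ => heatPartial N κ H n ξ y t) x =
        ∑ q ∈ Finset.range (n + 1) ×ˢ (Finset.univ : Finset (Fin (N - 1))),
          (∑ l : Fin N, e q.1 q.2 l * heatTerm N κ q.1 (q.2 + l) x y t +
            normHadamard H q.1 q.2 x y * heatTerm N κ q.1 (q.2 + N) x y t) := by
      simp_rw [heatPartial_eq_sum hN]
      have hle : ∀ q ∈ Finset.range (n + 1) ×ˢ (Finset.univ : Finset (Fin (N - 1))), q.1 ≤ n :=
        fun q hq => Nat.lt_succ_iff.mp (Finset.mem_range.mp (Finset.mem_product.mp hq).1)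
      rw [applyL_sum]
      · refine Finset.sum_congr rfl fun q hq => ?_
        rw [applyL_mul hN u (hh q.1 (hle q hq) q.2) (contDiff_heatTerm hN hκ q.1 q.2 y ht) hx]
        simp only [iteratedDeriv_heatTerm hN hκ _ _ _ y ht]
        congr 1
        refine Finset.sum_congr rfl fun l _ => ?_
        rw [fval_eq_evalHom _ hx]
        rfl
      · intro q hq
        refine ContDiffAt.mul ?_ (contDiff_heatTerm hN hκ q.1 q.2 y ht).contDiffAt
        exact (fval_contDiffAt (h q.1 q.2) hx).congr_of_eventuallyEq
          (fval_eventuallyEq (fun z => hh q.1 (hle q hq) q.2 z z.2) ⟨x, hx⟩).symm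
    rw [deriv_heatPartial hN hκ H n x y ht, hL, Finset.mul_sum, ← Finset.sum_sub_distrib] at h1
    have h2 := congrArg (fun z => (t : ℂ) * z) h1
    simp only [Finset.mul_sum] at h2
    rw [← Finset.sum_product']
    have h3 : ∑ j : Fin (N - 1), (t : ℂ) * (G j * heatTerm N κ n j x y t) =
        ∑ j : Fin (N - 1), G j * heatTerm N κ (n + 1) j x y t :=
      Finset.sum_congr rfl fun j _ => by rw [mul_left_comm, mul_heatTerm n j x y ht]
    rw [← h3, ← h2]
    refine Finset.sum_congr rfl fun q hq => ?_
    have hq1 : q.1 ≤ n := Nat.lt_succ_iff.mp (Finset.mem_range.mp (Finset.mem_product.mp hq).1)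
    have haq : a q.1 q.2 = normHadamard H q.1 q.2 x y := by
      rw [ha, ← hh q.1 hq1 q.2 x hx, fval_eq_evalHom _ hx]
    have hk1 : (q.1 : ℂ) * heatTerm N κ q.1 q.2 x y t =
        t * (q.1 * heatTerm N κ (q.1 - 1) q.2 x y t) := by
      rcases Nat.eq_zero_or_pos q.1 with h0 | hpos
      · rw [h0]; simp
      · rw [mul_left_comm, mul_heatTerm _ _ _ _ ht, Nat.sub_add_cancel hpos]
    have hl : ∑ l : Fin N, e q.1 q.2 l • heatTerm N κ (q.1 + 1) (q.2 + l) x y t =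
        t * ∑ l : Fin N, e q.1 q.2 l * heatTerm N κ q.1 (q.2 + l) x y t := by
      rw [Finset.mul_sum]
      refine Finset.sum_congr rfl fun l _ => ?_
      rw [smul_eq_mul, ← mul_heatTerm _ _ _ _ ht]
      ring
    rw [hl, haq, smul_eq_mul, smul_eq_mul]
    linear_combination normHadamard H q.1 q.2 x y * hk1
  have hred : ∀ t : ℝ, 0 < t → _ := fun t ht => sum_reduce (M := ℂ) hN (κ : ℂ)
    (φ := fun k q => heatTerm N κ k q x y t) (η := η) (γ := γ) (fun k l => by
      rw [heatTerm_reduce hN hκ k l x y ht, hη, hγ, smul_eq_mul, smul_eq_mul]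
      ring) a e n
  -- Level `n + 1` collects the boundary term of `sum_reduce` and the unknown remainder `G`; its
  -- vanishing is not used.
  set c : ℕ → Fin (N - 1) → ℂ := fun k j => if k ≤ n then transportCoeff η γ (κ : ℂ) a e k j else
    -(κ * upperCoeff (e n) j + G j) with hc
  have hfin := heatTerm_linearIndependent hN hκ hxy (n + 1) c (fun t ht => by
    have h1 := (hred t ht).symm.trans (hsum t ht)
    have h2 : ∀ k ∈ Finset.range (n + 1), ∑ j : Fin (N - 1), c k j * heatTerm N κ k j x y t =
        ∑ j : Fin (N - 1), transportCoeff η γ (κ : ℂ) a e k j • heatTerm N κ k j x y t := by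
      intro k hk
      refine Finset.sum_congr rfl fun j _ => ?_
      rw [hc, smul_eq_mul]
      simp only [if_pos (Nat.lt_succ_iff.mp (Finset.mem_range.mp hk))]
    rw [Finset.sum_range_succ, Finset.sum_congr rfl h2, sub_eq_iff_eq_add.mp h1]
    have h3 : ∀ j, c (n + 1) j = -(κ * upperCoeff (e n) j + G j) := fun j =>
      if_neg (by omega)
    simp only [h3, smul_eq_mul, Finset.mul_sum]
    rw [← Finset.sum_add_distrib, ← Finset.sum_add_distrib]
    exact Finset.sum_eq_zero fun j _ => by ring) k (by omega) j
  rw [hc] at hfin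
  simpa only [if_pos hk] using hfin

-- Each factor is `κ (s + 1 - (j+1)/N)`.
omit hN hκ in
theorem prod_eq_pochhammer (hN : 2 ≤ N) (k j : ℕ) :
    ∏ s ∈ Finset.range k, ((((j : ℤ) + 1 - (s + 1) * N : ℤ) : ℂ) * -((κ : ℂ) / N)) =
      (κ : ℂ) ^ k * (ascPochhammer ℂ k).eval (1 - ((j : ℂ) + 1) / N) := by
  have hN0 : (N : ℂ) ≠ 0 := Nat.cast_ne_zero.mpr (by omega)
  induction k with
  | zero => simp
  | succ k ih =>
    rw [Finset.prod_range_succ, ih, ascPochhammer_succ_eval]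
    push_cast
    field_simp
    ring

omit hN hκ in
theorem pochhammer_ne_zero (hN : 2 ≤ N) (k : ℕ) (j : Fin (N - 1)) :
    (ascPochhammer ℂ k).eval (1 - (((j : ℕ) : ℂ) + 1) / N) ≠ 0 := by
  have hpos : 0 < (1 - (((j : ℕ) : ℝ) + 1) / N) := by
    have hj := j.2
    have h1 : (((j : ℕ) : ℝ) + 1) < N := by
      have : (j : ℕ) + 1 < N := by omega
      exact_mod_cast this
    rw [sub_pos, div_lt_one (by linarith [show (0 : ℝ) ≤ (j : ℕ) by positivity])]
    exact h1
  have h := (ascPochhammer_pos k _ hpos).ne'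
  have e : (ascPochhammer ℂ k).eval (1 - (((j : ℕ) : ℂ) + 1) / N) =
      (((ascPochhammer ℝ k).eval (1 - (((j : ℕ) : ℝ) + 1) / N) : ℝ) : ℂ) := by
    clear h hpos
    induction k with
    | zero => simp
    | succ k ih => rw [ascPochhammer_succ_eval, ascPochhammer_succ_eval, ih]; push_cast; rfl
  rw [e]
  exact Complex.ofReal_ne_zero.mpr h

/-- The diagonal values of the Hadamard coefficients are residues of fractional powers. -/
theorem hadamard_diag {I : TopologicalSpace.Opens ℝ} (u : Fin (N - 1) → SmoothFn I)
    (H : ℕ → Fin (N - 1) → ℝ → ℝ → ℂ) (hH : IsHadamard N κ u H) (k : ℕ) (hk : 1 ≤ k)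
    (j : Fin (N - 1)) (y : ℝ) (hy : y ∈ I) :
    H k j y y = diagConst N κ k j * fval ((lop N u).fracPow N (k * N - ((j : ℕ) + 1))).res y := by
  -- Truncation at `k * N` is ample: it exceeds both `k` and the exponent `p = k * N - (j + 1)`.
  obtain ⟨W, hWo, hWI, hWd, hWs, G, hG⟩ := hH (k * N)
  have hkn : k ≤ k * N := Nat.le_mul_of_pos_right k (by omega)
  set n := k * N with hn
  -- With `y` fixed, the slice of `W` is an open neighbourhood of `y` on which the `H_i^l(·, y)` are
  -- elements of the differential ring.
  let J : TopologicalSpace.Opens ℝ := ⟨{ξ | (ξ, y) ∈ W}, hWo.preimage (by fun_prop)⟩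
  have hJI : J ≤ I := fun ξ hξ => (hWI hξ).1
  have hyJ : y ∈ J := hWd y hy
  have hsm : ∀ i ∈ Finset.Icc 1 n, ∀ l, ContDiffOn ℝ ∞ (fun ξ => H i l ξ y) J := fun i hi l =>
    (hWs i hi l).comp (contDiff_id.prodMk contDiff_const).contDiffOn fun ξ hξ => hξ
  have hex : ∀ (i : ℕ) (l : Fin (N - 1)), ∃ f : SmoothFn J,
      i ≤ n → ∀ x ∈ J, fval f x = normHadamard H i l x y := by
    intro i l
    by_cases hi : i ∈ Finset.Icc 1 n
    · refine ⟨mkFn _ (hsm i hi l), fun _ x hx => ?_⟩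
      rw [fval_mkFn _ hx, normHadamard, if_neg]
      have := (Finset.mem_Icc.mp hi).1
      omega
    · refine ⟨if (l : ℕ) = 0 then 1 else 0, fun hin x hx => ?_⟩
      rw [Finset.mem_Icc] at hi
      rw [normHadamard, if_pos (show i = 0 by omega), fval_eq_evalHom _ hx,
        apply_ite (evalHom _), map_one, map_zero]
  choose h hh using hex
  set c : ℂ := -((κ : ℂ) / N) with hc
  have hN0 : (N : ℂ) ≠ 0 := Nat.cast_ne_zero.mpr (by omega)
  have hκ2 : (κ : ℂ) * κ = 1 := by exact_mod_cast hκ.sq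
  have hc0 : c ≠ 0 := neg_ne_zero.mpr (div_ne_zero (left_ne_zero_of_mul_eq_one hκ2) hN0)
  have h0 : ∀ l, h 0 l = if (l : ℕ) = 0 then 1 else 0 := fun l => smoothFn_ext fun x hx => by
    rw [hh 0 l (Nat.zero_le n) x hx, normHadamard, if_pos rfl, fval_eq_evalHom _ hx,
      apply_ite (evalHom _), map_one, map_zero]
  let u' : Fin (N - 1) → SmoothFn J := fun l => restrictHom hJI (u l)
  -- The transport equations come from the heat equation at `x ≠ y` and from continuity at `x = y`.
  have htr : ∀ i ≤ n, ∀ l, transportCoeff (affineFn J c y) (algebraMap ℂ (SmoothFn J) c)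
      (κ : SmoothFn J) h (conjCoeff N u' h) i l = 0 := by
    intro i hi l
    refine eq_zero_of_fval_eq_zero_of_ne y fun x hx hxy => ?_
    rw [fval_eq_evalHom _ hx]
    refine transportCoeff_eval_eq_zero hN hκ u' H y n h (fun i hi l => hh i l hi) hx hxy
      (fun l => G l x y) (fun t ht => ?_) i hi l
    rw [← hG x y t hx ht]
    congr 2
    simp only [applyL]
    congr 1
    exact Finset.sum_congr rfl fun l _ => by rw [fval_restrictHom hJI _ hx]
  have hκγ : (N : SmoothFn J) * algebraMap ℂ (SmoothFn J) c = -(κ : SmoothFn J) := by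
    have e1 : (N : SmoothFn J) = algebraMap ℂ (SmoothFn J) (N : ℂ) := by simp
    have e2 : (κ : SmoothFn J) = algebraMap ℂ (SmoothFn J) (κ : ℂ) := by simp
    rw [e1, e2, ← map_mul, ← map_neg, hc]
    congr 1
    field_simp
  have hroot := isNthRoot_lop (smoothFn_isUnit (I := I) hN) u
  have hQ : IsNthRoot N (lop N u') ((nthRoot N (lop N u)).map (restrictHom hJI)) := by
    rw [← lop_map]
    exact hroot.map (restrictHom_deriv hJI)
  set p := k * N - ((j : ℕ) + 1) with hp
  have hres := res_pow_eq_sum hN (smoothFn_isUnit hN) hκ.sq (deriv_affineFn c y)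
    (deriv_algebraMap_smoothFn c) hκγ (affineFn_regular hc0 y) u' hQ h h0 n htr
    (evalHom ⟨y, hyJ⟩) (by
      rw [← fval_eq_evalHom, fval_affineFn c y hyJ, sub_self]
      simp) p (by omega)
  have hjN := j.2
  have hple : (j : ℕ) + 1 ≤ k * N := by
    have : N ≤ k * N := Nat.le_mul_of_pos_left N (by omega)
    omega
  have hpz : (-1 - (p : ℤ)) = (j : ℕ) - k * N := by
    rw [hp, Nat.cast_sub hple]
    push_cast
    ring
  have hγy : evalHom ⟨y, hyJ⟩ (algebraMap ℂ (SmoothFn J) c) = c := by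
    rw [← fval_eq_evalHom, fval_algebraMap c hyJ]
  -- Since `j` and `j'` differ by less than `N`, the number `j - kN` determines both indices, so the
  -- double sum has one nonzero term.
  have huniq : ∀ (k' : ℕ) (j' : Fin (N - 1)), (-1 - (p : ℤ)) = (j' : ℕ) - k' * N →
      k' = k ∧ j' = j := by
    intro k' j' he
    rw [hpz] at he
    have hj' := j'.2
    have h1 : (k : ℤ) * N - k' * N = (j : ℕ) - (j' : ℕ) := by linarith
    have hkk : k' = k := by
      rcases lt_trichotomy k' k with hlt | heq | hlt
      · have : (N : ℤ) * (k' + 1) ≤ N * k := by gcongr; exact_mod_cast hlt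
        have : (k : ℤ) * N - k' * N ≥ N := by linarith
        omega
      · exact heq
      · have : (N : ℤ) * (k + 1) ≤ N * k' := by gcongr; exact_mod_cast hlt
        have : (k' : ℤ) * N - k * N ≥ N := by linarith
        omega
    subst hkk
    exact ⟨rfl, Fin.ext (by omega)⟩
  rw [Finset.sum_eq_single_of_mem k (Finset.mem_range.mpr (by omega)),
    Finset.sum_eq_single_of_mem j (Finset.mem_univ j), if_pos hpz, hγy, ← fval_eq_evalHom,
    ← fval_eq_evalHom, hh k j hkn y hyJ, prod_eq_pochhammer hN,
    ← map_pow' (restrictHom_deriv hJI), map_coeff, fval_restrictHom hJI _ hyJ, normHadamard,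
    if_neg (by omega)] at hres
  -- `hres` now expresses the residue as `H_k^j(y,y)` times `κ^k (1-(j+1)/N)_k`; as `κ^k` is its own
  -- inverse, it reappears in the numerator.
  · have hP := pochhammer_ne_zero hN k j
    have hκk : (κ : ℂ) ^ k * κ ^ k = 1 := by rw [← mul_pow, hκ2, one_pow]
    change H k j y y = diagConst N κ k j * fval ((nthRoot N (lop N u) ^ p).coeff (-1)) y
    rw [hres, diagConst, div_mul_eq_mul_div, eq_div_iff hP]
    linear_combination
      (-(H k j y y) * (ascPochhammer ℂ k).eval (1 - (((j : ℕ) : ℂ) + 1) / N)) * hκk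
  · intro j' _ hj'
    rw [if_neg fun he => hj' (huniq k j' he).2, mul_zero]
  · intro k' _ hk'
    exact Finset.sum_eq_zero fun j' _ => by
      rw [if_neg fun he => hk' (huniq k' j' he).1, mul_zero]

end transport

end

noncomputable section

open PsDO

/-! ### Evaluation of differential polynomials -/

section evalDiff

variable {I : TopologicalSpace.Opens ℝ} {N : ℕ}

theorem evalDiff_X (u : Fin (N - 1) → SmoothFn I) (p : Fin (N - 1) × ℕ) :
    evalDiff N u (MvPolynomial.X p) = dIter p.2 (u p.1) :=
  MvPolynomial.aeval_X _ p

theorem evalDiff_C (u : Fin (N - 1) → SmoothFn I) (c : ℂ) :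
    evalDiff N u (MvPolynomial.C c) = algebraMap ℂ (SmoothFn I) c :=
  MvPolynomial.aeval_C _ c

/-- Evaluation of differential polynomials as a ring homomorphism. -/
def evalDiffHom (N : ℕ) (u : Fin (N - 1) → SmoothFn I) : DiffPoly N →+* SmoothFn I :=
  (MvPolynomial.aeval fun p : Fin (N - 1) × ℕ => dIter p.2 (u p.1)).toRingHom

theorem evalDiffHom_apply (u : Fin (N - 1) → SmoothFn I) (h : DiffPoly N) :
    evalDiffHom N u h = evalDiff N u h := rfl

theorem evalDiffHom_deriv (u : Fin (N - 1) → SmoothFn I) (h : DiffPoly N) :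
    evalDiffHom N u (Differential.deriv h) = Differential.deriv (evalDiffHom N u h) := by
  induction h using MvPolynomial.induction_on with
  | C c =>
    rw [diffPoly_deriv_C, map_zero, evalDiffHom_apply, evalDiff_C, deriv_algebraMap_smoothFn]
  | add f g hf hg => simp only [map_add, hf, hg]
  | mul_X f p hf =>
    simp only [Derivation.leibniz, map_add, map_mul, smul_eq_mul, diffPoly_deriv_X, hf,
      evalDiffHom_apply, evalDiff_X, dIter_succ]

theorem evalDiffHom_indet (u : Fin (N - 1) → SmoothFn I) (j : Fin (N - 1)) :
    evalDiffHom N u (indet N j) = u j := evalDiff_X u (j, 0)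

theorem evalDiff_diagDensity (hN : 2 ≤ N) (κ : ℤ) (u : Fin (N - 1) → SmoothFn I) (k j : ℕ) :
    evalDiff N u (diagDensity N κ k j) = algebraMap ℂ (SmoothFn I) (diagConst N κ k j) *
      ((lop N u).fracPow N (k * N - (j + 1))).res := by
  rw [diagDensity, ← evalDiffHom_apply, map_mul, evalDiffHom_apply, evalDiff_C]
  congr 1
  have h := fracPow_map (evalDiffHom_deriv u) (diffPoly_isUnit hN) (smoothFn_isUnit hN) (indet N)
    (k * N - (j + 1))
  simp only [evalDiffHom_indet] at h
  rw [← h]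
  rfl

theorem evalDiff_gdFlow_X (hN : 2 ≤ N) (u : Fin (N - 1) → SmoothFn I) (m : ℕ)
    (p : Fin (N - 1) × ℕ) : evalDiff N u (gdFlow N m (MvPolynomial.X p)) =
      dIter p.2 ((gdRHS N m u).coeff (p.1 : ℕ)) := by
  have h := gdRHS_map (evalDiffHom_deriv u) (diffPoly_isUnit hN) (smoothFn_isUnit hN) (indet N) m
    (p.1 : ℕ)
  simp only [evalDiffHom_indet] at h
  rw [gdFlow_X, ← evalDiffHom_apply, map_dIter (evalDiffHom_deriv u), h]

theorem fval_evalDiff (u : Fin (N - 1) → SmoothFn I) (h : DiffPoly N) {x : ℝ} (hx : x ∈ I) :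
    fval (evalDiff N u h) x =
      ((evalHom ⟨x, hx⟩).comp (evalDiffHom N u)) h := fval_eq_evalHom _ hx

theorem hasDerivAt_fval_evalDiff (u : Fin (N - 1) → SmoothFn I) (h : DiffPoly N) {x : ℝ}
    (hx : x ∈ I) : HasDerivAt (fval (evalDiff N u h))
      (fval (evalDiff N u (Differential.deriv h)) x) x := by
  rw [← evalDiffHom_apply u (Differential.deriv h), evalDiffHom_deriv, fval_deriv _ hx]
  exact (fval_differentiableAt _ ⟨x, hx⟩).hasDerivAt

end evalDiff

/-- A nonzero constant term is what would prevent integrability over the line. -/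
theorem constantCoeff_deriv {N : ℕ} (h : DiffPoly N) :
    MvPolynomial.constantCoeff (Differential.deriv h) = 0 := by
  induction h using MvPolynomial.induction_on with
  | C c => rw [diffPoly_deriv_C, map_zero]
  | add f g hf hg => rw [map_add, map_add, hf, hg, add_zero]
  | mul_X f p hf =>
    simp only [Derivation.leibniz, map_add, smul_eq_mul, map_mul, diffPoly_deriv_X, hf,
      MvPolynomial.constantCoeff_X, mul_zero, add_zero]

theorem evalDiff_zero {I : TopologicalSpace.Opens ℝ} {N : ℕ} (h : DiffPoly N) :
    evalDiff N (fun _ => (0 : SmoothFn I)) h =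
      algebraMap ℂ (SmoothFn I) (MvPolynomial.constantCoeff h) := by
  rw [← MvPolynomial.aeval_zero, evalDiff]
  congr 2
  exact funext fun p => dIter_zero p.2

/-! ### Solutions of the Gelfand–Dickey equations -/

section partialDeriv

variable {T : Set ℝ} {f : ℝ × ℝ → ℂ}

theorem hasDerivAt_fst (hT : IsOpen T) (hf : ContDiffOn ℝ ∞ f (Set.univ ×ˢ T)) (x : ℝ) {s : ℝ}
    (hs : s ∈ T) : HasDerivAt (fun ξ => f (ξ, s)) (fderiv ℝ f (x, s) (1, 0)) x := by
  have h1 : ContDiffAt ℝ ∞ f (x, s) := hf.contDiffAt ((isOpen_univ.prod hT).mem_nhds ⟨trivial, hs⟩)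
  have h2 := (h1.differentiableAt (by simp)).hasFDerivAt
  exact h2.comp_hasDerivAt x ((hasDerivAt_id x).prodMk (hasDerivAt_const x s))

theorem hasDerivAt_snd (hT : IsOpen T) (hf : ContDiffOn ℝ ∞ f (Set.univ ×ˢ T)) (x : ℝ) {s : ℝ}
    (hs : s ∈ T) : HasDerivAt (fun σ => f (x, σ)) (fderiv ℝ f (x, s) (0, 1)) s := by
  have h1 : ContDiffAt ℝ ∞ f (x, s) := hf.contDiffAt ((isOpen_univ.prod hT).mem_nhds ⟨trivial, hs⟩)
  have h2 := (h1.differentiableAt (by simp)).hasFDerivAt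
  exact h2.comp_hasDerivAt s ((hasDerivAt_const s x).prodMk (hasDerivAt_id s))

theorem contDiffOn_fderiv_apply (hT : IsOpen T) (hf : ContDiffOn ℝ ∞ f (Set.univ ×ˢ T))
    (v : ℝ × ℝ) : ContDiffOn ℝ ∞ (fun p => fderiv ℝ f p v) (Set.univ ×ˢ T) :=
  (hf.fderiv_of_isOpen (isOpen_univ.prod hT) (by simp)).clm_apply contDiffOn_const

theorem contDiffOn_deriv_fst (hT : IsOpen T) (hf : ContDiffOn ℝ ∞ f (Set.univ ×ˢ T)) :
    ContDiffOn ℝ ∞ (fun p : ℝ × ℝ => deriv (fun ξ => f (ξ, p.2)) p.1) (Set.univ ×ˢ T) :=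
  (contDiffOn_fderiv_apply hT hf (1, 0)).congr fun p hp => (hasDerivAt_fst hT hf p.1 hp.2).deriv

/-- Joint smoothness makes the second derivative symmetric, so `∂_s` and `∂_x` commute. -/
theorem hasDerivAt_deriv_fst (hT : IsOpen T) (hf : ContDiffOn ℝ ∞ f (Set.univ ×ˢ T)) {s : ℝ}
    (hs : s ∈ T) {g : ℝ → ℂ} (hg : ∀ x, HasDerivAt (fun σ => f (x, σ)) (g x) s) (x : ℝ) :
    HasDerivAt (fun σ => deriv (fun ξ => f (ξ, σ)) x) (deriv g x) s := by
  have h1 : ContDiffAt ℝ ∞ f (x, s) := hf.contDiffAt ((isOpen_univ.prod hT).mem_nhds ⟨trivial, hs⟩)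
  have hsymm := (h1.isSymmSndFDerivAt (by
    rw [minSmoothness_of_isRCLikeNormedField]; exact WithTop.coe_le_coe.mpr le_top)).eq (1, 0) (0, 1)
  have hd : DifferentiableAt ℝ (fderiv ℝ f) (x, s) :=
    (h1.fderiv_right (m := ∞) (by simp)).differentiableAt (by simp)
  have hap : ∀ v w : ℝ × ℝ, fderiv ℝ (fun p => fderiv ℝ f p v) (x, s) w =
      fderiv ℝ (fderiv ℝ f) (x, s) w v := by
    intro v w
    rw [fderiv_clm_apply hd (differentiableAt_const v)]
    simp
  have hg' : g = fun ξ => fderiv ℝ f (ξ, s) (0, 1) :=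
    funext fun ξ => (hg ξ).unique (hasDerivAt_snd hT hf ξ hs)
  have e1 : deriv g x = fderiv ℝ (fderiv ℝ f) (x, s) (1, 0) (0, 1) := by
    rw [hg', ← hap]
    exact (hasDerivAt_fst hT (contDiffOn_fderiv_apply hT hf (0, 1)) x hs).deriv
  rw [e1, hsymm, ← hap]
  refine (hasDerivAt_snd hT (contDiffOn_fderiv_apply hT hf (1, 0)) x hs).congr_of_eventuallyEq ?_
  filter_upwards [hT.mem_nhds hs] with σ hσ
  exact (hasDerivAt_fst hT hf x hσ).deriv

end partialDeriv

section solution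

variable {N m : ℕ} {T : Set ℝ} {u : ℝ → Fin (N - 1) → SmoothFn (⊤ : TopologicalSpace.Opens ℝ)}

theorem IsGDSolution.contDiffOn_dIter (hT : IsOpen T) (hu : IsGDSolution N m T u)
    (j : Fin (N - 1)) (i : ℕ) :
    ContDiffOn ℝ ∞ (fun p : ℝ × ℝ => fval (dIter i (u p.2 j)) p.1) (Set.univ ×ˢ T) := by
  induction i with
  | zero => exact hu.1 j
  | succ i ih =>
    refine (contDiffOn_deriv_fst hT ih).congr fun p _ => ?_
    rw [dIter_succ, fval_deriv _ (TopologicalSpace.Opens.mem_top p.1)]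

theorem IsGDSolution.hasDerivAt_dIter (hT : IsOpen T) (hu : IsGDSolution N m T u)
    (j : Fin (N - 1)) (i : ℕ) {s : ℝ} (hs : s ∈ T) (x : ℝ) :
    HasDerivAt (fun σ => fval (dIter i (u σ j)) x)
      (fval (dIter i ((gdRHS N m (u s)).coeff (j : ℕ))) x) s := by
  induction i generalizing x with
  | zero =>
    have h := hu.2 s hs x (j : ℕ)
    simp only [lop_coeff_fin] at h
    exact h
  | succ i ih =>
    have h := hasDerivAt_deriv_fst hT (hu.contDiffOn_dIter hT j i) hs ih x
    simp only [dIter_succ, fval_deriv _ (TopologicalSpace.Opens.mem_top x)]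
    exact h

/-- Both sides obey the product rule, and they agree on the generators `u_j^{(i)}`. This connects
the formal flow with an actual solution. -/
theorem IsGDSolution.hasDerivAt_evalDiff (hN : 2 ≤ N) (hT : IsOpen T) (hu : IsGDSolution N m T u)
    (h : DiffPoly N) {s : ℝ} (hs : s ∈ T) (x : ℝ) :
    HasDerivAt (fun σ => fval (evalDiff N (u σ) h) x)
      (fval (evalDiff N (u s) (gdFlow N m h)) x) s := by
  have hx : x ∈ (⊤ : TopologicalSpace.Opens ℝ) := trivial
  induction h using MvPolynomial.induction_on with
  | C c =>
    rw [MvPolynomial.derivation_C, fval_evalDiff _ _ hx, map_zero]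
    simp only [evalDiff_C, fval_algebraMap c hx]
    exact hasDerivAt_const s c
  | add f g hf hg =>
    simp only [fval_evalDiff _ _ hx, map_add] at hf hg ⊢
    exact hf.add hg
  | mul_X f p hf =>
    have hp := hu.hasDerivAt_dIter hT p.1 p.2 hs x
    simp only [← evalDiff_X, ← evalDiff_gdFlow_X hN] at hp
    simp only [fval_evalDiff _ _ hx, Derivation.leibniz, map_add, map_mul, smul_eq_mul] at hf hp ⊢
    refine (hf.mul hp).congr_deriv ?_
    ring

theorem IsGDSolution.contDiffOn_evalDiff (hT : IsOpen T) (hu : IsGDSolution N m T u)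
    (h : DiffPoly N) :
    ContDiffOn ℝ ∞ (fun p : ℝ × ℝ => fval (evalDiff N (u p.2) h) p.1) (Set.univ ×ˢ T) := by
  have hx : ∀ x, x ∈ (⊤ : TopologicalSpace.Opens ℝ) := fun _ => trivial
  induction h using MvPolynomial.induction_on with
  | C c =>
    simp only [evalDiff_C, fval_algebraMap c (hx _)]
    exact contDiffOn_const
  | add f g hf hg =>
    simp only [fval_evalDiff _ _ (hx _), map_add] at hf hg ⊢
    exact hf.add hg
  | mul_X f p hf =>
    have hp := hu.contDiffOn_dIter hT p.1 p.2
    simp only [← evalDiff_X] at hp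
    simp only [fval_evalDiff _ _ (hx _), map_mul] at hf hp ⊢
    exact hf.mul hp

theorem continuous_fval (f : SmoothFn (⊤ : TopologicalSpace.Opens ℝ)) : Continuous (fval f) :=
  continuousOn_univ.mp (fval_contDiffOn f).continuousOn

/-- In a product with a generator, one factor is bounded and the generator decays; the weights
`|x|^0` and `|x|^2` add up to `1 + x^2`. -/
theorem IsRapidlyDecaying.exists_bound (hd : IsRapidlyDecaying N T u) {K : Set ℝ} (hKT : K ⊆ T)
    (hK : IsCompact K) (h : DiffPoly N) : ∃ C : ℝ, ∀ s ∈ K, ∀ x : ℝ,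
      (1 + x ^ 2) * ‖fval (evalDiff N (u s) h) x - MvPolynomial.constantCoeff h‖ ≤ C := by
  have hx : ∀ x, x ∈ (⊤ : TopologicalSpace.Opens ℝ) := fun _ => trivial
  induction h using MvPolynomial.induction_on with
  | C c =>
    refine ⟨0, fun s _ x => ?_⟩
    rw [evalDiff_C, fval_algebraMap c (hx x), MvPolynomial.constantCoeff_C, sub_self, norm_zero,
      mul_zero]
  | add f g hf hg =>
    obtain ⟨A, hA⟩ := hf
    obtain ⟨B, hB⟩ := hg
    refine ⟨A + B, fun s hs x => le_trans ?_ (add_le_add (hA s hs x) (hB s hs x))⟩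
    rw [← mul_add]
    gcongr
    refine le_trans (le_of_eq ?_) (norm_add_le _ _)
    simp only [fval_evalDiff _ _ (hx _), map_add]
    congr 1
    ring
  | mul_X f p hf =>
    obtain ⟨A, hA⟩ := hf
    obtain ⟨B, hB⟩ := hd K hKT hK p.1 p.2 0
    obtain ⟨C, hC⟩ := hd K hKT hK p.1 p.2 2
    refine ⟨(A + ‖MvPolynomial.constantCoeff f‖) * (B + C), fun s hs x => ?_⟩
    have h1 := hA s hs x
    have h2 := hB s hs x
    have h3 := hC s hs x
    rw [← evalDiff_X] at h2 h3
    rw [pow_zero, one_mul] at h2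
    rw [sq_abs] at h3
    have h4 : ‖fval (evalDiff N (u s) f) x‖ ≤ A + ‖MvPolynomial.constantCoeff f‖ := by
      have h5 := norm_le_norm_sub_add (fval (evalDiff N (u s) f) x)
        (MvPolynomial.constantCoeff f)
      have h6 : ‖fval (evalDiff N (u s) f) x - MvPolynomial.constantCoeff f‖ ≤
          (1 + x ^ 2) * ‖fval (evalDiff N (u s) f) x - MvPolynomial.constantCoeff f‖ :=
        le_mul_of_one_le_left (norm_nonneg _) (by nlinarith [sq_nonneg x])
      linarith
    have e : fval (evalDiff N (u s) (f * MvPolynomial.X p)) x =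
        fval (evalDiff N (u s) f) x * fval (evalDiff N (u s) (MvPolynomial.X p)) x := by
      simp only [fval_evalDiff _ _ (hx _), map_mul]
    rw [e, map_mul, MvPolynomial.constantCoeff_X, mul_zero, sub_zero, norm_mul, mul_left_comm]
    refine mul_le_mul h4 (by linarith) (by positivity) ((norm_nonneg _).trans h4)

theorem IsRapidlyDecaying.exists_norm_le (hd : IsRapidlyDecaying N T u) {K : Set ℝ} (hKT : K ⊆ T)
    (hK : IsCompact K) {h : DiffPoly N} (h0 : MvPolynomial.constantCoeff h = 0) : ∃ C : ℝ,
      ∀ s ∈ K, ∀ x : ℝ, ‖fval (evalDiff N (u s) h) x‖ ≤ C * (1 + x ^ 2)⁻¹ := by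
  obtain ⟨C, hC⟩ := hd.exists_bound hKT hK h
  refine ⟨C, fun s hs x => ?_⟩
  have h1 := hC s hs x
  rw [h0, sub_zero] at h1
  rw [← div_eq_mul_inv, le_div_iff₀ (by positivity), mul_comm]
  exact h1

theorem IsRapidlyDecaying.integrable (hd : IsRapidlyDecaying N T u) {h : DiffPoly N}
    (h0 : MvPolynomial.constantCoeff h = 0) {s : ℝ} (hs : s ∈ T) :
    MeasureTheory.Integrable (fval (evalDiff N (u s) h)) := by
  obtain ⟨C, hC⟩ := hd.exists_norm_le (Set.singleton_subset_iff.mpr hs) isCompact_singleton h0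
  exact (integrable_inv_one_add_sq.const_mul C).mono' (continuous_fval _).aestronglyMeasurable
    (Filter.Eventually.of_forall fun x => hC s rfl x)

theorem IsRapidlyDecaying.integral_deriv (hd : IsRapidlyDecaying N T u) (F : DiffPoly N) {s : ℝ}
    (hs : s ∈ T) : ∫ x, fval (evalDiff N (u s) (Differential.deriv F)) x = 0 := by
  -- Subtracting the constant term makes the primitive itself integrable without changing its
  -- derivative.
  set F₀ : DiffPoly N := F - MvPolynomial.C (MvPolynomial.constantCoeff F) with hF
  have h0 : MvPolynomial.constantCoeff F₀ = 0 := by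
    rw [hF, map_sub, MvPolynomial.constantCoeff_C, sub_self]
  have hD : Differential.deriv F = Differential.deriv F₀ := by
    rw [hF, map_sub, diffPoly_deriv_C, sub_zero]
  rw [hD]
  exact MeasureTheory.integral_eq_zero_of_hasDerivAt_of_integrable
    (fun x => hasDerivAt_fval_evalDiff (u s) F₀ trivial)
    (hd.integrable (constantCoeff_deriv F₀) hs) (hd.integrable h0 hs)

theorem eq_of_hasDerivAt_zero {g : ℝ → ℂ} (hT : IsOpen T) (hTc : T.OrdConnected)
    (hg : ∀ s ∈ T, HasDerivAt g 0 s) {s₁ s₂ : ℝ} (h₁ : s₁ ∈ T) (h₂ : s₂ ∈ T) : g s₁ = g s₂ :=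
  hT.is_const_of_deriv_eq_zero hTc.isPreconnected
    (fun s hs => (hg s hs).differentiableAt.differentiableWithinAt) (fun s hs => (hg s hs).deriv)
    h₁ h₂

theorem IsGDSolution.integral_eq (hN : 2 ≤ N) (hT : IsOpen T) (hTc : T.OrdConnected)
    (hu : IsGDSolution N m T u) (hd : IsRapidlyDecaying N T u) {h F : DiffPoly N}
    (h0 : MvPolynomial.constantCoeff h = 0) (hF : gdFlow N m h = Differential.deriv F) {s₁ s₂ : ℝ}
    (h₁ : s₁ ∈ T) (h₂ : s₂ ∈ T) :
    ∫ x, fval (evalDiff N (u s₁) h) x = ∫ x, fval (evalDiff N (u s₂) h) x := by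
  refine eq_of_hasDerivAt_zero (g := fun s => ∫ x, fval (evalDiff N (u s) h) x) hT hTc
    (fun s hs => ?_) h₁ h₂
  obtain ⟨ε, hε, hball⟩ := Metric.nhds_basis_closedBall.mem_iff.mp (hT.mem_nhds hs)
  -- Being a total derivative, the flow of the density has no constant term, so one integrable bound
  -- serves a whole neighbourhood of `s`.
  obtain ⟨C, hC⟩ := hd.exists_norm_le hball (isCompact_closedBall s ε)
    (h := gdFlow N m h) (by rw [hF, constantCoeff_deriv])
  have key := (hasDerivAt_integral_of_dominated_loc_of_deriv_le (μ := MeasureTheory.volume)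
    (F := fun σ x => fval (evalDiff N (u σ) h) x)
    (F' := fun σ x => fval (evalDiff N (u σ) (gdFlow N m h)) x)
    (bound := fun x => C * (1 + x ^ 2)⁻¹)
    (Metric.closedBall_mem_nhds s hε)
    (Filter.Eventually.of_forall fun σ => (continuous_fval _).aestronglyMeasurable)
    (hd.integrable h0 hs) (continuous_fval _).aestronglyMeasurable
    (Filter.Eventually.of_forall fun x σ hσ => hC σ hσ x)
    (integrable_inv_one_add_sq.const_mul C)
    (Filter.Eventually.of_forall fun x σ hσ =>
      hu.hasDerivAt_evalDiff hN hT h (hball hσ) x)).2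
  rwa [hF, hd.integral_deriv F hs] at key

theorem IsSpacePeriodic.evalDiff_add {p : ℝ} (hp : IsSpacePeriodic N T p u) {s : ℝ} (hs : s ∈ T)
    (h : DiffPoly N) (x : ℝ) :
    fval (evalDiff N (u s) h) (x + p) = fval (evalDiff N (u s) h) x := by
  have hx : ∀ x, x ∈ (⊤ : TopologicalSpace.Opens ℝ) := fun _ => trivial
  have hdI : ∀ (i : ℕ) (j : Fin (N - 1)) (x : ℝ),
      fval (dIter i (u s j)) (x + p) = fval (dIter i (u s j)) x := by
    intro i j
    induction i with
    | zero => exact hp s hs j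
    | succ i ih =>
      intro x
      rw [dIter_succ, fval_deriv _ (hx _), fval_deriv _ (hx _), ← deriv_comp_add_const]
      exact congrArg (fun g => deriv g x) (funext ih)
  induction h using MvPolynomial.induction_on with
  | C c => rw [evalDiff_C, fval_algebraMap c (hx _), fval_algebraMap c (hx _)]
  | add f g hf hg =>
    simp only [fval_evalDiff _ _ (hx _), map_add] at hf hg ⊢
    rw [hf, hg]
  | mul_X f q hf =>
    have hq := hdI q.2 q.1 x
    rw [← evalDiff_X] at hq
    simp only [fval_evalDiff _ _ (hx _), map_mul] at hf hq ⊢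
    rw [hf, hq]

theorem IsGDSolution.intervalIntegral_eq (hN : 2 ≤ N) (hT : IsOpen T) (hTc : T.OrdConnected)
    (hu : IsGDSolution N m T u) {p : ℝ} (hp : IsSpacePeriodic N T p u) {h F : DiffPoly N}
    (hF : gdFlow N m h = Differential.deriv F) (a : ℝ) {s₁ s₂ : ℝ} (h₁ : s₁ ∈ T) (h₂ : s₂ ∈ T) :
    ∫ x in a..(a + p), fval (evalDiff N (u s₁) h) x =
      ∫ x in a..(a + p), fval (evalDiff N (u s₂) h) x := by
  refine eq_of_hasDerivAt_zero (g := fun s => ∫ x in a..(a + p), fval (evalDiff N (u s) h) x)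
    hT hTc (fun s hs => ?_) h₁ h₂
  obtain ⟨ε, hε, hball⟩ := Metric.nhds_basis_closedBall.mem_iff.mp (hT.mem_nhds hs)
  obtain ⟨C, hC⟩ := ((isCompact_uIcc (a := a) (b := a + p)).prod
    (isCompact_closedBall s ε)).exists_bound_of_continuousOn
    ((hu.contDiffOn_evalDiff hT (gdFlow N m h)).continuousOn.mono
      (Set.prod_mono (Set.subset_univ _) hball))
  have key := (intervalIntegral.hasDerivAt_integral_of_dominated_loc_of_deriv_le
    (μ := MeasureTheory.volume) (a := a) (b := a + p)
    (F := fun σ x => fval (evalDiff N (u σ) h) x)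
    (F' := fun σ x => fval (evalDiff N (u σ) (gdFlow N m h)) x)
    (bound := fun _ => C)
    (Metric.closedBall_mem_nhds s hε)
    (Filter.Eventually.of_forall fun σ => (continuous_fval _).aestronglyMeasurable)
    ((continuous_fval _).intervalIntegrable _ _) (continuous_fval _).aestronglyMeasurable
    (Filter.Eventually.of_forall fun x hx σ hσ =>
      hC (x, σ) ⟨Set.uIoc_subset_uIcc hx, hσ⟩)
    intervalIntegrable_const
    (Filter.Eventually.of_forall fun x _ σ hσ =>
      hu.hasDerivAt_evalDiff hN hT h (hball hσ) x)).2
  -- The integral of the total derivative is a difference of boundary values, which agree by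
  -- periodicity.
  rwa [hF, intervalIntegral.integral_eq_sub_of_hasDerivAt
    (fun x _ => hasDerivAt_fval_evalDiff (u s) F trivial)
    ((continuous_fval _).intervalIntegrable _ _), hp.evalDiff_add hs, sub_self] at key

end solution

/-! ### Assembling the statement -/

theorem lop_zero {R : Type*} [CommRing R] (N : ℕ) :
    lop N (fun _ => (0 : R)) = mono 1 N := by
  ext n
  simp [lop, mono_coeff]

theorem fracPow_lop_zero {R : Type*} [CommRing R] [Differential R] {N : ℕ}
    (hN : IsUnit (N : R)) (m : ℕ) : (lop N fun _ => (0 : R)).fracPow N m = mono 1 m := by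
  have h : IsNthRoot N (lop N fun _ => (0 : R)) (mono 1 1) :=
    ⟨by rw [mono_coeff, if_pos rfl], fun n hn => by rw [mono_coeff, if_neg (by omega)],
      by rw [partial_pow, lop_zero]⟩
  rw [fracPow, IsNthRoot.unique hN (isNthRoot_lop hN _) h, partial_pow]

/-- At `u = 0` the operator is `∂^N`, whose fractional powers `∂^m` have no residue; evaluation
there returns the constant term. -/
theorem constantCoeff_diagDensity {N : ℕ} (hN : 2 ≤ N) (κ : ℤ) (k j : ℕ) :
    MvPolynomial.constantCoeff (diagDensity N κ k j) = 0 := by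
  have h0 := TopologicalSpace.Opens.mem_top (0 : ℝ)
  rw [← fval_algebraMap (MvPolynomial.constantCoeff (diagDensity N κ k j)) h0, ← evalDiff_zero,
    evalDiff_diagDensity hN, fracPow_lop_zero (smoothFn_isUnit hN), res, mono_coeff,
    if_neg (by omega), mul_zero, fval_eq_evalHom _ h0, map_zero]

theorem hadamard_diag_eq_evalDiff {N : ℕ} (hN : 2 ≤ N) {κ : ℤ} (hκ : IsHeatSign N κ)
    {I : TopologicalSpace.Opens ℝ} (u : Fin (N - 1) → SmoothFn I)
    (H : ℕ → Fin (N - 1) → ℝ → ℝ → ℂ) (hH : IsHadamard N κ u H) (k : ℕ) (hk : 1 ≤ k)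
    (j : Fin (N - 1)) (x : ℝ) (hx : x ∈ I) :
    H k j x x = fval (evalDiff N u (diagDensity N κ k j)) x := by
  rw [hadamard_diag hN hκ u H hH k hk j x hx, evalDiff_diagDensity hN,
    fval_eq_evalHom (_ * _) hx, map_mul, ← fval_eq_evalHom, ← fval_eq_evalHom,
    fval_algebraMap _ hx]

end

end GelfandDickey

theorem theorem5p1 (N : ℕ) (hN : 2 ≤ N) (κ : ℤ) (hκ : IsHeatSign N κ) :
    -- the `N`-th root of `L` exists and is unique, and the values on the diagonal are residues
    (∀ (I : TopologicalSpace.Opens ℝ) (u : Fin (N - 1) → SmoothFn I),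
      (∃! Q : PsDO (SmoothFn I), PsDO.IsNthRoot N (lop N u) Q) ∧
      ∀ H : ℕ → Fin (N - 1) → ℝ → ℝ → ℂ, IsHadamard N κ u H →
        ∀ k : ℕ, 1 ≤ k → ∀ j : Fin (N - 1), ∀ x ∈ I,
          H k j x x =
            diagConst N κ k j * fval ((lop N u).fracPow N (k * N - ((j : ℕ) + 1))).res x) ∧
    -- first integrals in the sense of differential polynomials modulo total derivatives
    (∃! Q : PsDO (DiffPoly N), PsDO.IsNthRoot N (lop N (indet N)) Q) ∧
    (∀ (m : ℕ) (n : ℤ),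
      gdFlow N m ((lop N (indet N)).coeff n) = (gdRHS N m (indet N)).coeff n) ∧
    (∀ k : ℕ, 1 ≤ k → ∀ j : Fin (N - 1),
      (∀ (I : TopologicalSpace.Opens ℝ) (u : Fin (N - 1) → SmoothFn I)
        (H : ℕ → Fin (N - 1) → ℝ → ℝ → ℂ), IsHadamard N κ u H →
          ∀ x ∈ I, H k j x x = fval (evalDiff N u (diagDensity N κ k j)) x) ∧
      ∀ m : ℕ, 1 ≤ m → ∃ F : DiffPoly N,
        gdFlow N m (diagDensity N κ k j) = Differential.deriv F) ∧
    -- first integrals in the sense of conserved quantities of solutions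
    (∀ m : ℕ, 1 ≤ m → ∀ T : Set ℝ, IsOpen T → T.OrdConnected →
      ∀ u : ℝ → Fin (N - 1) → SmoothFn (⊤ : TopologicalSpace.Opens ℝ), IsGDSolution N m T u →
      ∀ H : ℝ → ℕ → Fin (N - 1) → ℝ → ℝ → ℂ, (∀ s ∈ T, IsHadamard N κ (u s) (H s)) →
      ∀ k : ℕ, 1 ≤ k → ∀ j : Fin (N - 1),
        (IsRapidlyDecaying N T u →
          (∀ s ∈ T, MeasureTheory.Integrable (fun x => H s k j x x)) ∧
          ∀ s₁ ∈ T, ∀ s₂ ∈ T, ∫ x, H s₁ k j x x = ∫ x, H s₂ k j x x) ∧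
        (∀ p : ℝ, IsSpacePeriodic N T p u →
          ∀ a : ℝ, ∀ s₁ ∈ T, ∀ s₂ ∈ T,
            ∫ x in a..(a + p), H s₁ k j x x = ∫ x in a..(a + p), H s₂ k j x x)) := by
  refine ⟨fun I u => ⟨existsUnique_lop_root (smoothFn_isUnit hN) u,
      fun H hH k hk j x hx => hadamard_diag hN hκ u H hH k hk j x hx⟩,
    existsUnique_lop_root (diffPoly_isUnit hN) (indet N), gdFlow_lop_coeff hN,
    fun k hk j => ⟨fun I u H hH x hx => hadamard_diag_eq_evalDiff hN hκ u H hH k hk j x hx,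
      fun m _ => exists_gdFlow_diagDensity_eq_deriv hN κ k j m⟩, ?_⟩
  intro m _ T hT hTc u hu H hH k hk j
  obtain ⟨F, hF⟩ := exists_gdFlow_diagDensity_eq_deriv hN κ k j m
  have hdiag : ∀ s ∈ T, (fun x => H s k j x x) =
      fval (evalDiff N (u s) (diagDensity N κ k j)) := fun s hs => funext fun x =>
    hadamard_diag_eq_evalDiff hN hκ (u s) (H s) (hH s hs) k hk j x trivial
  refine ⟨fun hd => ⟨fun s hs => ?_, fun s₁ h₁ s₂ h₂ => ?_⟩, fun p hp a s₁ h₁ s₂ h₂ => ?_⟩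
  · rw [hdiag s hs]
    exact hd.integrable (constantCoeff_diagDensity hN κ k j) hs
  · rw [hdiag s₁ h₁, hdiag s₂ h₂]
    exact hu.integral_eq hN hT hTc hd (constantCoeff_diagDensity hN κ k j) hF h₁ h₂
  · rw [hdiag s₁ h₁, hdiag s₂ h₂]
    exact hu.intervalIntegral_eq hN hT hTc hp hF a h₁ h₂
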